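/- A polytope is \emph{rational} if all its vertices have rational coordinates. A $4$-polytope is \emph{$2$-simplicial} if all its $2$-faces are triangles and \emph{$2$-simple} if every edge lies in exactly three facets; $f_i$ is the number of its $i$-faces and $f_{03}$ the number of pairs (vertex, facet containing it). For $n\ge 0$ let $P^4_n\subset\mathbb R^4$ denote any stacked $4$-polytope with $n+5$ vertices, that is, any polytope obtained from a $4$-simplex by $n$ times taking the convex hull with a new point that lies beyond exactly one facet and beneath all other facets. A \emph{vertex truncation} $D_1(P)$ of a polytope $P$ is any set obtained by intersecting $P$ with closed half-spaces $H_v^+$, one for each vertex $v$ of $P$, such that $v\notin H_v^+$, all other vertices of $P$ lie in the interior of $H_v^+$, and from each edge of $P$ exactly one point remains, which is a relative interior point of that edge. (a) Every vertex truncation $D_1(P^4_n)$ of any such $P^4_n$ (whenever one exists) is a $2$-simplicial $2$-simple $4$-polytope with $$(f_0,f_1,f_2,f_3;f_{03})=(10+4n,\;30+18n,\;30+18n,\;10+4n;\;50+26n).$$ (b) Every stacked $4$-polytope $P^4_n$ is combinatorially equivalent (isomorphic face lattices) to a rational stacked $4$-polytope obtained by $n$ stackings that has a rational vertex truncation. (c)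 Consequently there are infinitely many combinatorially distinct rational $2$-simplicial $2$-simple $4$-polytopes of the form $D_1(P^4_n)$: one can choose for every $n\ge0$ a rational $D_1(P^4_n)$ so that those for different $n$ are not combinatorially equivalent. -/

import Mathlib

/-- Euclidean `d`-space. -/
abbrev Space (d : ℕ) := EuclideanSpace ℝ (Fin d)

namespace Polytope

variable {d : ℕ}

/-- The dimension of (the affine hull of) a nonempty set. -/
noncomputable def dim (F : Set (Space d)) : ℕ := Module.finrank ℝ (vectorSpan ℝ F)

/-- `P` is a convex `k`-polytope: the convex hull of a finite nonempty set, of dimension `k`. -/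
def IsPolytope (k : ℕ) (P : Set (Space d)) : Prop :=
  (∃ s : Set (Space d), s.Finite ∧ s.Nonempty ∧ P = convexHull ℝ s) ∧ dim P = k

/-- The vertices of a polytope. -/
def vertices (P : Set (Space d)) : Set (Space d) := P.extremePoints ℝ

/-- The face lattice of `P`: all sets `P ∩ H` with `H` a supporting hyperplane, together with
`∅` and `P` (both are exposed in Mathlib's sense), ordered by inclusion. -/
abbrev FaceLattice (P : Set (Space d)) := {F : Set (Space d) // IsExposed ℝ P F}

/-- Combinatorial equivalence: the face lattices are isomorphic. -/
def CombEquiv (P Q : Set (Space d)) : Prop := Nonempty (FaceLattice P ≃o FaceLattice Q)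

/-- `F` is a (nonempty) `k`-dimensional face of `P`. -/
def IsFaceOfDim (P : Set (Space d)) (k : ℕ) (F : Set (Space d)) : Prop :=
  IsExposed ℝ P F ∧ F.Nonempty ∧ dim F = k

/-- `F` is a facet of `P`: a face of codimension one. -/
def IsFacet (P F : Set (Space d)) : Prop :=
  IsExposed ℝ P F ∧ F.Nonempty ∧ dim F + 1 = dim P

/-- The number `f_k` of `k`-dimensional faces. -/
noncomputable def fNum (P : Set (Space d)) (k : ℕ) : ℕ :=
  {F : Set (Space d) | IsFaceOfDim P k F}.ncard

/-- The number `f_{jk}` of incident pairs of a `j`-face and a `k`-face. -/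
noncomputable def flagNum (P : Set (Space d)) (j k : ℕ) : ℕ :=
  {p : Set (Space d) × Set (Space d) |
    IsFaceOfDim P j p.1 ∧ IsFaceOfDim P k p.2 ∧ p.1 ⊆ p.2}.ncard

/-- `P` is `k`-simplicial: for every `k`-face `F` the interval `[∅, F]` of the face lattice is
boolean, that is, it is the face lattice of a `k`-simplex. -/
def IsSimplicial (k : ℕ) (P : Set (Space d)) : Prop :=
  ∀ F : FaceLattice P, IsFaceOfDim P k F.1 → Nonempty (Set.Iic F ≃o Finset (Fin (k + 1)))

/-- `P` is `h`-simple: for every face `F` of dimension `dim P - h - 1` the interval `[F, P]` of the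
face lattice is boolean, of length `h + 1`. -/
def IsSimple (h : ℕ) (P : Set (Space d)) : Prop :=
  ∀ F : FaceLattice P, F.1.Nonempty → dim F.1 + h + 1 = dim P →
    Nonempty (Set.Ici F ≃o Finset (Fin (h + 1)))

/-- All vertices of `P` have rational coordinates. -/
def IsRational (P : Set (Space d)) : Prop :=
  ∀ v ∈ vertices P, ∀ i, ∃ q : ℚ, v i = (q : ℝ)

/-- For a facet `F` of a full-dimensional `P`: the point `v` lies beyond `F`, that is, the
hyperplane spanned by `F` strictly separates `v` from the interior of `P`. -/
def IsBeyond (P F : Set (Space d)) (v : Space d) : Prop :=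
  ∃ (l : Space d →L[ℝ] ℝ) (c : ℝ),
    (∀ x ∈ P, l x ≤ c) ∧ F = {x ∈ P | l x = c} ∧ c < l v

/-- For a facet `F` of a full-dimensional `P`: the point `v` lies beneath `F`, that is, strictly on
the same side of the hyperplane spanned by `F` as the interior of `P`. -/
def IsBeneath (P F : Set (Space d)) (v : Space d) : Prop :=
  ∃ (l : Space d →L[ℝ] ℝ) (c : ℝ),
    (∀ x ∈ P, l x ≤ c) ∧ F = {x ∈ P | l x = c} ∧ l v < c

/-- `IsStacked n P`: `P` is a full-dimensional stacked polytope in `d`-space, obtained from a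
`d`-simplex by `n` successive stackings; a stacking adds a new vertex beyond one facet (and beneath
all the others). -/
inductive IsStacked : ℕ → Set (Space d) → Prop
  | simplex (v : Fin (d + 1) → Space d) (hv : AffineIndependent ℝ v) :
      IsStacked 0 (convexHull ℝ (Set.range v))
  | stack (n : ℕ) (P F : Set (Space d)) (v : Space d) (hP : IsStacked n P) (hF : IsFacet P F)
      (hv : IsBeyond P F v) (hv' : ∀ G, IsFacet P G → G ≠ F → IsBeneath P G v) :
      IsStacked (n + 1) (convexHull ℝ (insert v P))

/-- `D` is a vertex truncation `D_1(P)`: every vertex `v` of `P` is truncated by a closed half-space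
`{x | b v ≤ a v x}` that does not contain `v` but has all other vertices in its interior, and
exactly one point, a relative interior one, remains from every edge of `P`. -/
def IsVertexTruncation (P D : Set (Space d)) : Prop :=
  ∃ (a : Space d → (Space d →L[ℝ] ℝ)) (b : Space d → ℝ),
    (∀ v ∈ vertices P, a v v < b v ∧ ∀ w ∈ vertices P, w ≠ v → b v < a v w) ∧
    D = {x ∈ P | ∀ v ∈ vertices P, b v ≤ a v x} ∧
    ∀ e, IsFaceOfDim P 1 e → ∃ x ∈ intrinsicInterior ℝ e, e ∩ D = {x}

end Polytope

namespace Polytope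

open Set

/-! ### Polytopes given by vertices and inequalities at once -/

section General

variable {d : ℕ} {α β : Type*}

/-! When a polytope is given both as a hull of points and by inequalities, its faces correspond to
the point sets cut out by the inequalities (`HVRep.faceIso`), so the face lattice depends only on
the incidence relation. A stacking replaces one tetrahedron of the boundary complex by the four
tetrahedra that join its triangles to the new vertex. Hence every stacked 4-polytope realizes a
complex `K` built in the same way (`IsStacked.exists_realizes`), with 10+4n edges, 10+6n triangles
and 5+3n tetrahedra.

In a vertex truncation the two cuts at an edge must meet it in the same point, which is one bilinear
equation on the cutting functionals (`Truncates`). The geometric core is that no vertices arise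
besides these edge points. Two caps meet only in the point of a common edge
(`Truncates.isEdgePoint_of_mem_caps`), and a point on at most one cutting hyperplane and on no edge
can be moved both ways along a line (`Realizes.exists_direction`). So `D` has one vertex for each
edge of `P` and one facet for each facet and each vertex of `P` (`Truncates.hvRep`).

Its nonempty faces are then intervals of the face lattice of `P`. In dimensions 0 to 4 they are:
(edge, edge); (vertex, triangle); (∅, triangle) and (vertex, tetrahedron); (∅, tetrahedron) and
(vertex, P); (∅, P). Every 2-face is a triangle, and the edge ({v}, r) lies in three facets, namely
the two tetrahedra over r and the cut at v. Counting intervals gives the flag vector.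

Rationality goes by induction along the stackings, with a rational truncation carried along. A point
just beyond a facet, near the barycentre of its six edge points, is not cut off, so the old cuts can
be kept. The new vertex has only four neighbours, affinely independent together with it, so a new
cutting functional can be prescribed on these five points to satisfy the four new equations
(`Truncates.exists_stack`). The truncations are told apart by their total number of faces, 82+44n.
-/

theorem affineMap_sum {γ : Type*} (g : Space d →ᵃ[ℝ] ℝ) (s : Finset γ) (w : γ → ℝ)
    (x : γ → Space d) (hw : ∑ i ∈ s, w i = 1) :
    g (∑ i ∈ s, w i • x i) = ∑ i ∈ s, w i * g (x i) := by
  have h : ∀ y, g y = g.linear y + g 0 := fun y => congrFun g.decomp y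
  rw [h, map_sum]
  simp_rw [h (x _), mul_add, Finset.sum_add_distrib, ← Finset.sum_mul, hw, map_smul, smul_eq_mul,
    one_mul]

theorem affineMap_sum_apply {γ : Type*} (s : Finset γ) (g : γ → Space d →ᵃ[ℝ] ℝ) (x : Space d) :
    (∑ k ∈ s, g k) x = ∑ k ∈ s, g k x := by
  classical
  induction s using Finset.induction_on with
  | empty => simp
  | insert a s ha ih => simp [Finset.sum_insert ha, ih]

theorem affineMap_lineMap (g : Space d →ᵃ[ℝ] ℝ) (x y : Space d) (c : ℝ) :
    g (AffineMap.lineMap x y c) = (1 - c) * g x + c * g y := by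
  rw [AffineMap.apply_lineMap, AffineMap.lineMap_apply_ring]

theorem affineMap_add_smul (g : Space d →ᵃ[ℝ] ℝ) (x v : Space d) (c : ℝ) :
    g (x + c • v) = g x + c * g.linear v := by
  have := g.map_vadd x (c • v)
  simp only [vadd_eq_add, map_smul, smul_eq_mul] at this
  rw [add_comm x, this, add_comm]

/-- An affine functional of positive value stays positive under a small perturbation. -/
theorem exists_pos_forall_add_mul_pos {γ : Type*} (s : Finset γ) (a b : γ → ℝ)
    (ha : ∀ k ∈ s, 0 < a k) : ∃ ε > 0, ∀ c, |c| ≤ ε → ∀ k ∈ s, 0 < a k + c * b k := by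
  classical
  induction s using Finset.induction_on with
  | empty => exact ⟨1, one_pos, by simp⟩
  | insert k s hk ih =>
    obtain ⟨ε, hε, h⟩ := ih fun j hj => ha j (Finset.mem_insert_of_mem hj)
    have hak := ha k (Finset.mem_insert_self k s)
    have hb : 0 < |b k| + 1 := by positivity
    refine ⟨min ε (a k / (2 * (|b k| + 1))), by positivity, fun c hc j hj => ?_⟩
    rcases Finset.mem_insert.1 hj with rfl | hj
    · have h1 : |c| * (|b j| + 1) ≤ a j / 2 := by
        have := hc.trans (min_le_right _ _)
        rw [le_div_iff₀ (by positivity)] at this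
        linarith
      have h2 : |c * b j| ≤ a j / 2 := by
        rw [abs_mul]
        nlinarith [abs_nonneg c]
      linarith [neg_abs_le (c * b j)]
    · exact h c (hc.trans (min_le_left _ _)) j hj

/-- A simultaneous description of `P` as the convex hull of the points `p i`, `i ∈ V`, and by the
inequalities `0 ≤ g k x`, `k ∈ W`, with incidence relation `I`. -/
structure HVRep (V : Finset α) (W : Finset β) (I : α → β → Prop) (p : α → Space d)
    (g : β → Space d →ᵃ[ℝ] ℝ) (P : Set (Space d)) : Prop where
  hull : P = convexHull ℝ (p '' V)
  ineq : P = {x | ∀ k ∈ W, 0 ≤ g k x}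
  inc : ∀ i ∈ V, ∀ k ∈ W, g k (p i) = 0 ↔ I i k

/-- The sets of vertices cut out by a set of facets, together with the empty set. -/
def IsClosedSet (V : Finset α) (W : Finset β) (I : α → β → Prop) (S : Set α) : Prop :=
  S = ∅ ∨ ∃ A : Set β, S = {i | i ∈ V ∧ ∀ k ∈ W, k ∈ A → I i k}

/-- The functional exposing `F` vanishes on the direction space of `F`. If `G` had the same
direction space, the functional would be constant on `G` too, and `G` would lie in `F`. -/
theorem dim_lt_of_isExposed {P F G : Set (Space d)} (hF : IsExposed ℝ P F) (hF0 : F.Nonempty)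
    (hG : G ⊆ P) (hFG : F ⊂ G) : dim F < dim G := by
  obtain ⟨l, hl⟩ := hF hF0
  obtain ⟨x, hx⟩ := hF0
  obtain ⟨y, hyG, hyF⟩ := exists_of_ssubset hFG
  refine Submodule.finrank_lt_finrank_of_lt (lt_of_le_of_ne (vectorSpan_mono ℝ hFG.1) fun h => ?_)
  have hker : vectorSpan ℝ F ≤ LinearMap.ker (l : Space d →ₗ[ℝ] ℝ) := by
    rw [vectorSpan_def, Submodule.span_le]
    rintro _ ⟨a, ha, b, hb, rfl⟩
    rw [hl] at ha hb
    simp only [vsub_eq_sub, SetLike.mem_coe, LinearMap.mem_ker, ContinuousLinearMap.coe_coe,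
      map_sub]
    linarith [ha.2 b hb.1, hb.2 a ha.1]
  have hyx : y -ᵥ x ∈ vectorSpan ℝ F := by
    rw [h]; exact vsub_mem_vectorSpan ℝ hyG (hFG.1 hx)
  have h0 : l y = l x := by
    have := hker hyx
    simp only [vsub_eq_sub, LinearMap.mem_ker, ContinuousLinearMap.coe_coe, map_sub] at this
    linarith
  refine hyF ?_
  rw [hl] at hx ⊢
  exact ⟨hG hyG, fun z hz => (hx.2 z hz).trans h0.ge⟩

theorem dim_le (F : Set (Space d)) : dim F ≤ d := by
  simpa [dim] using Submodule.finrank_le (vectorSpan ℝ F)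

namespace HVRep

variable {V : Finset α} {W : Finset β} {I : α → β → Prop} {p : α → Space d}
  {g : β → Space d →ᵃ[ℝ] ℝ} {P : Set (Space d)}

theorem convex (h : HVRep V W I p g P) : Convex ℝ P := h.hull ▸ convex_convexHull ℝ _

theorem mem (h : HVRep V W I p g P) {i : α} (hi : i ∈ V) : p i ∈ P := by
  rw [h.hull]; exact subset_convexHull ℝ _ (mem_image_of_mem p hi)

theorem nonneg (h : HVRep V W I p g P) {x : Space d} (hx : x ∈ P) {k : β} (hk : k ∈ W) :
    0 ≤ g k x := by
  rw [h.ineq] at hx; exact hx k hk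

theorem pos (h : HVRep V W I p g P) {i : α} (hi : i ∈ V) {k : β} (hk : k ∈ W) (hik : ¬ I i k) :
    0 < g k (p i) :=
  (h.nonneg (h.mem hi) hk).lt_of_ne fun h0 => hik ((h.inc i hi k hk).1 h0.symm)

theorem isCompact (h : HVRep V W I p g P) : IsCompact P := by
  rw [h.hull]; exact ((V.finite_toSet).image p).isCompact_convexHull ℝ

/-- The sum of the chosen functionals is nonnegative on `P` and vanishes exactly where all of them
do, so its negative exposes the face. -/
theorem isExposed_face (h : HVRep V W I p g P) (A : Set β) :
    IsExposed ℝ P {x | x ∈ P ∧ ∀ k ∈ W, k ∈ A → g k x = 0} := by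
  classical
  rintro ⟨x₀, hx₀, hx₀'⟩
  let G : Space d →ᵃ[ℝ] ℝ := ∑ k ∈ W.filter (· ∈ A), g k
  have hG : ∀ x, G x = ∑ k ∈ W.filter (· ∈ A), g k x := affineMap_sum_apply _ _
  have hl : ∀ x, G x = G.linear x + G 0 := fun y => congrFun G.decomp y
  have hG0 : ∀ x ∈ P, ∀ k ∈ W.filter (· ∈ A), 0 ≤ g k x := fun x hx k hk =>
    h.nonneg hx (Finset.mem_filter.1 hk).1
  refine ⟨-(LinearMap.toContinuousLinearMap G.linear), ?_⟩
  ext x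
  simp only [mem_ofPred_eq, neg_apply, LinearMap.coe_toContinuousLinearMap',
    neg_le_neg_iff]
  constructor
  · rintro ⟨hx, hx'⟩
    refine ⟨hx, fun y hy => ?_⟩
    have h1 : G x = 0 := by
      rw [hG]
      exact Finset.sum_eq_zero fun k hk => hx' k (Finset.mem_filter.1 hk).1 (Finset.mem_filter.1 hk).2
    have h2 : 0 ≤ G y := by rw [hG]; exact Finset.sum_nonneg (hG0 y hy)
    linarith [hl x, hl y]
  · rintro ⟨hx, hx'⟩
    refine ⟨hx, fun k hk hkA => ?_⟩
    have h1 : G x₀ = 0 := by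
      rw [hG]
      exact Finset.sum_eq_zero fun k hk =>
        hx₀' k (Finset.mem_filter.1 hk).1 (Finset.mem_filter.1 hk).2
    have h2 : G x = 0 := by
      have : 0 ≤ G x := by rw [hG]; exact Finset.sum_nonneg (hG0 x hx)
      linarith [hl x, hl x₀, hx' x₀ hx₀]
    rw [hG] at h2
    exact (Finset.sum_eq_zero_iff_of_nonneg (hG0 x hx)).1 h2 k (Finset.mem_filter.2 ⟨hk, hkA⟩)

/-- A face is cut out by the inequalities tight on all of it: prolong the segment from `x` slightly
past a relatively interior point of `F`. -/
theorem eq_face_of_isExposed (h : HVRep V W I p g P) {F : Set (Space d)} (hF : IsExposed ℝ P F)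
    (hF0 : F.Nonempty) :
    F = {x | x ∈ P ∧ ∀ k ∈ W, k ∈ {k | ∀ y ∈ F, g k y = 0} → g k x = 0} := by
  classical
  refine Subset.antisymm (fun x hx => ⟨hF.subset hx, fun k _ hk => hk x hx⟩) ?_
  rintro x ⟨hxP, hx⟩
  -- Repeated midpoints give a point of `F` at which only the inequalities tight on all of `F` are
  -- tight.
  have hy : ∀ s ⊆ W, ∃ y ∈ F, ∀ k ∈ s, (∃ z ∈ F, g k z ≠ 0) → 0 < g k y := by
    intro s
    induction s using Finset.induction_on with
    | empty => intro _; obtain ⟨y, hy⟩ := hF0; exact ⟨y, hy, by simp⟩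
    | insert k s hk ih =>
      intro hs
      obtain ⟨y, hyF, hy⟩ := ih ((Finset.subset_insert k s).trans hs)
      by_cases hz : ∃ z ∈ F, g k z ≠ 0
      · obtain ⟨z, hzF, hz⟩ := hz
        refine ⟨AffineMap.lineMap y z (1 / 2 : ℝ),
          (hF.convex h.convex).lineMap_mem hyF hzF ⟨by norm_num, by norm_num⟩, ?_⟩
        intro j hj hj'
        have h1 := h.nonneg (hF.subset hyF) (hs hj)
        have h2 := h.nonneg (hF.subset hzF) (hs hj)
        rw [affineMap_lineMap]
        rcases Finset.mem_insert.1 hj with rfl | hj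
        · have := h2.lt_of_ne' hz
          linarith
        · have := hy j hj hj'
          linarith
      · refine ⟨y, hyF, fun j hj hj' => ?_⟩
        rcases Finset.mem_insert.1 hj with rfl | hj
        · exact absurd hj' hz
        · exact hy j hj hj'
  obtain ⟨y, hyF, hy⟩ := hy W subset_rfl
  obtain ⟨ε, hε, hε'⟩ := exists_pos_forall_add_mul_pos (W.filter fun k => 0 < g k y)
    (fun k => g k y) (fun k => g k y - g k x) (fun k hk => (Finset.mem_filter.1 hk).2)
  -- This point lies beyond `y` as seen from `x`. Since the exposing functional is maximal at `y`,
  -- it cannot be smaller at `x`.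
  have hz : AffineMap.lineMap y x (-ε) ∈ P := by
    rw [h.ineq]
    intro k hk
    rw [affineMap_lineMap]
    by_cases hk' : 0 < g k y
    · have := hε' ε (by rw [abs_of_pos hε]) k (Finset.mem_filter.2 ⟨hk, hk'⟩)
      linarith
    · have h0 : ∀ z ∈ F, g k z = 0 := by
        by_contra! hcon
        exact hk' (hy k hk hcon)
      rw [hx k hk h0, h0 y hyF]; simp
  obtain ⟨l, hl⟩ := hF hF0
  rw [hl] at hyF ⊢
  refine ⟨hxP, fun w hw => (hyF.2 w hw).trans ?_⟩
  have := hyF.2 _ hz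
  rw [AffineMap.lineMap_apply] at this
  simp only [vsub_eq_sub, vadd_eq_add, map_add, map_smul, map_sub, smul_eq_mul] at this
  nlinarith

/-- A convex combination attains the maximum of a linear functional only if every point of nonzero
weight attains it. -/
theorem eq_convexHull_of_isExposed (h : HVRep V W I p g P) {F : Set (Space d)}
    (hF : IsExposed ℝ P F) : F = convexHull ℝ (p '' {i | i ∈ V ∧ p i ∈ F}) := by
  classical
  have hFc := hF.convex h.convex
  refine Subset.antisymm (fun x hx => ?_) (convexHull_min ?_ hFc)
  · obtain ⟨l, hl⟩ := hF ⟨x, hx⟩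
    have hxP := hF.subset hx
    rw [h.hull, ← Finset.coe_image, Finset.mem_convexHull'] at hxP
    obtain ⟨w, hw0, hw1, hwx⟩ := hxP
    have hmem : ∀ y ∈ V.image p, w y ≠ 0 → y ∈ F := by
      intro y hy hwy
      have hPle : ∀ z ∈ V.image p, l z ≤ l x := fun z hz => by
        rw [hl] at hx
        obtain ⟨i, hi, rfl⟩ := Finset.mem_image.1 hz
        exact hx.2 _ (h.mem hi)
      have hsum : ∑ z ∈ V.image p, w z * (l x - l z) = 0 := by
        simp_rw [mul_sub, Finset.sum_sub_distrib, ← Finset.sum_mul, hw1]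
        nth_rewrite 1 [← hwx]
        rw [map_sum]
        simp
      have := (Finset.sum_eq_zero_iff_of_nonneg fun z hz =>
        mul_nonneg (hw0 z hz) (sub_nonneg.2 (hPle z hz))).1 hsum y hy
      have hlyx : l x = l y := by
        rcases mul_eq_zero.1 this with h0 | h0
        · exact absurd h0 hwy
        · linarith
      rw [hl] at hx ⊢
      obtain ⟨i, hi, rfl⟩ := Finset.mem_image.1 hy
      exact ⟨h.mem hi, fun z hz => (hx.2 z hz).trans hlyx.le⟩
    rw [← hwx, ← Finset.sum_filter_of_ne (p := fun y => w y ≠ 0)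
      (fun y hy hne => fun h0 => hne (by simp [h0]))]
    refine (convex_convexHull ℝ _).sum_mem (fun y hy => hw0 y (Finset.mem_filter.1 hy).1) ?_
      fun y hy => subset_convexHull ℝ _ ?_
    · rw [Finset.sum_filter_ne_zero, hw1]
    · obtain ⟨hy, hwy⟩ := Finset.mem_filter.1 hy
      have hyF := hmem y hy hwy
      obtain ⟨i, hi, rfl⟩ := Finset.mem_image.1 hy
      exact ⟨i, ⟨hi, hyF⟩, rfl⟩
  · rintro _ ⟨i, ⟨_, hi⟩, rfl⟩
    exact hi

/-- The face spanned by a closed set of vertices. -/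
theorem convexHull_closedSet (h : HVRep V W I p g P) (A : Set β) :
    convexHull ℝ (p '' {i | i ∈ V ∧ ∀ k ∈ W, k ∈ A → I i k}) =
      {x | x ∈ P ∧ ∀ k ∈ W, k ∈ A → g k x = 0} := by
  rw [h.eq_convexHull_of_isExposed (h.isExposed_face A)]
  congr 2
  ext i
  constructor
  · rintro ⟨hi, hA⟩
    exact ⟨hi, h.mem hi, fun k hk hkA => (h.inc i hi k hk).2 (hA k hk hkA)⟩
  · rintro ⟨hi, -, hA⟩
    exact ⟨hi, fun k hk hkA => (h.inc i hi k hk).1 (hA k hk hkA)⟩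

theorem isExposed_convexHull (h : HVRep V W I p g P) {S : Set α} (hS : IsClosedSet V W I S) :
    IsExposed ℝ P (convexHull ℝ (p '' S)) := by
  rcases hS with rfl | ⟨A, rfl⟩
  · simpa using isExposed_empty
  · rw [h.convexHull_closedSet]; exact h.isExposed_face A

theorem mem_convexHull_iff (h : HVRep V W I p g P) {S : Set α} (hS : IsClosedSet V W I S) {i : α}
    (hi : i ∈ V) : p i ∈ convexHull ℝ (p '' S) ↔ i ∈ S := by
  refine ⟨fun hp => ?_, fun hp => subset_convexHull ℝ _ (mem_image_of_mem p hp)⟩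
  rcases hS with rfl | ⟨A, rfl⟩
  · simp at hp
  · rw [h.convexHull_closedSet] at hp
    exact ⟨hi, fun k hk hkA => (h.inc i hi k hk).1 (hp.2 k hk hkA)⟩

theorem isClosedSet_of_isExposed (h : HVRep V W I p g P) {F : Set (Space d)}
    (hF : IsExposed ℝ P F) : IsClosedSet V W I {i | i ∈ V ∧ p i ∈ F} := by
  rcases F.eq_empty_or_nonempty with rfl | hF0
  · exact Or.inl (by simp)
  · refine Or.inr ⟨{k | ∀ y ∈ F, g k y = 0}, ?_⟩
    have hF' := h.eq_face_of_isExposed hF hF0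
    ext i
    constructor
    · rintro ⟨hi, hpi⟩
      exact ⟨hi, fun k hk hkA => (h.inc i hi k hk).1 (hkA _ hpi)⟩
    · rintro ⟨hi, hA⟩
      refine ⟨hi, ?_⟩
      rw [hF']
      exact ⟨h.mem hi, fun k hk hkA => (h.inc i hi k hk).2 (hA k hk hkA)⟩

theorem subset_of_isClosedSet {S : Set α} (hS : IsClosedSet V W I S) {i : α} (hi : i ∈ S) :
    i ∈ V := by
  rcases hS with rfl | ⟨A, rfl⟩
  · exact hi.elim
  · exact hi.1

theorem convexHull_subset_iff (h : HVRep V W I p g P) {S T : Set α} (hS : IsClosedSet V W I S)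
    (hT : IsClosedSet V W I T) :
    convexHull ℝ (p '' S) ⊆ convexHull ℝ (p '' T) ↔ S ⊆ T :=
  ⟨fun hst _ hi => (h.mem_convexHull_iff hT (subset_of_isClosedSet hS hi)).1
    (hst (subset_convexHull ℝ _ (mem_image_of_mem p hi))),
  fun hst => convexHull_mono (image_mono hst)⟩

/-- The face lattice is the lattice of closed sets of vertices. -/
def faceIso (h : HVRep V W I p g P) :
    {S : Set α // IsClosedSet V W I S} ≃o FaceLattice P where
  toFun S := ⟨convexHull ℝ (p '' S.1), h.isExposed_convexHull S.2⟩
  invFun F := ⟨{i | i ∈ V ∧ p i ∈ F.1}, h.isClosedSet_of_isExposed F.2⟩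
  left_inv S := Subtype.ext <| by
    ext i
    exact ⟨fun hi => (h.mem_convexHull_iff S.2 hi.1).1 hi.2, fun hi =>
      ⟨subset_of_isClosedSet S.2 hi, (h.mem_convexHull_iff S.2 (subset_of_isClosedSet S.2 hi)).2 hi⟩⟩
  right_inv F := Subtype.ext (h.eq_convexHull_of_isExposed F.2).symm
  map_rel_iff' {S T} := h.convexHull_subset_iff S.2 T.2

/-- Both face lattices are isomorphic to the lattice of closed sets, in which only `V`, `W` and `I`
occur. -/
theorem combEquiv (h : HVRep V W I p g P) {q : α → Space d} {g' : β → Space d →ᵃ[ℝ] ℝ}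
    {Q : Set (Space d)} (h' : HVRep V W I q g' Q) : CombEquiv P Q :=
  ⟨h.faceIso.symm.trans h'.faceIso⟩

theorem mem_vertices (h : HVRep V W I p g P) {i : α} (hi : IsClosedSet V W I {i}) :
    p i ∈ vertices P := by
  have := (h.isExposed_convexHull hi).isExtreme
  rw [image_singleton, convexHull_singleton] at this
  exact isExtreme_singleton.1 this

theorem vertices_subset (h : HVRep V W I p g P) : vertices P ⊆ p '' V := by
  rw [vertices, h.hull]; exact extremePoints_convexHull_subset

end HVRep

end General

/-! ### Boundary complexes of stacked polytopes -/

section Combinatorics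

/-- The facets of the boundary complex after stacking a new vertex `v` onto the facet `f`. -/
def stackFacets (K : Finset (Finset ℕ)) (f : Finset ℕ) (v : ℕ) : Finset (Finset ℕ) :=
  K.erase f ∪ f.image fun w => insert v (f.erase w)

/-- The boundary complexes of stacked `4`-polytopes with `n + 5` vertices, given by their facets. -/
inductive StackedComplex : ℕ → Finset (Finset ℕ) → Prop
  | simplex : StackedComplex 0 ((Finset.range 5).powersetCard 4)
  | stack (n : ℕ) (K : Finset (Finset ℕ)) (f : Finset ℕ) (hK : StackedComplex n K) (hf : f ∈ K) :
      StackedComplex (n + 1) (stackFacets K f (n + 5))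

/-- The faces with `j` vertices of the complex with facets `K`. -/
def skel (K : Finset (Finset ℕ)) (j : ℕ) : Finset (Finset ℕ) :=
  K.biUnion (Finset.powersetCard j)

theorem mem_skel {K : Finset (Finset ℕ)} {j : ℕ} {t : Finset ℕ} :
    t ∈ skel K j ↔ ∃ f ∈ K, t ⊆ f ∧ t.card = j := by
  simp [skel, Finset.mem_powersetCard]

/-- A pure three-dimensional simplicial complex on the vertex set `range N`, such that every
`2`-face lies in exactly two facets. -/
structure IsComplex (N : ℕ) (K : Finset (Finset ℕ)) : Prop where
  five_le : 5 ≤ N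
  sub : ∀ f ∈ K, f ⊆ Finset.range N
  card : ∀ f ∈ K, f.card = 4
  ridge : ∀ r ∈ skel K 3, (K.filter (r ⊆ ·)).card = 2
  cover : ∀ i < N, ∃ f ∈ K, i ∈ f

namespace IsComplex

variable {N : ℕ} {K : Finset (Finset ℕ)}

/-- The second tetrahedron through the triangle opposite `w`. It cannot contain `w`, since it would
then contain, and by cardinality equal, `f`. -/
theorem neighbour (h : IsComplex N K) {f : Finset ℕ} (hf : f ∈ K) {w : ℕ} (hw : w ∈ f) :
    ∃ f' ∈ K, f' ≠ f ∧ f.erase w ⊆ f' ∧ w ∉ f' := by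
  have hc := h.card f hf
  have hr : f.erase w ∈ skel K 3 :=
    mem_skel.2 ⟨f, hf, Finset.erase_subset _ _, by rw [Finset.card_erase_of_mem hw, hc]⟩
  have h2 := h.ridge _ hr
  obtain ⟨f', hf', hne⟩ := Finset.exists_mem_ne (by omega : 1 < (K.filter (f.erase w ⊆ ·)).card) f
  obtain ⟨hf'K, hsub⟩ := Finset.mem_filter.1 hf'
  refine ⟨f', hf'K, hne, hsub, fun hw' => hne ?_⟩
  refine (Finset.eq_of_subset_of_card_le (fun x hx => ?_) ?_).symm
  · by_cases hxw : x = w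
    · exact hxw ▸ hw'
    · exact hsub (Finset.mem_erase.2 ⟨hxw, hx⟩)
  · rw [hc, h.card f' hf'K]

theorem lt (h : IsComplex N K) {f : Finset ℕ} (hf : f ∈ K) {i : ℕ} (hi : i ∈ f) : i < N :=
  Finset.mem_range.1 (h.sub f hf hi)

theorem nonempty (h : IsComplex N K) : K.Nonempty := by
  obtain ⟨f, hf, -⟩ := h.cover 0 (by have := h.five_le; omega)
  exact ⟨f, hf⟩

end IsComplex

theorem mem_stackFacets {K : Finset (Finset ℕ)} {f e : Finset ℕ} {v : ℕ} :
    e ∈ stackFacets K f v ↔ (e ≠ f ∧ e ∈ K) ∨ ∃ w ∈ f, insert v (f.erase w) = e := by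
  simp [stackFacets]

theorem exists_subset_erase {f t : Finset ℕ} (ht : t ⊆ f) (h : t.card < f.card) :
    ∃ w ∈ f, t ⊆ f.erase w := by
  obtain ⟨w, hw, hwt⟩ := Finset.exists_mem_notMem_of_card_lt_card h
  exact ⟨w, hw, fun x hx => Finset.mem_erase.2 ⟨fun hxw => hwt (hxw ▸ hx), ht hx⟩⟩

section Stack

variable {N : ℕ} {K : Finset (Finset ℕ)} {f : Finset ℕ}

theorem IsComplex.notMem (h : IsComplex N K) {f : Finset ℕ} (hf : f ∈ K) : N ∉ f :=
  fun hN => lt_irrefl _ (h.lt hf hN)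

/-- A proper subset of `f` misses some `w`, hence survives in the new facet omitting `w`. The bound
on `j` excludes `f` itself, the only face that is lost. -/
theorem IsComplex.skel_stackFacets (h : IsComplex N K) (hf : f ∈ K) {j : ℕ} (hj : j < 3) :
    skel (stackFacets K f N) (j + 1) =
      skel K (j + 1) ∪ (f.powersetCard j).image (insert N) := by
  have hfc := h.card f hf
  ext t
  simp only [mem_skel, Finset.mem_union, Finset.mem_image, Finset.mem_powersetCard,
    mem_stackFacets]
  constructor
  · rintro ⟨e, ⟨-, he⟩ | ⟨w, hw, rfl⟩, hte, htc⟩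
    · exact Or.inl ⟨e, he, hte, htc⟩
    · by_cases hN : N ∈ t
      · refine Or.inr ⟨t.erase N, ⟨fun x hx => ?_, by rw [Finset.card_erase_of_mem hN]; omega⟩,
          Finset.insert_erase hN⟩
        obtain ⟨hxN, hxt⟩ := Finset.mem_erase.1 hx
        exact Finset.mem_of_mem_erase (Finset.mem_of_mem_insert_of_ne (hte hxt) hxN)
      · refine Or.inl ⟨f, hf, fun x hx => ?_, htc⟩
        exact Finset.mem_of_mem_erase
          (Finset.mem_of_mem_insert_of_ne (hte hx) fun hxN => hN (hxN ▸ hx))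
  · rintro (⟨e, he, hte, htc⟩ | ⟨s, ⟨hs, hsc⟩, rfl⟩)
    · by_cases hef : e = f
      · subst hef
        obtain ⟨w, hw, htw⟩ := exists_subset_erase hte (by omega)
        exact ⟨_, Or.inr ⟨w, hw, rfl⟩, htw.trans (Finset.subset_insert _ _), htc⟩
      · exact ⟨e, Or.inl ⟨hef, he⟩, hte, htc⟩
    · obtain ⟨w, hw, hsw⟩ := exists_subset_erase hs (by omega)
      refine ⟨_, Or.inr ⟨w, hw, rfl⟩, Finset.insert_subset_insert _ hsw, ?_⟩
      rw [Finset.card_insert_of_notMem fun hN => h.notMem hf (hs hN), hsc]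

theorem IsComplex.card_skel_stackFacets (h : IsComplex N K) (hf : f ∈ K) {j : ℕ} (hj : j < 3) :
    (skel (stackFacets K f N) (j + 1)).card = (skel K (j + 1)).card + Nat.choose 4 j := by
  rw [h.skel_stackFacets hf hj, Finset.card_union_of_disjoint, Finset.card_image_of_injOn,
    Finset.card_powersetCard, h.card f hf]
  · intro s hs t ht hst
    have hs' := Finset.mem_powersetCard.1 hs
    have ht' := Finset.mem_powersetCard.1 ht
    have := congrArg (fun r => Finset.erase r N) hst
    simpa [Finset.erase_insert (fun hN => h.notMem hf (hs'.1 hN)),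
      Finset.erase_insert (fun hN => h.notMem hf (ht'.1 hN))] using this
  · rw [Finset.disjoint_left]
    rintro t ht ht'
    obtain ⟨e, he, hte, -⟩ := mem_skel.1 ht
    obtain ⟨s, -, rfl⟩ := Finset.mem_image.1 ht'
    exact h.notMem he (hte (Finset.mem_insert_self _ _))

theorem IsComplex.insert_erase_injOn (h : IsComplex N K) (hf : f ∈ K) :
    InjOn (fun w => insert N (f.erase w)) (f : Set ℕ) := by
  intro a ha b hb hab
  by_contra hne
  have h1 : a ∈ insert N (f.erase b) :=
    Finset.mem_insert_of_mem (Finset.mem_erase.2 ⟨hne, ha⟩)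
  have h2 : a ∈ insert N (f.erase a) := by rw [show insert N (f.erase a) = _ from hab]; exact h1
  rcases Finset.mem_insert.1 h2 with h3 | h3
  · exact h.notMem hf (h3 ▸ ha)
  · exact Finset.notMem_erase _ _ h3

theorem IsComplex.disjoint_stackFacets (h : IsComplex N K) (f : Finset ℕ) :
    Disjoint (K.erase f) (f.image fun w => insert N (f.erase w)) := by
  rw [Finset.disjoint_left]
  rintro t ht ht'
  obtain ⟨w, -, rfl⟩ := Finset.mem_image.1 ht'
  exact h.notMem (Finset.mem_of_mem_erase ht) (Finset.mem_insert_self _ _)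

theorem IsComplex.card_stackFacets (h : IsComplex N K) (hf : f ∈ K) :
    (stackFacets K f N).card = K.card + 3 := by
  rw [stackFacets, Finset.card_union_of_disjoint (h.disjoint_stackFacets f),
    Finset.card_image_of_injOn (h.insert_erase_injOn hf), h.card f hf, Finset.card_erase_of_mem hf]
  have := Finset.card_pos.2 h.nonempty
  omega

theorem IsComplex.stackFacets (h : IsComplex N K) (hf : f ∈ K) :
    IsComplex (N + 1) (stackFacets K f N) where
  five_le := by have := h.five_le; omega
  sub e he := by
    have hr : Finset.range N ⊆ Finset.range (N + 1) := Finset.range_subset_range.2 (by omega)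
    rcases mem_stackFacets.1 he with ⟨-, he⟩ | ⟨w, hw, rfl⟩
    · exact (h.sub e he).trans hr
    · refine Finset.insert_subset (by simp) ?_
      exact (Finset.erase_subset _ _).trans ((h.sub f hf).trans hr)
  card e he := by
    rcases mem_stackFacets.1 he with ⟨-, he⟩ | ⟨w, hw, rfl⟩
    · exact h.card e he
    · rw [Finset.card_insert_of_notMem fun hN => h.notMem hf (Finset.mem_of_mem_erase hN),
        Finset.card_erase_of_mem hw, h.card f hf]
  cover i hi := by
    rcases Nat.lt_succ_iff_lt_or_eq.1 hi with hi | rfl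
    · obtain ⟨e, he, hie⟩ := h.cover i hi
      by_cases hef : e = f
      · subst hef
        obtain ⟨w, hw, hwi⟩ := exists_subset_erase (Finset.singleton_subset_iff.2 hie)
          (by rw [h.card e he]; simp)
        exact ⟨_, mem_stackFacets.2 (Or.inr ⟨w, hw, rfl⟩),
          Finset.mem_insert_of_mem (Finset.singleton_subset_iff.1 hwi)⟩
      · exact ⟨e, mem_stackFacets.2 (Or.inl ⟨hef, he⟩), hie⟩
    · obtain ⟨w, hw⟩ : f.Nonempty := Finset.card_pos.1 (by rw [h.card f hf]; norm_num)
      exact ⟨_, mem_stackFacets.2 (Or.inr ⟨w, hw, rfl⟩), Finset.mem_insert_self _ _⟩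
  ridge r hr := by
    have hfc := h.card f hf
    have himg : ((f.image fun w => insert N (f.erase w)).filter (r ⊆ ·)).card =
        (f.filter fun w => r ⊆ insert N (f.erase w)).card := by
      rw [Finset.filter_image, Finset.card_image_of_injOn]
      exact (h.insert_erase_injOn hf).mono fun x hx => by simp at hx; exact hx.1
    rw [h.skel_stackFacets hf (by norm_num)] at hr
    rw [Polytope.stackFacets, Finset.filter_union,
      Finset.card_union_of_disjoint (Finset.disjoint_filter_filter (h.disjoint_stackFacets f)),
      himg]
    -- An old triangle in `f` trades `f` for the one new facet that omits its opposite vertex; other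
    -- old triangles keep their two facets. A new triangle consists of `N` and two vertices of `f`,
    -- and lies in the facets omitting one of the other two.
    rcases Finset.mem_union.1 hr with hr | hr
    · obtain ⟨e, he, hre, hrc⟩ := mem_skel.1 hr
      have hNr : N ∉ r := fun hN => h.notMem he (hre hN)
      have hsub : ∀ w, r ⊆ insert N (f.erase w) ↔ r ⊆ f ∧ w ∉ r := by
        intro w
        constructor
        · intro hw
          refine ⟨fun x hx => ?_, fun hwr => ?_⟩
          · exact Finset.mem_of_mem_erase
              (Finset.mem_of_mem_insert_of_ne (hw hx) fun hxN => hNr (hxN ▸ hx))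
          · exact Finset.notMem_erase _ _
              (Finset.mem_of_mem_insert_of_ne (hw hwr) fun hxN => hNr (hxN ▸ hwr))
        · rintro ⟨h1, h2⟩ x hx
          exact Finset.mem_insert_of_mem (Finset.mem_erase.2 ⟨fun hxw => h2 (hxw ▸ hx), h1 hx⟩)
      simp_rw [hsub]
      have h2 := h.ridge r hr
      by_cases hrf : r ⊆ f
      · have h3 : (f.filter fun w => r ⊆ f ∧ w ∉ r).card = 1 := by
          have : (f.filter fun w => r ⊆ f ∧ w ∉ r) = f \ r := by
            ext x; simp [hrf]
          rw [this, Finset.card_sdiff_of_subset hrf]; omega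
        rw [h3, Finset.filter_erase, Finset.card_erase_of_mem (Finset.mem_filter.2 ⟨hf, hrf⟩), h2]
      · simp only [hrf, false_and, Finset.filter_false, Finset.card_empty, add_zero]
        rw [Finset.filter_erase, Finset.erase_eq_of_notMem, h2]
        simp [hrf]
    · obtain ⟨s, hs, rfl⟩ := Finset.mem_image.1 hr
      obtain ⟨hsf, hsc⟩ := Finset.mem_powersetCard.1 hs
      have hNs : N ∉ s := fun hN => h.notMem hf (hsf hN)
      have h1 : (K.erase f).filter (insert N s ⊆ ·) = ∅ := by
        refine Finset.filter_eq_empty_iff.2 fun e he hse => ?_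
        exact h.notMem (Finset.mem_of_mem_erase he) (hse (Finset.mem_insert_self _ _))
      have h2 : (f.filter fun w => insert N s ⊆ insert N (f.erase w)) = f \ s := by
        ext x
        simp only [Finset.mem_filter, Finset.mem_sdiff, and_congr_right_iff]
        intro hx
        constructor
        · intro hsub hxs
          exact Finset.notMem_erase _ _ (Finset.mem_of_mem_insert_of_ne
            (hsub (Finset.mem_insert_of_mem hxs)) fun hxN => hNs (hxN ▸ hxs))
        · intro hxs
          exact Finset.insert_subset_insert _ fun y hy =>
            Finset.mem_erase.2 ⟨fun hyx => hxs (hyx ▸ hy), hsf hy⟩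
      rw [h1, h2, Finset.card_sdiff_of_subset hsf]
      simp; omega

end Stack

theorem StackedComplex.isComplex {n : ℕ} {K : Finset (Finset ℕ)} (h : StackedComplex n K) :
    IsComplex (n + 5) K := by
  induction h with
  | simplex =>
    refine ⟨le_rfl, fun f hf => (Finset.mem_powersetCard.1 hf).1,
      fun f hf => (Finset.mem_powersetCard.1 hf).2, ?_, ?_⟩
    · decide
    · decide
  | stack n K f hK hf ih =>
    rw [show n + 1 + 5 = n + 5 + 1 by ring]
    exact ih.stackFacets hf

theorem StackedComplex.card {n : ℕ} {K : Finset (Finset ℕ)} (h : StackedComplex n K) :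
    K.card = 5 + 3 * n ∧ (skel K 2).card = 10 + 4 * n ∧ (skel K 3).card = 10 + 6 * n := by
  induction h with
  | simplex => decide
  | stack n K f hK hf ih =>
    obtain ⟨h1, h2, h3⟩ := ih
    have hc := hK.isComplex
    rw [hc.card_stackFacets hf, hc.card_skel_stackFacets hf (j := 1) (by norm_num),
      hc.card_skel_stackFacets hf (j := 2) (by norm_num), h1, h2, h3]
    refine ⟨by ring, ?_, ?_⟩ <;> simp [Nat.choose] <;> ring

theorem exists_stackedComplex (n : ℕ) : ∃ K, StackedComplex n K := by
  induction n with
  | zero => exact ⟨_, .simplex⟩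
  | succ n ih =>
    obtain ⟨K, hK⟩ := ih
    obtain ⟨f, hf⟩ := hK.isComplex.nonempty
    exact ⟨_, .stack n K f hK hf⟩

end Combinatorics

/-! ### Stacked polytopes realize stacked complexes -/

section Realization

/-- `P` is a polytope with vertices `p i`, `i < N`, whose facets are given by `K`. -/
abbrev Realizes {d : ℕ} (N : ℕ) (K : Finset (Finset ℕ)) (p : ℕ → Space d)
    (g : Finset ℕ → Space d →ᵃ[ℝ] ℝ) (P : Set (Space d)) : Prop :=
  HVRep (Finset.range N) K (fun i f => i ∈ f) p g P

theorem dim_convexHull {d : ℕ} (s : Set (Space d)) : dim (convexHull ℝ s) = dim s := by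
  rw [dim, dim, ← direction_affineSpan, affineSpan_convexHull, direction_affineSpan]

theorem convexHull_insert_convexHull {d : ℕ} (v : Space d) (s : Set (Space d)) :
    convexHull ℝ (insert v (convexHull ℝ s)) = convexHull ℝ (insert v s) := by
  refine Subset.antisymm (convexHull_min ?_ (convex_convexHull ℝ _))
    (convexHull_mono (insert_subset_insert (subset_convexHull ℝ s)))
  exact insert_subset (subset_convexHull ℝ _ (mem_insert _ _))
    (convexHull_mono (subset_insert _ _))

/-- Barycentric coordinates with respect to a point `q` and four further points, whose affine
independence is witnessed by a triangular system of functionals. -/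
theorem exists_barycentric {f : Finset ℕ} (hf : f.card = 4) {p : ℕ → Space 4} {q : Space 4}
    {g : Space 4 →ᵃ[ℝ] ℝ} {h : ℕ → Space 4 →ᵃ[ℝ] ℝ} (hg : ∀ w ∈ f, g (p w) = 0) (hgq : g q ≠ 0)
    (hh : ∀ w ∈ f, ∀ w' ∈ f, w' ≠ w → h w (p w') = 0) (hhw : ∀ w ∈ f, h w (p w) ≠ 0)
    (x : Space 4) : ∃ (c₀ : ℝ) (c : ℕ → ℝ), c₀ + ∑ w ∈ f, c w = 1 ∧
      x = c₀ • q + ∑ w ∈ f, c w • p w ∧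
      ∀ φ : Space 4 →ᵃ[ℝ] ℝ, φ x = c₀ * φ q + ∑ w ∈ f, c w * φ (p w) := by
  have hsub : ∀ (φ : Space 4 →ᵃ[ℝ] ℝ) y, φ.linear (y - q) = φ y - φ q := fun φ y => by
    have := φ.linearMap_vsub y q
    simpa using this
  have hli : LinearIndependent ℝ (fun w : f => p w - q) := by
    rw [Fintype.linearIndependent_iff]
    intro c hc
    have key : ∀ φ : Space 4 →ᵃ[ℝ] ℝ, ∑ w : f, c w * (φ (p w) - φ q) = 0 := fun φ => by
      have := congrArg φ.linear hc
      simpa [map_sum, -map_sub, hsub] using this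
    -- As `g` vanishes at every `p w`, only the sum of the coefficients survives. Once that is zero,
    -- `h w` isolates the coefficient of `w`.
    have h0 : ∑ w : f, c w = 0 := by
      have := key g
      simp_rw [fun w : f => hg w w.2, zero_sub, ← Finset.sum_mul] at this
      exact (mul_eq_zero.1 this).resolve_right (neg_ne_zero.2 hgq)
    intro w
    have := key (h w)
    simp_rw [mul_sub, Finset.sum_sub_distrib, ← Finset.sum_mul, h0, zero_mul, sub_zero] at this
    rw [Finset.sum_eq_single w (fun w' _ hne => by
      rw [hh w w.2 w' w'.2 fun hx => hne (Subtype.ext hx), mul_zero]) (by simp)] at this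
    exact (mul_eq_zero.1 this).resolve_right (hhw w w.2)
  have hspan := hli.span_eq_top_of_card_eq_finrank' (by simp [hf])
  have hx : x - q ∈ Submodule.span ℝ (range fun w : f => p w - q) := by rw [hspan]; trivial
  obtain ⟨c, hc⟩ := (Submodule.mem_span_range_iff_exists_fun ℝ).1 hx
  classical
  let c' : ℕ → ℝ := fun w => if hw : w ∈ f then c ⟨w, hw⟩ else 0
  have hsum : ∀ {M : Type} [AddCommMonoid M] (F : ℝ → ℕ → M),
      ∑ w ∈ f, F (c' w) w = ∑ w : f, F (c w) w := by
    intro M _ F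
    rw [← Finset.sum_coe_sort]
    exact Finset.sum_congr rfl fun w _ => by simp [c']
  refine ⟨1 - ∑ w ∈ f, c' w, c', by ring, ?_, fun φ => ?_⟩
  · rw [hsum (fun a w => a • p w), hsum fun a _ => a, sub_smul, one_smul, Finset.sum_smul]
    have : x = q + ∑ w : f, c w • (p w - q) := by rw [hc]; abel
    rw [this]
    simp_rw [smul_sub, Finset.sum_sub_distrib]
    abel
  · rw [hsum (fun a w => a * φ (p w)), hsum fun a _ => a, sub_mul, one_mul, Finset.sum_mul]
    have h1 : φ x = φ q + φ.linear (x - q) := by rw [hsub]; ring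
    rw [h1, ← hc, map_sum]
    simp_rw [map_smul, hsub, smul_eq_mul, mul_sub, Finset.sum_sub_distrib]
    ring

variable {N : ℕ} {K : Finset (Finset ℕ)} {p : ℕ → Space 4} {g : Finset ℕ → Space 4 →ᵃ[ℝ] ℝ}
  {P : Set (Space 4)}

/-- A subset of a facet is the intersection of the facets containing it: a vertex `i` of `f` outside
`t` is missed by the neighbour across the triangle opposite `i`, which still contains `t`. -/
theorem IsComplex.isClosedSet_face (hK : IsComplex N K) {f t : Finset ℕ} (hf : f ∈ K)
    (ht : t ⊆ f) : IsClosedSet (Finset.range N) K (fun i f => i ∈ f) (t : Set ℕ) := by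
  refine Or.inr ⟨{e | t ⊆ e}, ?_⟩
  ext i
  refine ⟨fun hi => ⟨hK.sub f hf (ht hi), fun e _ hte => hte hi⟩, fun ⟨_, hi⟩ => ?_⟩
  by_contra hit
  obtain ⟨f', hf', -, hsub, hif'⟩ := hK.neighbour hf (hi f hf ht)
  exact hif' (hi f' hf' ((fun x hx => hsub (Finset.mem_erase.2
    ⟨fun hxi => hit (hxi ▸ hx), ht hx⟩) : t ⊆ f')))

theorem IsComplex.isClosedSet_singleton (hK : IsComplex N K) {i : ℕ} (hi : i < N) :
    IsClosedSet (Finset.range N) K (fun i f => i ∈ f) {i} := by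
  obtain ⟨f, hf, hif⟩ := hK.cover i hi
  simpa using hK.isClosedSet_face hf (Finset.singleton_subset_iff.2 hif)

theorem IsComplex.eq_of_isClosedSet (_ : IsComplex N K) {S : Set ℕ}
    (hS : IsClosedSet (Finset.range N) K (fun i f => i ∈ f) S) :
    S = ∅ ∨ S = (Finset.range N : Set ℕ) ∨ ∃ f ∈ K, ∃ t ⊆ f, S = (t : Set ℕ) := by
  classical
  rcases hS with rfl | ⟨A, rfl⟩
  · exact Or.inl rfl
  · right
    by_cases h : ∃ f ∈ K, f ∈ A
    · obtain ⟨f, hf, hfA⟩ := h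
      refine Or.inr ⟨f, hf, f.filter fun i => i ∈ Finset.range N ∧ ∀ k ∈ K, k ∈ A → i ∈ k,
        Finset.filter_subset _ _, ?_⟩
      ext i
      simp only [mem_ofPred_eq, Finset.coe_filter]
      exact ⟨fun hi => ⟨hi.2 f hf hfA, hi⟩, fun hi => hi.2⟩
    · push Not at h
      left
      ext i
      simp only [mem_ofPred_eq, Finset.mem_coe]
      exact ⟨fun hi => hi.1, fun hi => ⟨hi, fun k hk hkA => absurd hkA (h k hk)⟩⟩

theorem IsComplex.exists_notMem (hK : IsComplex N K) {f : Finset ℕ} (hf : f ∈ K) :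
    ∃ i < N, i ∉ f := by
  obtain ⟨i, hi, hif⟩ := Finset.exists_mem_notMem_of_card_lt_card
    (s := f) (t := Finset.range N) (by have := hK.five_le; rw [hK.card f hf]; simp; omega)
  exact ⟨i, Finset.mem_range.1 hi, hif⟩

namespace Realizes

theorem injOn (hK : IsComplex N K) (h : Realizes N K p g P) :
    InjOn p (Finset.range N : Set ℕ) := by
  intro i hi j hj hij
  have h1 := (h.mem_convexHull_iff (hK.isClosedSet_singleton (Finset.mem_range.1 hj)) hi).1 (by
    rw [hij]; exact subset_convexHull ℝ _ ⟨j, rfl, rfl⟩)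
  exact h1

theorem vertices_eq (hK : IsComplex N K) (h : Realizes N K p g P) :
    vertices P = p '' (Finset.range N : Set ℕ) := by
  refine Subset.antisymm h.vertices_subset ?_
  rintro _ ⟨i, hi, rfl⟩
  exact h.mem_vertices (hK.isClosedSet_singleton (Finset.mem_range.1 hi))

/-- Counting points bounds the dimension from above. Adding the vertices one at a time gives
strictly increasing exposed faces, which bounds it from below. -/
theorem dim_face (hK : IsComplex N K) (h : Realizes N K p g P) {f : Finset ℕ} (hf : f ∈ K)
    {t : Finset ℕ} (ht : t ⊆ f) (ht0 : t.Nonempty) :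
    dim (convexHull ℝ (p '' (t : Set ℕ))) + 1 = t.card := by
  classical
  have hup : ∀ t : Finset ℕ, t.Nonempty → dim (convexHull ℝ (p '' (t : Set ℕ))) + 1 ≤ t.card := by
    intro t ht0
    have := finrank_vectorSpan_image_finset_le ℝ p t (n := t.card - 1)
      (by have := ht0.card_pos; omega)
    rw [dim_convexHull, dim, ← Finset.coe_image]
    have := ht0.card_pos
    omega
  refine le_antisymm (hup t ht0) ?_
  induction t using Finset.induction_on with
  | empty => simp at ht0
  | insert a s ha ih =>
    rcases s.eq_empty_or_nonempty with rfl | hs0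
    · simp
    have hs := ih ((Finset.subset_insert a s).trans ht) hs0
    have hclt := hK.isClosedSet_face hf ht
    have hcls := hK.isClosedSet_face hf ((Finset.subset_insert a s).trans ht)
    have : dim (convexHull ℝ (p '' (s : Set ℕ))) <
        dim (convexHull ℝ (p '' ((insert a s : Finset ℕ) : Set ℕ))) := by
      refine dim_lt_of_isExposed (h.isExposed_convexHull hcls) (by simpa using hs0)
        (h.isExposed_convexHull hclt).subset ⟨(h.convexHull_subset_iff hcls hclt).2 (by simp), ?_⟩
      rw [h.convexHull_subset_iff hclt hcls]
      intro hsub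
      exact ha (by simpa using hsub (show a ∈ ((insert a s : Finset ℕ) : Set ℕ) by simp))
    rw [Finset.card_insert_of_notMem ha]
    omega

theorem isExposed_facet (hK : IsComplex N K) (h : Realizes N K p g P) {f : Finset ℕ}
    (hf : f ∈ K) : IsExposed ℝ P (convexHull ℝ (p '' (f : Set ℕ))) :=
  h.isExposed_convexHull (hK.isClosedSet_face hf subset_rfl)

/-- A facet has dimension 3 and is a proper exposed face, while the ambient space has dimension 4.
-/
theorem dim_eq (hK : IsComplex N K) (h : Realizes N K p g P) : dim P = 4 := by
  obtain ⟨f, hf⟩ := hK.nonempty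
  have hc := hK.card f hf
  have hf0 : f.Nonempty := Finset.card_pos.1 (by omega)
  have h1 := dim_face hK h hf subset_rfl hf0
  have h2 : dim (convexHull ℝ (p '' (f : Set ℕ))) < dim P := by
    refine dim_lt_of_isExposed (isExposed_facet hK h hf) (by simpa using hf0) subset_rfl
      ⟨(isExposed_facet hK h hf).subset, ?_⟩
    obtain ⟨i, hi, hif⟩ := hK.exists_notMem hf
    intro hsub
    exact hif ((h.mem_convexHull_iff (hK.isClosedSet_face hf subset_rfl)
      (Finset.mem_range.2 hi)).1 (hsub (h.mem (Finset.mem_range.2 hi))))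
  have := dim_le P
  omega

theorem facet_eq (hK : IsComplex N K) (h : Realizes N K p g P) {f : Finset ℕ} (hf : f ∈ K) :
    convexHull ℝ (p '' (f : Set ℕ)) = {x | x ∈ P ∧ g f x = 0} := by
  have := h.convexHull_closedSet {f}
  have h1 : {i | i ∈ Finset.range N ∧ ∀ k ∈ K, k ∈ ({f} : Set (Finset ℕ)) → i ∈ k} =
      (f : Set ℕ) := by
    ext i
    simp only [mem_singleton_iff, mem_ofPred_eq, Finset.mem_coe]
    exact ⟨fun hi => hi.2 f hf rfl, fun hi => ⟨hK.sub f hf hi, fun k _ hk => hk ▸ hi⟩⟩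
  rw [h1] at this
  rw [this]
  ext x
  simp only [mem_singleton_iff, mem_ofPred_eq]
  exact ⟨fun hx => ⟨hx.1, hx.2 f hf rfl⟩, fun hx => ⟨hx.1, fun k _ hk => hk ▸ hx.2⟩⟩

theorem isFacet (hK : IsComplex N K) (h : Realizes N K p g P) {f : Finset ℕ} (hf : f ∈ K) :
    IsFacet P (convexHull ℝ (p '' (f : Set ℕ))) := by
  have hf0 : f.Nonempty := Finset.card_pos.1 (by rw [hK.card f hf]; norm_num)
  exact ⟨isExposed_facet hK h hf, by simpa using hf0,
    by rw [dim_face hK h hf subset_rfl hf0, dim_eq hK h, hK.card f hf]⟩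

theorem exists_of_isExposed (hK : IsComplex N K) (h : Realizes N K p g P) {F : Set (Space 4)}
    (hF : IsExposed ℝ P F) (hF0 : F.Nonempty) :
    F = P ∨ ∃ f ∈ K, ∃ t ⊆ f, t.Nonempty ∧ F = convexHull ℝ (p '' (t : Set ℕ)) := by
  have h1 := h.eq_convexHull_of_isExposed hF
  rcases hK.eq_of_isClosedSet (h.isClosedSet_of_isExposed hF) with hS | hS | ⟨f, hf, t, ht, hS⟩
  · rw [hS] at h1; simp [h1] at hF0
  · rw [hS] at h1; exact Or.inl (h1.trans h.hull.symm)
  · rw [hS] at h1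
    refine Or.inr ⟨f, hf, t, ht, ?_, h1⟩
    rw [h1] at hF0; simpa using hF0

theorem exists_of_isFacet (hK : IsComplex N K) (h : Realizes N K p g P) {F : Set (Space 4)}
    (hF : IsFacet P F) : ∃ f ∈ K, F = convexHull ℝ (p '' (f : Set ℕ)) := by
  obtain ⟨hFe, hF0, hd⟩ := hF
  rcases exists_of_isExposed hK h hFe hF0 with rfl | ⟨f, hf, t, ht, ht0, rfl⟩
  · omega
  · rw [dim_face hK h hf ht ht0, dim_eq hK h] at hd
    rw [Finset.eq_of_subset_of_card_le ht (by rw [hK.card f hf, hd])]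
    exact ⟨f, hf, rfl⟩

theorem isFaceOfDim_one (hK : IsComplex N K) (h : Realizes N K p g P) {e : Set (Space 4)} :
    IsFaceOfDim P 1 e ↔ ∃ t ∈ skel K 2, e = convexHull ℝ (p '' (t : Set ℕ)) := by
  constructor
  · rintro ⟨he, he0, hd⟩
    rcases exists_of_isExposed hK h he he0 with rfl | ⟨f, hf, t, ht, ht0, rfl⟩
    · rw [dim_eq hK h] at hd; omega
    · have := dim_face hK h hf ht ht0
      exact ⟨t, mem_skel.2 ⟨f, hf, ht, by omega⟩, rfl⟩
  · rintro ⟨t, ht, rfl⟩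
    obtain ⟨f, hf, htf, htc⟩ := mem_skel.1 ht
    have ht0 : t.Nonempty := Finset.card_pos.1 (by omega)
    have := dim_face hK h hf htf ht0
    exact ⟨h.isExposed_convexHull (hK.isClosedSet_face hf htf), by simpa using ht0, by omega⟩

theorem facet_injective (hK : IsComplex N K) (h : Realizes N K p g P) {e f : Finset ℕ}
    (he : e ∈ K) (hf : f ∈ K)
    (hef : convexHull ℝ (p '' (e : Set ℕ)) = convexHull ℝ (p '' (f : Set ℕ))) : e = f := by
  have h1 := (h.convexHull_subset_iff (hK.isClosedSet_face he subset_rfl)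
    (hK.isClosedSet_face hf subset_rfl)).1 hef.le
  exact Finset.eq_of_subset_of_card_le (by exact_mod_cast h1) (by rw [hK.card e he, hK.card f hf])

/-- Barycentric coordinates with respect to the vertices of a facet and a point off the facet. -/
theorem exists_barycentric (hK : IsComplex N K) (h : Realizes N K p g P) {f : Finset ℕ}
    (hf : f ∈ K) {q : Space 4} (hq : g f q ≠ 0) (x : Space 4) :
    ∃ (c₀ : ℝ) (c : ℕ → ℝ), c₀ + ∑ w ∈ f, c w = 1 ∧ x = c₀ • q + ∑ w ∈ f, c w • p w ∧
      ∀ φ : Space 4 →ᵃ[ℝ] ℝ, φ x = c₀ * φ q + ∑ w ∈ f, c w * φ (p w) := by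
  have hnb : ∀ w, ∃ f', w ∈ f → f' ∈ K ∧ f.erase w ⊆ f' ∧ w ∉ f' := fun w => by
    by_cases hw : w ∈ f
    · obtain ⟨f', h1, -, h2, h3⟩ := hK.neighbour hf hw
      exact ⟨f', fun _ => ⟨h1, h2, h3⟩⟩
    · exact ⟨∅, fun hw' => absurd hw' hw⟩
  choose nb hnb using hnb
  refine Polytope.exists_barycentric (h := fun w => g (nb w)) (hK.card f hf)
    (fun w hw => (h.inc w (hK.sub f hf hw) f hf).2 hw) hq ?_ ?_ x
  · intro w hw w' hw' hne
    exact (h.inc w' (hK.sub f hf hw') _ (hnb w hw).1).2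
      ((hnb w hw).2.1 (Finset.mem_erase.2 ⟨hne, hw'⟩))
  · intro w hw
    exact fun h0 => (hnb w hw).2.2 ((h.inc w (hK.sub f hf hw) _ (hnb w hw).1).1 h0)

/-- Facet-defining functionals are unique up to a scalar. -/
theorem exists_eq_mul (hK : IsComplex N K) (h : Realizes N K p g P) {f : Finset ℕ} (hf : f ∈ K)
    {φ : Space 4 →ᵃ[ℝ] ℝ} (hφ : ∀ x ∈ P, 0 ≤ φ x) (hφ0 : ∀ w ∈ f, φ (p w) = 0) :
    ∃ c : ℝ, 0 ≤ c ∧ ∀ x, φ x = c * g f x := by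
  obtain ⟨i, hi, hif⟩ := hK.exists_notMem hf
  have hi' := Finset.mem_range.2 hi
  have hpos := h.pos hi' hf hif
  -- Functionals vanishing on `f` are determined by their value at one vertex off `f`; the scalar
  -- compares these values.
  refine ⟨φ (p i) / g f (p i), div_nonneg (hφ _ (h.mem hi')) hpos.le, fun x => ?_⟩
  obtain ⟨c₀, c, -, -, hc⟩ := exists_barycentric hK h hf hpos.ne' x
  have h1 := hc φ
  have h2 := hc (g f)
  rw [Finset.sum_eq_zero fun w hw => by rw [hφ0 w hw, mul_zero]] at h1
  rw [Finset.sum_eq_zero fun w hw => by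
    rw [(h.inc w (hK.sub f hf hw) f hf).2 hw, mul_zero]] at h2
  rw [h1, h2]
  field_simp
  ring

/-- A supporting functional in the form used for `IsBeyond` and `IsBeneath`. -/
theorem exists_mul_of_supporting (hK : IsComplex N K) (h : Realizes N K p g P) {f : Finset ℕ}
    (hf : f ∈ K) {l : Space 4 →L[ℝ] ℝ} {c : ℝ} (hl : ∀ x ∈ P, l x ≤ c)
    (hF : convexHull ℝ (p '' (f : Set ℕ)) = {x ∈ P | l x = c}) :
    ∃ a : ℝ, 0 ≤ a ∧ ∀ x, c - l x = a * g f x := by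
  refine exists_eq_mul hK h hf
    (φ := AffineMap.const ℝ (Space 4) c - (l : Space 4 →ₗ[ℝ] ℝ).toAffineMap) ?_ ?_
  · intro x hx
    simpa using hl x hx
  · intro w hw
    have : p w ∈ convexHull ℝ (p '' (f : Set ℕ)) :=
      subset_convexHull ℝ _ (mem_image_of_mem p hw)
    rw [hF] at this
    simp [this.2]

/-- Whichever supporting functional is used for the facet, its slack is a nonnegative multiple of `g
f`, so a negative slack at `v` forces `g f v` to be negative. -/
theorem neg_of_isBeyond (hK : IsComplex N K) (h : Realizes N K p g P) {f : Finset ℕ}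
    (hf : f ∈ K) {v : Space 4} (hv : IsBeyond P (convexHull ℝ (p '' (f : Set ℕ))) v) :
    g f v < 0 := by
  obtain ⟨l, c, hl, hF, hcv⟩ := hv
  obtain ⟨a, ha, hal⟩ := exists_mul_of_supporting hK h hf hl hF
  have := hal v
  by_contra! hcon
  have := mul_nonneg ha hcon
  linarith

theorem pos_of_isBeneath (hK : IsComplex N K) (h : Realizes N K p g P) {f : Finset ℕ}
    (hf : f ∈ K) {v : Space 4} (hv : IsBeneath P (convexHull ℝ (p '' (f : Set ℕ))) v) :
    0 < g f v := by
  obtain ⟨l, c, hl, hF, hcv⟩ := hv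
  obtain ⟨a, ha, hal⟩ := exists_mul_of_supporting hK h hf hl hF
  have := hal v
  by_contra! hcon
  have := mul_nonpos_of_nonneg_of_nonpos ha hcon
  linarith

theorem facet_supporting (hK : IsComplex N K) (h : Realizes N K p g P) {f : Finset ℕ}
    (hf : f ∈ K) : ∃ (l : Space 4 →L[ℝ] ℝ) (c : ℝ), (∀ x ∈ P, l x ≤ c) ∧
      convexHull ℝ (p '' (f : Set ℕ)) = {x ∈ P | l x = c} ∧ ∀ x, c - l x = g f x := by
  have hl : ∀ x, g f x = (g f).linear x + g f 0 := fun y => congrFun (g f).decomp y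
  refine ⟨-(LinearMap.toContinuousLinearMap (g f).linear), g f 0, fun x hx => ?_, ?_, fun x => ?_⟩
  · have := h.nonneg hx hf
    have := hl x
    simp only [neg_apply, LinearMap.coe_toContinuousLinearMap']
    linarith
  · rw [facet_eq hK h hf]
    ext x
    have := hl x
    simp only [neg_apply, LinearMap.coe_toContinuousLinearMap', mem_ofPred_eq,
      and_congr_right_iff]
    intro _
    constructor <;> intro h0 <;> linarith
  · have := hl x
    simp only [neg_apply, LinearMap.coe_toContinuousLinearMap']
    linarith

theorem isBeyond (hK : IsComplex N K) (h : Realizes N K p g P) {f : Finset ℕ}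
    (hf : f ∈ K) {v : Space 4} (hv : g f v < 0) :
    IsBeyond P (convexHull ℝ (p '' (f : Set ℕ))) v := by
  obtain ⟨l, c, h1, h2, h3⟩ := facet_supporting hK h hf
  exact ⟨l, c, h1, h2, by linarith [h3 v]⟩

theorem isBeneath (hK : IsComplex N K) (h : Realizes N K p g P) {f : Finset ℕ}
    (hf : f ∈ K) {v : Space 4} (hv : 0 < g f v) :
    IsBeneath P (convexHull ℝ (p '' (f : Set ℕ))) v := by
  obtain ⟨l, c, h1, h2, h3⟩ := facet_supporting hK h hf
  exact ⟨l, c, h1, h2, by linarith [h3 v]⟩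

/-- Supporting functionals of the facets that contain a point stacked onto `f`. -/
theorem exists_dual (hK : IsComplex N K) (h : Realizes N K p g P) {f : Finset ℕ} (hf : f ∈ K)
    {v : Space 4} (hv : g f v < 0) (hv' : ∀ e ∈ K, e ≠ f → 0 < g e v) :
    ∃ φ : ℕ → Space 4 →ᵃ[ℝ] ℝ, (∀ w, φ w v = 0) ∧
      (∀ w ∈ f, ∀ w' ∈ f, w' ≠ w → φ w (p w') = 0) ∧ (∀ w ∈ f, 0 < φ w (p w)) ∧
      (∀ w ∈ f, ∀ x ∈ P, 0 ≤ φ w x) ∧ (∀ w ∈ f, ∀ i < N, i ∉ f → 0 < φ w (p i)) ∧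
      ∀ w ∈ f, ∃ e ∈ K, φ w = g e v • g f - g f v • g e := by
  classical
  have hnb : ∀ w, ∃ f', w ∈ f → f' ∈ K ∧ f' ≠ f ∧ f.erase w ⊆ f' ∧ w ∉ f' := fun w => by
    by_cases hw : w ∈ f
    · obtain ⟨f', h1⟩ := hK.neighbour hf hw
      exact ⟨f', fun _ => h1⟩
    · exact ⟨∅, fun hw' => absurd hw' hw⟩
  choose nb hnb using hnb
  -- The member of the pencil of hyperplanes through the triangle opposite `w` that passes through
  -- `v`. Both coefficients, `g (nb w) v` and `-g f v`, are positive, so nonnegativity on `P` is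
  -- inherited.
  let φ : ℕ → Space 4 →ᵃ[ℝ] ℝ := fun w => g (nb w) v • g f - g f v • g (nb w)
  have hφ : ∀ w x, φ w x = g (nb w) v * g f x - g f v * g (nb w) x := fun w x => by simp [φ]
  have hφv : ∀ w, φ w v = 0 := fun w => by rw [hφ]; ring
  have hpf : ∀ w ∈ f, g f (p w) = 0 := fun w hw => (h.inc w (hK.sub f hf hw) f hf).2 hw
  have hφ0 : ∀ w ∈ f, ∀ w' ∈ f, w' ≠ w → φ w (p w') = 0 := fun w hw w' hw' hne => by
    rw [hφ, hpf w' hw', (h.inc w' (hK.sub f hf hw') _ (hnb w hw).1).2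
      ((hnb w hw).2.2.1 (Finset.mem_erase.2 ⟨hne, hw'⟩))]
    ring
  have hφw : ∀ w ∈ f, 0 < φ w (p w) := fun w hw => by
    have h1 := h.pos (hK.sub f hf hw) (hnb w hw).1 (hnb w hw).2.2.2
    rw [hφ, hpf w hw]
    nlinarith
  have hφP : ∀ w ∈ f, ∀ x ∈ P, 0 ≤ φ w x := fun w hw x hx => by
    have h1 := h.nonneg hx hf
    have h2 := h.nonneg hx (hnb w hw).1
    have h3 := hv' _ (hnb w hw).1 (hnb w hw).2.1
    rw [hφ]
    nlinarith [mul_nonneg h3.le h1, mul_nonneg (neg_nonneg.2 hv.le) h2]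
  have hφi : ∀ w ∈ f, ∀ i < N, i ∉ f → 0 < φ w (p i) := fun w hw i hi hif => by
    have hi' := Finset.mem_range.2 hi
    have h1 := h.pos hi' hf hif
    have h2 := h.nonneg (h.mem hi') (hnb w hw).1
    have h3 := hv' _ (hnb w hw).1 (hnb w hw).2.1
    rw [hφ]
    nlinarith [mul_pos h3 h1, mul_nonneg (neg_nonneg.2 hv.le) h2]
  exact ⟨φ, hφv, hφ0, hφw, hφP, hφi, fun w hw => ⟨nb w, (hnb w hw).1, rfl⟩⟩

/-- Stacking a point onto a facet: the facets of the new polytope. -/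
theorem stack (hK : IsComplex N K) (h : Realizes N K p g P) {f : Finset ℕ} (hf : f ∈ K)
    {v : Space 4} (hv : g f v < 0) (hv' : ∀ e ∈ K, e ≠ f → 0 < g e v) :
    ∃ g' : Finset ℕ → Space 4 →ᵃ[ℝ] ℝ,
      Realizes (N + 1) (stackFacets K f N) (Function.update p N v) g'
        (convexHull ℝ (insert v P)) ∧
      ∀ e ∈ stackFacets K f N, e ∈ K ∧ g' e = g e ∨
        ∃ e₁ ∈ K, ∃ e₂ ∈ K, g' e = g e₁ v • g e₂ - g e₂ v • g e₁ := by
  classical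
  obtain ⟨φ, hφv, hφ0, hφw, hφP, hφi, hφg⟩ := exists_dual hK h hf hv hv'
  have hpf : ∀ w ∈ f, g f (p w) = 0 := fun w hw => (h.inc w (hK.sub f hf hw) f hf).2 hw
  have hsd : ∀ w ∈ f, (f \ insert N (f.erase w)).sum id = w := fun w hw => by
    have : f \ insert N (f.erase w) = {w} := by
      ext x
      simp only [Finset.mem_sdiff, Finset.mem_insert, Finset.mem_erase, Finset.mem_singleton]
      constructor
      · rintro ⟨hx, hx'⟩
        by_contra hne
        exact hx' (Or.inr ⟨hne, hx⟩)
      · rintro rfl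
        refine ⟨hw, ?_⟩
        rintro (rfl | h0)
        · exact hK.notMem hf hw
        · exact h0.1 rfl
    rw [this]; simp
  -- For a new facet `e` the set `f \ e` has one element, the omitted vertex, and the sum reads it
  -- off.
  let g' : Finset ℕ → Space 4 →ᵃ[ℝ] ℝ := fun e => if N ∈ e then φ ((f \ e).sum id) else g e
  have hg'old : ∀ e ∈ K, g' e = g e := fun e he => if_neg (hK.notMem he)
  have hg'new : ∀ w ∈ f, g' (insert N (f.erase w)) = φ w := fun w hw => by
    simp only [g', Finset.mem_insert_self, if_true, hsd w hw]
  have hpN : ∀ i ∈ Finset.range N, Function.update p N v i = p i := fun i hi =>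
    Function.update_of_ne (by rintro rfl; simp at hi) _ _
  have himg : Function.update p N v '' (Finset.range (N + 1) : Set ℕ) =
      insert v (p '' (Finset.range N : Set ℕ)) := by
    rw [Finset.range_add_one, Finset.coe_insert, image_insert_eq, Function.update_self]
    congr 1
    exact image_congr fun i hi => hpN i hi
  refine ⟨g', ⟨?_, ?_, ?_⟩, ?_⟩
  · rw [himg, h.hull, convexHull_insert_convexHull]
  · refine Subset.antisymm (convexHull_min (insert_subset ?_ ?_) ?_) ?_
    · intro e he
      rcases mem_stackFacets.1 he with ⟨hef, he⟩ | ⟨w, hw, rfl⟩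
      · rw [hg'old e he]; exact (hv' e he hef).le
      · rw [hg'new w hw, hφv]
    · intro x hx e he
      rcases mem_stackFacets.1 he with ⟨hef, he⟩ | ⟨w, hw, rfl⟩
      · rw [hg'old e he]; exact h.nonneg hx he
      · rw [hg'new w hw]; exact hφP w hw x hx
    · intro x hx y hy a b ha hb hab e he
      have : g' e (a • x + b • y) = a * g' e x + b * g' e y := by
        rw [Convex.combo_affine_apply hab, smul_eq_mul, smul_eq_mul]
      rw [this]
      exact add_nonneg (mul_nonneg ha (hx e he)) (mul_nonneg hb (hy e he))
    · intro x hx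
      -- On the inner side of `f` the point lies in `P`. On the outer side it lies in the simplex
      -- spanned by `v` and `f`: `g f` and the `φ w` give the signs of its barycentric coordinates.
      by_cases hfx : 0 ≤ g f x
      · refine subset_convexHull ℝ _ (Or.inr ?_)
        rw [h.ineq]
        intro e he
        by_cases hef : e = f
        · exact hef ▸ hfx
        · have := hx e (mem_stackFacets.2 (Or.inl ⟨hef, he⟩))
          rwa [hg'old e he] at this
      · push Not at hfx
        obtain ⟨c₀, c, hc1, hcx, hc⟩ := Polytope.exists_barycentric (hK.card f hf) hpf hv.ne
          hφ0 (fun w hw => (hφw w hw).ne') x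
        have h0 : 0 ≤ c₀ := by
          have := hc (g f)
          rw [Finset.sum_eq_zero fun w hw => by rw [hpf w hw, mul_zero]] at this
          nlinarith
        have h1 : ∀ w ∈ f, 0 ≤ c w := fun w hw => by
          have := hc (φ w)
          rw [hφv, Finset.sum_eq_single w (fun w' hw' hne => by
            rw [hφ0 w hw w' hw' hne, mul_zero]) (fun h => absurd hw h)] at this
          have h2 := hx _ (mem_stackFacets.2 (Or.inr ⟨w, hw, rfl⟩))
          rw [hg'new w hw, this] at h2
          have h3 := hφw w hw
          by_contra! hneg
          nlinarith
        have hcv : Convex ℝ (convexHull ℝ (insert v P)) := convex_convexHull ℝ _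
        have hsum : c₀ • v + ∑ w ∈ f, c w • p w =
            ∑ w ∈ insert N f, (if w = N then c₀ else c w) • Function.update p N v w := by
          rw [Finset.sum_insert (hK.notMem hf)]
          simp only [if_true, Function.update_self]
          congr 1
          refine Finset.sum_congr rfl fun w hw => ?_
          have hne : w ≠ N := by rintro rfl; exact hK.notMem hf hw
          rw [if_neg hne, Function.update_of_ne hne]
        rw [hcx, hsum]
        refine hcv.sum_mem ?_ ?_ ?_
        · intro w hw
          split_ifs with hwN
          · exact h0
          · exact h1 w ((Finset.mem_insert.1 hw).resolve_left hwN)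
        · rw [Finset.sum_insert (hK.notMem hf), if_pos rfl, ← hc1]
          congr 1
          refine Finset.sum_congr rfl fun w hw => if_neg ?_
          rintro rfl; exact hK.notMem hf hw
        · intro w hw
          rcases Finset.mem_insert.1 hw with rfl | hw
          · rw [Function.update_self]; exact subset_convexHull ℝ _ (mem_insert _ _)
          · rw [hpN w (hK.sub f hf hw)]
            exact subset_convexHull ℝ _ (Or.inr (h.mem (hK.sub f hf hw)))
  · intro i hi e he
    rcases Nat.lt_succ_iff_lt_or_eq.1 (Finset.mem_range.1 hi) with hiN | rfl
    · have hi' := Finset.mem_range.2 hiN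
      rw [hpN i hi']
      rcases mem_stackFacets.1 he with ⟨hef, he⟩ | ⟨w, hw, rfl⟩
      · rw [hg'old e he]; exact h.inc i hi' e he
      · rw [hg'new w hw]
        by_cases hif : i ∈ f
        · by_cases hiw : i = w
          · subst hiw
            simp [(hφw i hif).ne', hiN.ne]
          · simp [hφ0 w hw i hif hiw, hif, hiw]
        · simp [(hφi w hw i hiN hif).ne', hif, hiN.ne]
    · rw [Function.update_self]
      rcases mem_stackFacets.1 he with ⟨hef, he⟩ | ⟨w, hw, rfl⟩
      · rw [hg'old e he]
        simp [(hv' e he hef).ne', hK.notMem he]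
      · rw [hg'new w hw]
        simp [hφv]
  · intro e he
    rcases mem_stackFacets.1 he with ⟨hef, he⟩ | ⟨w, hw, rfl⟩
    · exact Or.inl ⟨he, hg'old e he⟩
    · obtain ⟨e₁, he₁, h1⟩ := hφg w hw
      exact Or.inr ⟨e₁, he₁, f, hf, (hg'new w hw).trans h1⟩

/-- The facets of a simplex. -/
theorem simplex (b : AffineBasis (Fin 5) ℝ (Space 4)) :
    Realizes 5 ((Finset.range 5).powersetCard 4) (fun i => b (Fin.ofNat 5 i))
      (fun e => b.coord (Fin.ofNat 5 ((Finset.range 5 \ e).sum id)))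
      (convexHull ℝ (range b)) where
  hull := by
    congr 1
    ext x
    constructor
    · rintro ⟨i, rfl⟩
      exact ⟨i, by simp, by simp⟩
    · rintro ⟨i, -, rfl⟩
      exact ⟨_, rfl⟩
  ineq := by
    rw [b.convexHull_eq_nonneg_coord]
    ext x
    refine ⟨fun h e _ => h _, fun h i => ?_⟩
    -- The complement of a four-element set is a single index, which the sum returns; every index
    -- arises in this way.
    have : ∀ i : Fin 5, ∃ e ∈ (Finset.range 5).powersetCard 4,
        Fin.ofNat 5 ((Finset.range 5 \ e).sum id) = i := by decide
    obtain ⟨e, he, rfl⟩ := this i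
    exact h e he
  inc := by
    intro i hi e he
    rw [b.coord_apply]
    have : ∀ i ∈ Finset.range 5, ∀ e ∈ (Finset.range 5).powersetCard 4,
        (Fin.ofNat 5 ((Finset.range 5 \ e).sum id) ≠ Fin.ofNat 5 i ↔ i ∈ e) := by decide
    rw [← this i hi e he]
    simp

end Realizes

/-- Every stacked polytope realizes a stacked complex. -/
theorem IsStacked.exists_realizes {n : ℕ} {P : Set (Space 4)} (hP : IsStacked n P) :
    ∃ K p g, StackedComplex n K ∧ Realizes (n + 5) K p g P := by
  induction hP with
  | simplex v hv =>
    let b : AffineBasis (Fin 5) ℝ (Space 4) :=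
      ⟨v, hv, hv.affineSpan_eq_top_iff_card_eq_finrank_add_one.2 (by simp)⟩
    exact ⟨_, _, _, .simplex, Realizes.simplex b⟩
  | stack n P F v hP hF hv hv' ih =>
    obtain ⟨K, p, g, hS, h⟩ := ih
    have hK := hS.isComplex
    obtain ⟨f, hf, rfl⟩ := h.exists_of_isFacet hK hF
    obtain ⟨g', hg', -⟩ := h.stack hK hf (h.neg_of_isBeyond hK hf hv) fun e he hef =>
      h.pos_of_isBeneath hK he (hv' _ (h.isFacet hK he)
        fun heq => hef (h.facet_injective hK he hf heq))
    exact ⟨_, _, g', .stack n K f hS hf, hg'⟩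

end Realization

/-! ### Cutting off the vertices: caps, edge points and facets -/

section Truncation

/-- The affine functionals `A u` cut off the vertices `p u`, and for every edge `{u, w}` the
functionals `A u` and `A w` vanish at the same point of the edge. -/
structure Truncates (N : ℕ) (K : Finset (Finset ℕ)) (p : ℕ → Space 4)
    (A : ℕ → Space 4 →ᵃ[ℝ] ℝ) : Prop where
  neg : ∀ u < N, A u (p u) < 0
  pos : ∀ u < N, ∀ w < N, w ≠ u → 0 < A u (p w)
  compat : ∀ u w, u ≠ w → {u, w} ∈ skel K 2 → A u (p u) * A w (p w) = A u (p w) * A w (p u)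

/-- The set that remains of `P` after the truncation of its vertices. -/
def truncation (N : ℕ) (A : ℕ → Space 4 →ᵃ[ℝ] ℝ) (P : Set (Space 4)) : Set (Space 4) :=
  {x | x ∈ P ∧ ∀ u < N, 0 ≤ A u x}

/-- `x` is the point that remains from the edge with endpoints `p u` and `p w`. -/
def IsEdgePoint (p : ℕ → Space 4) (A : ℕ → Space 4 →ᵃ[ℝ] ℝ) (u w : ℕ) (x : Space 4) : Prop :=
  ∃ c : ℝ, 0 < c ∧ c < 1 ∧ x = AffineMap.lineMap (p u) (p w) c ∧ A u x = 0 ∧ A w x = 0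

variable {N : ℕ} {K : Finset (Finset ℕ)} {p : ℕ → Space 4} {g : Finset ℕ → Space 4 →ᵃ[ℝ] ℝ}
  {P : Set (Space 4)} {A : ℕ → Space 4 →ᵃ[ℝ] ℝ}

theorem IsEdgePoint.symm {u w : ℕ} {x : Space 4} (h : IsEdgePoint p A u w x) :
    IsEdgePoint p A w u x := by
  obtain ⟨c, h0, h1, hx, hu, hw⟩ := h
  refine ⟨1 - c, by linarith, by linarith, ?_, hw, hu⟩
  rw [AffineMap.lineMap_apply_one_sub, hx]

theorem IsComplex.skel_lt (hK : IsComplex N K) {j : ℕ} {t : Finset ℕ} (ht : t ∈ skel K j) {u : ℕ}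
    (hu : u ∈ t) : u < N := by
  obtain ⟨f, hf, htf, -⟩ := mem_skel.1 ht
  exact hK.lt hf (htf hu)

theorem skel_two {e : Finset ℕ} (he : e ∈ skel K 2) : ∃ u w, u ≠ w ∧ e = {u, w} := by
  obtain ⟨f, hf, htf, htc⟩ := mem_skel.1 he
  exact Finset.card_eq_two.1 htc

namespace Truncates

theorem edge_pos (hA : Truncates N K p A) {u w : ℕ} (hu : u < N) (hw : w < N) {j : ℕ}
    (hj : j < N) (hju : j ≠ u) (hjw : j ≠ w) {c : ℝ} (h0 : 0 ≤ c) (h1 : c ≤ 1) :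
    0 < A j (AffineMap.lineMap (p u) (p w) c) := by
  rw [affineMap_lineMap]
  have h2 := hA.pos j hj u hu hju.symm
  have h3 := hA.pos j hj w hw hjw.symm
  rcases h0.eq_or_lt with rfl | h0
  · simpa using h2
  · have := mul_pos h0 h3
    have := mul_nonneg (sub_nonneg.2 h1) h2.le
    linarith

theorem exists_edgePoint (hK : IsComplex N K) (hA : Truncates N K p A) {u w : ℕ} (huw : u ≠ w)
    (he : {u, w} ∈ skel K 2) : ∃ x, IsEdgePoint p A u w x := by
  have hu := hK.skel_lt he (u := u) (by simp)
  have hw := hK.skel_lt he (u := w) (by simp)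
  have h1 := hA.neg u hu
  have h2 := hA.pos u hu w hw huw.symm
  have h3 := hA.compat u w huw he
  have h4 : A u (p w) - A u (p u) ≠ 0 := by linarith
  -- The zero of `A u` on the edge; by `compat` it is also the zero of `A w`.
  refine ⟨_, -A u (p u) / (A u (p w) - A u (p u)), div_pos (by linarith) (by linarith),
    (div_lt_one (by linarith)).2 (by linarith), rfl, ?_, ?_⟩
  · rw [affineMap_lineMap]; field_simp; ring
  · rw [affineMap_lineMap]; field_simp; linarith

/-- A point of an edge that is not cut off. -/
theorem isEdgePoint_of_nonneg (hK : IsComplex N K) (hA : Truncates N K p A) {u w : ℕ}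
    (huw : u ≠ w) (he : {u, w} ∈ skel K 2) {c : ℝ}
    (h1 : 0 ≤ A u (AffineMap.lineMap (p u) (p w) c))
    (h2 : 0 ≤ A w (AffineMap.lineMap (p u) (p w) c)) :
    IsEdgePoint p A u w (AffineMap.lineMap (p u) (p w) c) := by
  have hu := hK.skel_lt he (u := u) (by simp)
  have hw := hK.skel_lt he (u := w) (by simp)
  have a1 := hA.neg u hu
  have a2 := hA.pos u hu w hw huw.symm
  have a3 := hA.compat u w huw he
  have a4 := hA.neg w hw
  have a5 := hA.pos w hw u hu huw
  rw [affineMap_lineMap] at h1 h2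
  -- By `compat` the restrictions of `A u` and `A w` to the line are negative multiples of each
  -- other, so both are nonnegative only where both vanish.
  have key : A w (p w) * ((1 - c) * A u (p u) + c * A u (p w)) =
      A u (p w) * ((1 - c) * A w (p u) + c * A w (p w)) := by linear_combination (1 - c) * a3
  have z1 : (1 - c) * A u (p u) + c * A u (p w) = 0 := by
    by_contra hne
    have := h1.lt_of_ne' hne
    nlinarith [mul_nonneg a2.le h2]
  have z2 : (1 - c) * A w (p u) + c * A w (p w) = 0 := by
    rw [z1, mul_zero] at key
    exact (mul_eq_zero.1 key.symm).resolve_left a2.ne'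
  refine ⟨c, ?_, ?_, rfl, by rw [affineMap_lineMap, z1], by rw [affineMap_lineMap, z2]⟩
  · by_contra! hc
    nlinarith
  · by_contra! hc
    nlinarith

theorem edgePoint_unique (hK : IsComplex N K) (hA : Truncates N K p A) {u w : ℕ}
    (huw : u ≠ w) (he : {u, w} ∈ skel K 2) {x y : Space 4} (hx : IsEdgePoint p A u w x)
    (hy : IsEdgePoint p A u w y) : x = y := by
  have hu := hK.skel_lt he (u := u) (by simp)
  have hw := hK.skel_lt he (u := w) (by simp)
  have a1 := hA.neg u hu
  have a2 := hA.pos u hu w hw huw.symm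
  obtain ⟨c, -, -, rfl, hc, -⟩ := hx
  obtain ⟨c', -, -, rfl, hc', -⟩ := hy
  rw [affineMap_lineMap] at hc hc'
  have : (c - c') * (A u (p w) - A u (p u)) = 0 := by linear_combination hc - hc'
  rcases mul_eq_zero.1 this with h | h
  · rw [sub_eq_zero.1 h]
  · linarith

end Truncates

theorem lineMap_mem_of_realizes (h : Realizes N K p g P) {u w : ℕ} (hu : u < N) (hw : w < N)
    {c : ℝ} (h0 : 0 ≤ c) (h1 : c ≤ 1) : AffineMap.lineMap (p u) (p w) c ∈ P :=
  h.convex.lineMap_mem (h.mem (Finset.mem_range.2 hu)) (h.mem (Finset.mem_range.2 hw)) ⟨h0, h1⟩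

/-- A point of `P` that is not on an edge can be moved inside `P` in both directions along some
line on which a given functional is constant. -/
theorem Realizes.exists_direction (hK : IsComplex N K) (h : Realizes N K p g P) {x : Space 4}
    (hx : x ∈ P) (φ : Space 4 →ᵃ[ℝ] ℝ) :
    (∃ i < N, x = p i) ∨
    (∃ u w c, u ≠ w ∧ {u, w} ∈ skel K 2 ∧ 0 < c ∧ c < 1 ∧
      x = AffineMap.lineMap (p u) (p w) (c : ℝ)) ∨
    ∃ v ≠ 0, φ.linear v = 0 ∧ ∃ ε > 0, ∀ c : ℝ, |c| ≤ ε → x + c • v ∈ P := by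
  classical
  have move : ∀ v : Space 4, (∀ k ∈ K, g k x = 0 → (g k).linear v = 0) →
      ∃ ε > 0, ∀ c : ℝ, |c| ≤ ε → x + c • v ∈ P := by
    intro v hv
    obtain ⟨ε, hε, hε'⟩ := exists_pos_forall_add_mul_pos (K.filter fun k => 0 < g k x)
      (fun k => g k x) (fun k => (g k).linear v) (fun k hk => (Finset.mem_filter.1 hk).2)
    refine ⟨ε, hε, fun c hc => ?_⟩
    rw [h.ineq]
    intro k hk
    rw [affineMap_add_smul]
    rcases (h.nonneg hx hk).eq_or_lt with h0 | h0
    · rw [hv k hk h0.symm, ← h0]; simp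
    · exact (hε' c hc k (Finset.mem_filter.2 ⟨hk, h0⟩)).le
  by_cases hT : ∃ f ∈ K, g f x = 0
  · obtain ⟨f, hf, hfx⟩ := hT
    -- The vertices of the smallest face containing `x`, namely those on every facet that is tight
    -- at `x`.
    let t : Finset ℕ := f.filter fun i => ∀ k ∈ K, g k x = 0 → i ∈ k
    have htf : t ⊆ f := Finset.filter_subset _ _
    have hxt : x ∈ convexHull ℝ (p '' (t : Set ℕ)) := by
      have h1 := h.convexHull_closedSet {k | g k x = 0}
      have h2 : {i | i ∈ Finset.range N ∧ ∀ k ∈ K, k ∈ {k | g k x = 0} → i ∈ k} = (t : Set ℕ) := by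
        ext i
        simp only [mem_ofPred_eq, t, Finset.coe_filter]
        exact ⟨fun hi => ⟨hi.2 f hf hfx, hi.2⟩, fun hi => ⟨hK.sub f hf hi.1, hi.2⟩⟩
      rw [← h2, h1]
      exact ⟨hx, fun k _ hk => hk⟩
    have htk : ∀ i ∈ t, ∀ k ∈ K, g k x = 0 → g k (p i) = 0 := fun i hi k hk hkx =>
      (h.inc i (hK.sub f hf (htf hi)) k hk).2 ((Finset.mem_filter.1 hi).2 k hk hkx)
    have hlin : ∀ k : Space 4 →ᵃ[ℝ] ℝ, ∀ a b, k.linear (a - b) = k a - k b := fun k a b => by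
      have := k.linearMap_vsub a b
      simpa using this
    rcases lt_or_ge t.card 3 with hc | hc
    · have h0 : t.Nonempty := by
        by_contra h0
        rw [Finset.not_nonempty_iff_eq_empty.1 h0] at hxt
        simp at hxt
      have := h0.card_pos
      interval_cases hcc : t.card
      · obtain ⟨i, hi⟩ := Finset.card_eq_one.1 hcc
        rw [hi] at hxt
        simp only [Finset.coe_singleton, image_singleton, convexHull_singleton,
          mem_singleton_iff] at hxt
        exact Or.inl ⟨i, hK.lt hf (htf (by rw [hi]; simp)), hxt⟩
      · obtain ⟨u, w, huw, hi⟩ := Finset.card_eq_two.1 hcc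
        have hu : u < N := hK.lt hf (htf (by rw [hi]; simp))
        have hw : w < N := hK.lt hf (htf (by rw [hi]; simp))
        have hcoe : p '' (t : Set ℕ) = {p u, p w} := by rw [hi]; simp [image_pair]
        rw [hcoe, convexHull_pair, segment_eq_image_lineMap] at hxt
        obtain ⟨c, ⟨hc0, hc1⟩, rfl⟩ := hxt
        rcases hc0.eq_or_lt with rfl | hc0
        · exact Or.inl ⟨u, hu, by simp⟩
        rcases hc1.eq_or_lt with rfl | hc1
        · exact Or.inl ⟨w, hw, by simp⟩
        exact Or.inr (Or.inl ⟨u, w, c, huw, mem_skel.2 ⟨f, hf, hi ▸ htf, hi ▸ hcc⟩, hc0, hc1, rfl⟩)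
    -- Three vertices of this face give two directions that preserve all tight inequalities, and a
    -- combination of the two is killed by `φ`. The facets across from `v` and `w` certify that it
    -- is nonzero.
    · obtain ⟨u, hu, v, hv, w, hw, huv, huw, hvw⟩ := Finset.two_lt_card.1 hc
      obtain ⟨fv, hfv, -, hfv', hvfv⟩ := hK.neighbour hf (htf hv)
      obtain ⟨fw, hfw, -, hfw', hwfw⟩ := hK.neighbour hf (htf hw)
      have hz : ∀ {i k}, i ∈ t → k ∈ K → (g k (p i) = 0 ↔ i ∈ k) := fun {i k} hi hk =>
        h.inc i (hK.sub f hf (htf hi)) k hk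
      have hmv : ∀ i ∈ t, ∀ j ∈ t, ∀ k ∈ K, g k x = 0 → (g k).linear (p i - p j) = 0 :=
        fun i hi j hj k hk hkx => by rw [hlin, htk i hi k hk hkx, htk j hj k hk hkx, sub_zero]
      have hvv : (g fv).linear (p v - p u) ≠ 0 := by
        rw [hlin, (hz hu hfv).2 (hfv' (Finset.mem_erase.2 ⟨huv, htf hu⟩)), sub_zero]
        exact fun h0 => hvfv ((hz hv hfv).1 h0)
      have hvw0 : (g fv).linear (p w - p u) = 0 := by
        rw [hlin, (hz hu hfv).2 (hfv' (Finset.mem_erase.2 ⟨huv, htf hu⟩)),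
          (hz hw hfv).2 (hfv' (Finset.mem_erase.2 ⟨hvw.symm, htf hw⟩)), sub_zero]
      have hww : (g fw).linear (p w - p u) ≠ 0 := by
        rw [hlin, (hz hu hfw).2 (hfw' (Finset.mem_erase.2 ⟨huw, htf hu⟩)), sub_zero]
        exact fun h0 => hwfw ((hz hw hfw).1 h0)
      refine Or.inr (Or.inr ?_)
      by_cases h0 : φ.linear (p w - p u) = 0
      · exact ⟨p w - p u, fun h1 => hww (by rw [h1, map_zero]), h0, move _ (hmv w hw u hu)⟩
      · refine ⟨φ.linear (p w - p u) • (p v - p u) - φ.linear (p v - p u) • (p w - p u),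
          fun h1 => ?_, by simp only [map_sub, map_smul, smul_eq_mul]; ring,
          move _ fun k hk hkx => ?_⟩
        · have := congrArg (g fv).linear h1
          rw [LinearMap.map_sub (g fv).linear, LinearMap.map_smul (g fv).linear,
            LinearMap.map_smul (g fv).linear, hvw0, smul_zero, sub_zero, LinearMap.map_zero,
            smul_eq_mul] at this
          exact (mul_ne_zero h0 hvv) this
        · rw [LinearMap.map_sub (g k).linear, LinearMap.map_smul (g k).linear,
            LinearMap.map_smul (g k).linear, hmv v hv u hu k hk hkx, hmv w hw u hu k hk hkx]
          simp
  -- With no tight inequality every direction is allowed, and a functional on 4-space has a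
  -- nontrivial kernel.
  · push Not at hT
    have hker : LinearMap.ker φ.linear ≠ ⊥ := LinearMap.ker_ne_bot_of_finrank_lt (by simp)
    obtain ⟨v, hv, hv0⟩ := (Submodule.ne_bot_iff _).1 hker
    exact Or.inr (Or.inr ⟨v, hv0, hv, move v fun k hk hk0 => absurd hk0 (hT k hk)⟩)

theorem notMem_extremePoints {S : Set (Space 4)} {x v : Space 4} (hv : v ≠ 0) (h1 : x + v ∈ S)
    (h2 : x - v ∈ S) : x ∉ S.extremePoints ℝ := by
  intro hx
  have := hx.2 h1 h2 ⟨1 / 2, 1 / 2, by norm_num, by norm_num, by norm_num, by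
    rw [← smul_add, add_add_sub_cancel, ← two_smul ℝ x, smul_smul]; norm_num⟩
  exact hv (by simpa using this)

/-- Krein–Milman; the closure is harmless because the hull of a finite set is closed. -/
theorem eq_convexHull_of_extremePoints_subset {S T : Set (Space 4)} (hS : IsCompact S)
    (hSc : Convex ℝ S) (hT : T.Finite) (hTS : T ⊆ S) (h : S.extremePoints ℝ ⊆ T) :
    S = convexHull ℝ T := by
  refine Subset.antisymm ?_ (convexHull_min hTS hSc)
  rw [← closure_convexHull_extremePoints hS hSc]
  exact closure_minimal (convexHull_mono h) (hT.isClosed_convexHull ℝ)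

/-- The points where `φ` is positive, together with the hull of the zeros of `φ` in `S`, form a
convex set containing `S`. -/
theorem mem_convexHull_zero {S : Set (Space 4)} {φ : Space 4 →ᵃ[ℝ] ℝ} (hφ : ∀ y ∈ S, 0 ≤ φ y)
    {x : Space 4} (hx : x ∈ convexHull ℝ S) (hx0 : φ x ≤ 0) :
    x ∈ convexHull ℝ {y | y ∈ S ∧ φ y = 0} := by
  have hsub : convexHull ℝ S ⊆
      {x | 0 < φ x ∨ φ x = 0 ∧ x ∈ convexHull ℝ {y | y ∈ S ∧ φ y = 0}} := by
    refine convexHull_min (fun y hy => ?_) ?_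
    · rcases (hφ y hy).eq_or_lt with h0 | h0
      · exact Or.inr ⟨h0.symm, subset_convexHull ℝ _ ⟨hy, h0.symm⟩⟩
      · exact Or.inl h0
    · rw [convex_iff_forall_pos]
      intro y hy z hz a b ha hb hab
      have hc : φ (a • y + b • z) = a * φ y + b * φ z := by
        rw [Convex.combo_affine_apply hab, smul_eq_mul, smul_eq_mul]
      rcases hy with hy | ⟨hy, hy'⟩ <;> rcases hz with hz | ⟨hz, hz'⟩
      · left; rw [hc]; positivity
      · left; rw [hc, hz]; simpa using mul_pos ha hy
      · left; rw [hc, hy]; simpa using mul_pos hb hz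
      · right
        exact ⟨by rw [hc, hy, hz]; simp, (convex_convexHull ℝ _) hy' hz' ha.le hb.le hab⟩
  rcases hsub hx with h | h
  · linarith
  · exact h.2

theorem continuous_affineMap (φ : Space 4 →ᵃ[ℝ] ℝ) : Continuous φ :=
  φ.continuous_of_finiteDimensional

namespace Truncates

/-- The part of `P` that is cut off at the vertex `v` is spanned by `v` and the edge points. -/
theorem cap_eq (hK : IsComplex N K) (h : Realizes N K p g P) (hA : Truncates N K p A)
    {v : ℕ} (hv : v < N) : {x | x ∈ P ∧ A v x ≤ 0} = convexHull ℝ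
      (insert (p v) {x | ∃ w, v ≠ w ∧ {v, w} ∈ skel K 2 ∧ IsEdgePoint p A v w x}) := by
  have hconv : Convex ℝ {x | x ∈ P ∧ A v x ≤ 0} :=
    h.convex.inter ((convex_Iic (0 : ℝ)).affine_preimage (A v))
  refine eq_convexHull_of_extremePoints_subset ?_ hconv ?_ ?_ ?_
  · exact h.isCompact.inter_right (isClosed_Iic.preimage (continuous_affineMap (A v)))
  · refine Finite.insert _ ?_
    have : {x | ∃ w, v ≠ w ∧ {v, w} ∈ skel K 2 ∧ IsEdgePoint p A v w x} ⊆
        ⋃ w ∈ (Finset.range N : Set ℕ),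
          {x | v ≠ w ∧ {v, w} ∈ skel K 2 ∧ IsEdgePoint p A v w x} := by
      rintro x ⟨w, hvw, he, hx⟩
      exact mem_biUnion (Finset.mem_range.2 (hK.skel_lt he (u := w) (by simp))) ⟨hvw, he, hx⟩
    refine Finite.subset (Finite.biUnion (Finset.finite_toSet _) fun w _ => ?_) this
    refine Set.Subsingleton.finite ?_
    rintro x ⟨h1, h2, h3⟩ y ⟨-, -, h3'⟩
    exact edgePoint_unique hK hA h1 h2 h3 h3'
  · refine insert_subset ⟨h.mem (Finset.mem_range.2 hv), (hA.neg v hv).le⟩ ?_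
    rintro x ⟨w, hvw, he, c, h0, h1, rfl, hx, -⟩
    exact ⟨lineMap_mem_of_realizes h hv (hK.skel_lt he (u := w) (by simp)) h0.le h1.le, hx.le⟩
  · intro x hx
    have hxP := hx.1
    -- An extreme point of the cap inside an edge at `v` satisfies `A v x = 0`: otherwise a short
    -- move along the edge in either direction preserves the three strict inequalities placing it
    -- inside the edge and the cap.
    have hedge : ∀ w c, v ≠ w → {v, w} ∈ skel K 2 → 0 < c → c < 1 →
        x = AffineMap.lineMap (p v) (p w) (c : ℝ) → IsEdgePoint p A v w x := by
      intro w c hvw he h0 h1 hxc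
      obtain ⟨y, hy⟩ := hA.exists_edgePoint hK hvw he
      have hw := hK.skel_lt he (u := w) (by simp)
      have a1 := hA.neg v hv
      have a2 := hA.pos v hv w hw hvw.symm
      rcases hxP.2.eq_or_lt with hz | hz
      · obtain ⟨c', h0', h1', rfl, hc', hcw⟩ := hy
        refine ⟨c, h0, h1, hxc, hz, ?_⟩
        have : (c - c') * (A v (p w) - A v (p v)) = 0 := by
          rw [hxc] at hz
          rw [affineMap_lineMap] at hz hc'
          linear_combination hz - hc'
        rcases mul_eq_zero.1 this with h' | h'
        · rw [hxc, sub_eq_zero.1 h', hcw]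
        · linarith
      · exfalso
        obtain ⟨ε, hε, hε'⟩ := exists_pos_forall_add_mul_pos (Finset.univ : Finset (Fin 3))
          ![c, 1 - c, -A v x] ![1, -1, -(A v).linear (p w - p v)] (by
            intro k hk
            fin_cases hk <;> simp [h0, h1, hz])
        have hmv : ∀ δ : ℝ, |δ| ≤ ε → x + δ • (p w - p v) ∈ {x | x ∈ P ∧ A v x ≤ 0} := by
          intro δ hδ
          have b0 := hε' δ hδ 0 (by simp)
          have b1 := hε' δ hδ 1 (by simp)
          have b2 := hε' δ hδ 2 (by simp)
          simp at b0 b1 b2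
          refine ⟨?_, ?_⟩
          · have : x + δ • (p w - p v) = AffineMap.lineMap (p v) (p w) (c + δ) := by
              rw [hxc, AffineMap.lineMap_apply, AffineMap.lineMap_apply, vsub_eq_sub, vadd_eq_add,
                vadd_eq_add, add_smul]
              abel
            rw [this]
            exact lineMap_mem_of_realizes h hv hw b0.le (by linarith)
          · rw [affineMap_add_smul, map_sub]
            linarith
        refine notMem_extremePoints (v := ε • (p w - p v)) ?_ (hmv ε (by rw [abs_of_pos hε]))
          ?_ hx
        · refine smul_ne_zero hε.ne' fun h' => ?_
          rw [sub_eq_zero.1 h'] at a2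
          linarith
        · have := hmv (-ε) (by rw [abs_neg, abs_of_pos hε])
          rwa [neg_smul, ← sub_eq_add_neg] at this
    -- Moving along a line on which `A v` is constant does not leave the cap.
    rcases h.exists_direction hK hxP.1 (A v) with ⟨i, hi, rfl⟩ | ⟨u, w, c, huw, he, h0, h1, hxc⟩ |
      ⟨d, hd, hd0, ε, hε, hmv⟩
    · by_cases hiv : i = v
      · exact Or.inl (by rw [hiv])
      · have := hA.pos v hv i hi hiv
        linarith [hxP.2]
    · right
      by_cases hvu : v = u
      · subst hvu
        exact ⟨w, huw, he, hedge w c huw he h0 h1 hxc⟩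
      by_cases hvw : v = w
      · subst hvw
        have he' : {v, u} ∈ skel K 2 := by rwa [Finset.pair_comm]
        refine ⟨u, huw.symm, he', hedge u (1 - c) huw.symm he' (by linarith) (by linarith) ?_⟩
        rw [AffineMap.lineMap_apply_one_sub, hxc]
      · have := hA.edge_pos (hK.skel_lt he (u := u) (by simp)) (hK.skel_lt he (u := w) (by simp)) hv
          hvu hvw h0.le h1.le
        rw [← hxc] at this
        linarith [hxP.2]
    · exfalso
      have hmv' : ∀ c : ℝ, |c| ≤ ε → x + c • d ∈ {x | x ∈ P ∧ A v x ≤ 0} := fun c hc =>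
        ⟨hmv c hc, by rw [affineMap_add_smul, hd0, mul_zero, add_zero]; exact hxP.2⟩
      refine notMem_extremePoints (v := ε • d) (smul_ne_zero hε.ne' hd)
        (hmv' ε (by rw [abs_of_pos hε])) ?_ hx
      have := hmv' (-ε) (by rw [abs_neg, abs_of_pos hε])
      rwa [neg_smul, ← sub_eq_add_neg] at this

/-- Two caps meet only in the point of the common edge. -/
theorem isEdgePoint_of_mem_caps (hK : IsComplex N K) (h : Realizes N K p g P)
    (hA : Truncates N K p A) {v w : ℕ} (hv : v < N) (hw : w < N) (hvw : v ≠ w) {x : Space 4}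
    (hx : x ∈ P) (hxv : A v x ≤ 0) (hxw : A w x ≤ 0) :
    {v, w} ∈ skel K 2 ∧ IsEdgePoint p A v w x := by
  have hx' : x ∈ {x | x ∈ P ∧ A v x ≤ 0} := ⟨hx, hxv⟩
  rw [cap_eq hK h hA hv] at hx'
  have hpos : ∀ u y, v ≠ u → u ≠ w → {v, u} ∈ skel K 2 → IsEdgePoint p A v u y → 0 < A w y := by
    rintro u y hvu huw he ⟨c, h0, h1, rfl, -, -⟩
    exact hA.edge_pos hv (hK.skel_lt he (u := u) (by simp)) hw hvw.symm huw.symm h0.le h1.le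
  -- On the generators of the cap at `v` the functional `A w` is nonnegative, and it vanishes at
  -- most at the point of the edge from `v` to `w`.
  have hz := mem_convexHull_zero (φ := A w) ?_ hx' hxw
  · have hsub : ∀ y, y ∈ insert (p v) {x | ∃ w, v ≠ w ∧ {v, w} ∈ skel K 2 ∧
        IsEdgePoint p A v w x} ∧ A w y = 0 → {v, w} ∈ skel K 2 ∧ IsEdgePoint p A v w y := by
      rintro y ⟨rfl | ⟨u, hvu, he, hy⟩, h0⟩
      · exact absurd h0 (hA.pos w hw v hv hvw).ne'
      · by_cases huw : u = w
        · subst huw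
          exact ⟨he, hy⟩
        · exact absurd h0 (hpos u y hvu huw he hy).ne'
    obtain ⟨y, hy⟩ := (convexHull_nonempty_iff (𝕜 := ℝ)).1 ⟨x, hz⟩
    obtain ⟨he, hy'⟩ := hsub y hy
    have : {y | y ∈ insert (p v) {x | ∃ w, v ≠ w ∧ {v, w} ∈ skel K 2 ∧
        IsEdgePoint p A v w x} ∧ A w y = 0} ⊆ {y} := fun z hz =>
      edgePoint_unique hK hA hvw he (hsub z hz).2 hy'
    have := convexHull_mono (𝕜 := ℝ) this hz
    rw [convexHull_singleton] at this
    rw [mem_singleton_iff.1 this]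
    exact ⟨he, hy'⟩
  · rintro y (rfl | ⟨u, hvu, he, hy⟩)
    · exact (hA.pos w hw v hv hvw).le
    · by_cases huw : u = w
      · subst huw
        obtain ⟨c, -, -, -, -, h0⟩ := hy
        exact h0.ge
      · exact (hpos u y hvu huw he hy).le

/-- If two cuts are tight at `x`, then `x` lies in two caps and is an edge point. If at most one is
tight, `x` either lies on an edge or moves both ways along a line on which that cut stays constant.
-/
theorem extremePoints_subset (hK : IsComplex N K) (h : Realizes N K p g P)
    (hA : Truncates N K p A) {x : Space 4} (hx : x ∈ (truncation N A P).extremePoints ℝ) :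
    ∃ u w, u ≠ w ∧ {u, w} ∈ skel K 2 ∧ IsEdgePoint p A u w x := by
  obtain ⟨hxP, hxA⟩ := hx.1
  by_cases hZ : ∃ u < N, ∃ w < N, u ≠ w ∧ A u x = 0 ∧ A w x = 0
  · obtain ⟨u, hu, w, hw, huw, hxu, hxw⟩ := hZ
    exact ⟨u, w, huw, isEdgePoint_of_mem_caps hK h hA hu hw huw hxP hxu.le hxw.le⟩
  · obtain ⟨v, hv⟩ : ∃ v, ∀ j < N, j ≠ v → 0 < A j x := by
      by_cases hZ' : ∃ v < N, A v x = 0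
      · obtain ⟨v, hv, hv0⟩ := hZ'
        refine ⟨v, fun j hj hjv => (hxA j hj).lt_of_ne' fun h0 => ?_⟩
        exact hZ ⟨j, hj, v, hv, hjv, h0, hv0⟩
      · push Not at hZ'
        exact ⟨0, fun j hj _ => (hxA j hj).lt_of_ne' (hZ' j hj)⟩
    rcases h.exists_direction hK hxP (A v) with ⟨i, hi, rfl⟩ | ⟨u, w, c, huw, he, h0, h1, rfl⟩ |
      ⟨d, hd, hd0, ε, hε, hmv⟩
    · have := hA.neg i hi
      linarith [hxA i hi]
    · exact ⟨u, w, huw, he, isEdgePoint_of_nonneg hK hA huw he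
        (hxA u (hK.skel_lt he (by simp))) (hxA w (hK.skel_lt he (by simp)))⟩
    · exfalso
      obtain ⟨ε', hε', hmv'⟩ := exists_pos_forall_add_mul_pos ((Finset.range N).erase v)
        (fun j => A j x) (fun j => (A j).linear d) (fun j hj => by
          obtain ⟨hjv, hj⟩ := Finset.mem_erase.1 hj
          exact hv j (Finset.mem_range.1 hj) hjv)
      have hm : ∀ c : ℝ, |c| ≤ min ε ε' → x + c • d ∈ truncation N A P := by
        refine fun c hc => ⟨hmv c (hc.trans (min_le_left _ _)), fun j hj => ?_⟩
        rw [affineMap_add_smul]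
        by_cases hjv : j = v
        · subst hjv
          rw [hd0, mul_zero, add_zero]; exact hxA j hj
        · exact (hmv' c (hc.trans (min_le_right _ _)) j
            (Finset.mem_erase.2 ⟨hjv, Finset.mem_range.2 hj⟩)).le
      have hpos : 0 < min ε ε' := lt_min hε hε'
      refine notMem_extremePoints (v := min ε ε' • d) (smul_ne_zero hpos.ne' hd)
        (hm _ (by rw [abs_of_pos hpos])) ?_ hx
      have := hm (-min ε ε') (by rw [abs_neg, abs_of_pos hpos])
      rwa [neg_smul, ← sub_eq_add_neg] at this

end Truncates

/-- The facets of the truncation, as intervals in the face lattice of `P`. -/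
def truncFacets (N : ℕ) (K : Finset (Finset ℕ)) : Finset (Finset ℕ × Finset ℕ) :=
  K.image (fun f => (∅, f)) ∪ (Finset.range N).image fun v => ({v}, Finset.range N)

theorem mem_truncFacets {x : Finset ℕ × Finset ℕ} : x ∈ truncFacets N K ↔
    (∃ f ∈ K, x = (∅, f)) ∨ ∃ v < N, x = ({v}, Finset.range N) := by
  simp [truncFacets, eq_comm]

/-- The functionals defining the facets of the truncation. -/
noncomputable def truncFunctional (g : Finset ℕ → Space 4 →ᵃ[ℝ] ℝ) (A : ℕ → Space 4 →ᵃ[ℝ] ℝ)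
    (x : Finset ℕ × Finset ℕ) : Space 4 →ᵃ[ℝ] ℝ :=
  if x.1 = ∅ then g x.2 else A (x.1.sum id)

/-- `D` has a vertex for every edge of the complex, and a facet for every facet and every vertex. -/
abbrev IsTruncation (N : ℕ) (K : Finset (Finset ℕ)) (q : Finset ℕ → Space 4)
    (g : Finset ℕ × Finset ℕ → Space 4 →ᵃ[ℝ] ℝ) (D : Set (Space 4)) : Prop :=
  HVRep (skel K 2) (truncFacets N K) (fun e y => y.1 ⊆ e ∧ e ⊆ y.2) q g D

/-- The vertices of the truncation are edge points, one for each edge of `P`; its facets come from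
facets and vertices of `P`. -/
theorem Truncates.hvRep (hK : IsComplex N K) (h : Realizes N K p g P) (hA : Truncates N K p A) :
    ∃ q : Finset ℕ → Space 4,
      (∀ u w, u ≠ w → {u, w} ∈ skel K 2 → IsEdgePoint p A u w (q {u, w})) ∧
      IsTruncation N K q (truncFunctional g A) (truncation N A P) := by
  -- The point is chosen for the unordered edge, so it must serve both orders of the endpoints. Sets
  -- that are not edges get the value 0.
  have hex : ∀ e : Finset ℕ, ∃ x, ∀ u w, u ≠ w → e = {u, w} → {u, w} ∈ skel K 2 →
      IsEdgePoint p A u w x := by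
    intro e
    by_cases he : e ∈ skel K 2
    · obtain ⟨u, w, huw, rfl⟩ := skel_two he
      obtain ⟨x, hx⟩ := hA.exists_edgePoint hK huw he
      refine ⟨x, fun u' w' huw' heq _ => ?_⟩
      rcases Set.pair_eq_pair_iff.1
        (by simpa using congrArg (fun s : Finset ℕ => (s : Set ℕ)) heq) with ⟨rfl, rfl⟩ | ⟨rfl, rfl⟩
      · exact hx
      · exact hx.symm
    · exact ⟨0, fun u w _ h1 h2 => absurd (h1 ▸ h2) he⟩
  choose q hq using hex
  have hq' : ∀ u w, u ≠ w → {u, w} ∈ skel K 2 → IsEdgePoint p A u w (q {u, w}) :=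
    fun u w huw he => hq _ u w huw rfl he
  have hmem : ∀ e ∈ skel K 2, q e ∈ truncation N A P := by
    intro e he
    obtain ⟨u, w, huw, rfl⟩ := skel_two he
    obtain ⟨c, h0, h1, hx, hxu, hxw⟩ := hq' u w huw he
    have hu := hK.skel_lt he (u := u) (by simp)
    have hw := hK.skel_lt he (u := w) (by simp)
    refine ⟨by rw [hx]; exact lineMap_mem_of_realizes h hu hw h0.le h1.le, fun j hj => ?_⟩
    by_cases hju : j = u
    · rw [hju, hxu]
    by_cases hjw : j = w
    · rw [hjw, hxw]
    rw [hx]; exact (hA.edge_pos hu hw hj hju hjw h0.le h1.le).le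
  refine ⟨q, hq', ?_, ?_, ?_⟩
  · have hset : truncation N A P = P ∩ ⋂ u ∈ Iio N, {x | 0 ≤ A u x} := by
      ext x; simp [truncation]
    refine eq_convexHull_of_extremePoints_subset ?_ ?_ ((Finset.finite_toSet _).image q) ?_ ?_
    · rw [hset]
      exact h.isCompact.inter_right (isClosed_biInter fun u _ =>
        isClosed_Ici.preimage (continuous_affineMap (A u)))
    · rw [hset]
      exact h.convex.inter (convex_iInter₂ fun u _ => (convex_Ici (0 : ℝ)).affine_preimage (A u))
    · rintro _ ⟨e, he, rfl⟩
      exact hmem e he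
    · intro x hx
      obtain ⟨u, w, huw, he, hx⟩ := hA.extremePoints_subset hK h hx
      exact ⟨{u, w}, he, hA.edgePoint_unique hK huw he (hq' u w huw he) hx⟩
  · ext x
    constructor
    · rintro ⟨hx, hx'⟩ k hk
      rcases mem_truncFacets.1 hk with ⟨f, hf, rfl⟩ | ⟨v, hv, rfl⟩
      · simpa [truncFunctional] using h.nonneg hx hf
      · simpa [truncFunctional] using hx' v hv
    · intro hx
      refine ⟨?_, fun v hv => ?_⟩
      · rw [h.ineq]
        intro f hf
        simpa [truncFunctional] using hx (∅, f) (mem_truncFacets.2 (Or.inl ⟨f, hf, rfl⟩))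
      · simpa [truncFunctional] using hx ({v}, _) (mem_truncFacets.2 (Or.inr ⟨v, hv, rfl⟩))
  · intro e he k hk
    obtain ⟨u, w, huw, rfl⟩ := skel_two he
    obtain ⟨c, h0, h1, hx, hxu, hxw⟩ := hq' u w huw he
    have hu := hK.skel_lt he (u := u) (by simp)
    have hw := hK.skel_lt he (u := w) (by simp)
    rcases mem_truncFacets.1 hk with ⟨f, hf, rfl⟩ | ⟨v, hv, rfl⟩
    · have hu' := Finset.mem_range.2 hu
      have hw' := Finset.mem_range.2 hw
      have a1 := h.nonneg (h.mem hu') hf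
      have a2 := h.nonneg (h.mem hw') hf
      simp only [truncFunctional, if_true, Finset.empty_subset, true_and, Finset.insert_subset_iff,
        Finset.singleton_subset_iff]
      -- An interior point of an edge lies on a facet exactly when both endpoints do, as a positive
      -- combination of nonnegative values vanishes only if both do.
      rw [← h.inc u hu' f hf, ← h.inc w hw' f hf, hx, affineMap_lineMap,
        add_eq_zero_iff_of_nonneg (mul_nonneg (by linarith) a1) (mul_nonneg h0.le a2),
        mul_eq_zero, mul_eq_zero]
      simp [h0.ne', (sub_pos.2 h1).ne']
    · have hsub : {u, w} ⊆ Finset.range N := by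
        simp [Finset.insert_subset_iff, hu, hw]
      simp only [truncFunctional, Finset.singleton_ne_empty, if_false, Finset.sum_singleton, id,
        hsub, and_true, Finset.singleton_subset_iff, Finset.mem_insert, Finset.mem_singleton]
      constructor
      · intro h2
        by_contra! hcon
        rw [hx] at h2
        exact (hA.edge_pos hu hw hv hcon.1 hcon.2 h0.le h1.le).ne' h2
      · rintro (rfl | rfl)
        · exact hxu
        · exact hxw

end Truncation

/-! ### Vertex truncations and compatible functionals are the same -/

section VertexTruncation

variable {N : ℕ} {K : Finset (Finset ℕ)} {p : ℕ → Space 4} {g : Finset ℕ → Space 4 →ᵃ[ℝ] ℝ}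
  {P : Set (Space 4)}

theorem convexHull_image_pair (p : ℕ → Space 4) (u w : ℕ) :
    convexHull ℝ (p '' (({u, w} : Finset ℕ) : Set ℕ)) = segment ℝ (p u) (p w) := by
  rw [Finset.coe_pair, image_pair, convexHull_pair]

/-- The cuts leave of each edge the interval between the zeros of `A u` and `A w`. If only one point
remains the zeros agree, and clearing denominators gives `compat`. -/
theorem IsVertexTruncation.exists_truncates {D : Set (Space 4)} (hK : IsComplex N K)
    (h : Realizes N K p g P) (hD : IsVertexTruncation P D) :
    ∃ A, Truncates N K p A ∧ D = truncation N A P := by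
  obtain ⟨a, b, hab, hDeq, hedge⟩ := hD
  rw [h.vertices_eq hK] at hab hDeq
  let A : ℕ → Space 4 →ᵃ[ℝ] ℝ := fun u =>
    ((a (p u) : Space 4 →L[ℝ] ℝ) : Space 4 →ₗ[ℝ] ℝ).toAffineMap - AffineMap.const ℝ _ (b (p u))
  have hA : ∀ u x, A u x = a (p u) x - b (p u) := fun u x => by simp [A]
  have hmem : ∀ {u}, u < N → p u ∈ p '' (Finset.range N : Set ℕ) := fun hu =>
    mem_image_of_mem p (Finset.mem_range.2 hu)
  have hDA : D = truncation N A P := by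
    rw [hDeq]
    ext x
    simp only [truncation, mem_ofPred_eq, and_congr_right_iff, hA, sub_nonneg]
    intro _
    constructor
    · intro hx u hu
      exact hx _ (hmem hu)
    · rintro hx _ ⟨u, hu, rfl⟩
      exact hx u (Finset.mem_range.1 hu)
  have hneg : ∀ u < N, A u (p u) < 0 := fun u hu => by
    rw [hA]; linarith [(hab _ (hmem hu)).1]
  have hpos : ∀ u < N, ∀ w < N, w ≠ u → 0 < A u (p w) := fun u hu w hw hwu => by
    rw [hA]
    have := (hab _ (hmem hu)).2 _ (hmem hw) fun heq =>
      hwu (h.injOn hK (Finset.mem_range.2 hw) (Finset.mem_range.2 hu) heq)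
    linarith
  refine ⟨A, ⟨hneg, hpos, fun u w huw he => ?_⟩, hDA⟩
  have hu := hK.skel_lt he (u := u) (by simp)
  have hw := hK.skel_lt he (u := w) (by simp)
  obtain ⟨x, -, hx⟩ := hedge _ ((h.isFaceOfDim_one hK).2 ⟨_, he, rfl⟩)
  rw [convexHull_image_pair, segment_eq_image_lineMap] at hx
  have a1 := hneg u hu
  have a2 := hpos u hu w hw huw.symm
  have a3 := hneg w hw
  have a4 := hpos w hw u hu huw
  have huniq : ∀ c : ℝ, 0 ≤ c → c ≤ 1 → 0 ≤ (1 - c) * A u (p u) + c * A u (p w) →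
      0 ≤ (1 - c) * A w (p u) + c * A w (p w) → AffineMap.lineMap (p u) (p w) c = x := by
    intro c h0 h1 hcu hcw
    have : AffineMap.lineMap (p u) (p w) c ∈
        AffineMap.lineMap (p u) (p w) '' Icc (0 : ℝ) 1 ∩ D := by
      refine ⟨⟨c, ⟨h0, h1⟩, rfl⟩, ?_⟩
      rw [hDA]
      refine ⟨lineMap_mem_of_realizes h hu hw h0 h1, fun j hj => ?_⟩
      rw [affineMap_lineMap]
      by_cases hju : j = u
      · rw [hju]; exact hcu
      by_cases hjw : j = w
      · rw [hjw]; exact hcw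
      exact add_nonneg (mul_nonneg (sub_nonneg.2 h1) (hpos j hj u hu fun h' => hju h'.symm).le)
        (mul_nonneg h0 (hpos j hj w hw fun h' => hjw h'.symm).le)
    rw [hx] at this
    exact this
  have hxD : x ∈ AffineMap.lineMap (p u) (p w) '' Icc (0 : ℝ) 1 ∩ D := by rw [hx]; rfl
  obtain ⟨⟨c, ⟨h0, h1⟩, hcx⟩, hxD⟩ := hxD
  rw [hDA] at hxD
  have hcu := hxD.2 u hu
  have hcw := hxD.2 w hw
  rw [← hcx, affineMap_lineMap] at hcu hcw
  have hs : 0 < A u (p w) - A u (p u) := by linarith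
  have ht : 0 < A w (p u) - A w (p w) := by linarith
  have e1 : -A u (p u) / (A u (p w) - A u (p u)) ≤ c := by
    rw [div_le_iff₀ hs]; linarith
  have e2 : c ≤ A w (p u) / (A w (p u) - A w (p w)) := by
    rw [le_div_iff₀ ht]; linarith
  have e3 : 0 < -A u (p u) / (A u (p w) - A u (p u)) := div_pos (by linarith) hs
  have e4 : A w (p u) / (A w (p u) - A w (p w)) < 1 := (div_lt_one ht).2 (by linarith)
  -- `s` and `t` are the parameters at which `A u` and `A w` vanish. Both endpoints of the remaining
  -- interval are left over, so uniqueness gives `s = t`.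
  set s := -A u (p u) / (A u (p w) - A u (p u)) with hsdef
  set t := A w (p u) / (A w (p u) - A w (p w)) with htdef
  have es : s * (A u (p w) - A u (p u)) = -A u (p u) := div_mul_cancel₀ _ hs.ne'
  have et : t * (A w (p u) - A w (p w)) = A w (p u) := div_mul_cancel₀ _ ht.ne'
  have f1 := huniq s e3.le (by linarith) (by linarith)
    (by nlinarith [mul_le_mul_of_nonneg_right (e1.trans e2) ht.le])
  have f2 := huniq t (by linarith) e4.le
    (by nlinarith [mul_le_mul_of_nonneg_right (e1.trans e2) hs.le]) (by linarith)
  have hst : s = t := by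
    have hne : p u ≠ p w := fun h' =>
      huw (h.injOn hK (Finset.mem_range.2 hu) (Finset.mem_range.2 hw) h')
    exact AffineMap.lineMap_injective ℝ hne (f1.trans f2.symm)
  rw [← hst] at et
  have g1 : (A u (p w) - A u (p u)) * A w (p u) = -A u (p u) * (A w (p u) - A w (p w)) := by
    linear_combination (A w (p u) - A w (p w)) * es - (A u (p w) - A u (p u)) * et
  linarith

/-- As `φ` separates the endpoints it serves as a coordinate on the line: the strict inequalities
between its end values define a relatively open subset of the segment. -/
theorem mem_intrinsicInterior_segment {x y : Space 4} {φ : Space 4 →ᵃ[ℝ] ℝ} (hφ : φ x < φ y)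
    {c : ℝ} (h0 : 0 < c) (h1 : c < 1) :
    AffineMap.lineMap x y c ∈ intrinsicInterior ℝ (segment ℝ x y) := by
  have hmem : AffineMap.lineMap x y c ∈ segment ℝ x y := by
    rw [segment_eq_image_lineMap]; exact ⟨c, ⟨h0.le, h1.le⟩, rfl⟩
  rw [mem_intrinsicInterior]
  refine ⟨⟨_, subset_affineSpan ℝ _ hmem⟩, ?_, rfl⟩
  rw [mem_interior]
  refine ⟨{z | φ x < φ z.1 ∧ φ z.1 < φ y}, ?_, ?_, ?_⟩
  · rintro ⟨z, hz⟩ ⟨hz1, hz2⟩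
    have hz' : z ∈ affineSpan ℝ {x, y} := by
      rwa [← convexHull_pair, affineSpan_convexHull] at hz
    obtain ⟨t, rfl⟩ := mem_affineSpan_pair_iff_exists_lineMap_eq.1 hz'
    simp only [mem_preimage]
    rw [affineMap_lineMap] at hz1 hz2
    rw [segment_eq_image_lineMap]
    refine ⟨t, ⟨?_, ?_⟩, rfl⟩
    · by_contra! ht; nlinarith
    · by_contra! ht; nlinarith
  · have hc : Continuous fun z : affineSpan ℝ (segment ℝ x y) => φ z.1 :=
      (continuous_affineMap φ).comp continuous_subtype_val
    exact (isOpen_lt continuous_const hc).inter (isOpen_lt hc continuous_const)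
  · constructor
    · change φ x < φ (AffineMap.lineMap x y c)
      rw [affineMap_lineMap]; nlinarith
    · change φ (AffineMap.lineMap x y c) < φ y
      rw [affineMap_lineMap]; nlinarith

theorem Truncates.isVertexTruncation {A : ℕ → Space 4 →ᵃ[ℝ] ℝ} (hK : IsComplex N K)
    (h : Realizes N K p g P) (hA : Truncates N K p A) :
    IsVertexTruncation P (truncation N A P) := by
  -- Half-spaces are indexed by vertices as points, so the labelling `p` is inverted on its range.
  let idx : Space 4 → ℕ := Function.invFunOn p (Finset.range N : Set ℕ)
  have hidx : ∀ {u}, u < N → idx (p u) = u := fun {u} hu =>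
    (h.injOn hK).leftInvOn_invFunOn (Finset.mem_coe.2 (Finset.mem_range.2 hu))
  have hl : ∀ u x, A u x = (A u).linear x + A u 0 := fun u y => congrFun (A u).decomp y
  refine ⟨fun y => LinearMap.toContinuousLinearMap (A (idx y)).linear, fun y => -A (idx y) 0,
    ?_, ?_, ?_⟩
  · rw [h.vertices_eq hK]
    rintro _ ⟨u, hu, rfl⟩
    have hu := Finset.mem_range.1 hu
    simp only [hidx hu, LinearMap.coe_toContinuousLinearMap']
    refine ⟨by linarith [hA.neg u hu, hl u (p u)], ?_⟩
    rintro _ ⟨w, hw, rfl⟩ hne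
    have := hA.pos u hu w (Finset.mem_range.1 hw) fun h' => hne (by rw [h'])
    linarith [hl u (p w)]
  · rw [h.vertices_eq hK]
    ext x
    simp only [truncation, mem_ofPred_eq, and_congr_right_iff, forall_mem_image,
      LinearMap.coe_toContinuousLinearMap', Finset.mem_coe, Finset.mem_range]
    intro _
    refine forall_congr' fun u => forall_congr' fun hu => ?_
    rw [hidx hu]
    have := hl u x
    constructor <;> intro _ <;> linarith
  · intro e he
    obtain ⟨t, ht, rfl⟩ := (h.isFaceOfDim_one hK).1 he
    obtain ⟨u, w, huw, rfl⟩ := skel_two ht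
    have hu := hK.skel_lt ht (u := u) (by simp)
    have hw := hK.skel_lt ht (u := w) (by simp)
    obtain ⟨x, hx⟩ := hA.exists_edgePoint hK huw ht
    rw [convexHull_image_pair]
    refine ⟨x, ?_, ?_⟩
    · obtain ⟨c, h0, h1, rfl, -⟩ := hx
      exact mem_intrinsicInterior_segment ((hA.neg u hu).trans (hA.pos u hu w hw huw.symm)) h0 h1
    · refine Subset.antisymm ?_ ?_
      · rintro y ⟨hy, hyD⟩
        rw [segment_eq_image_lineMap] at hy
        obtain ⟨c, -, rfl⟩ := hy
        exact hA.edgePoint_unique hK huw ht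
          (hA.isEdgePoint_of_nonneg hK huw ht (hyD.2 u hu) (hyD.2 w hw)) hx
      · rintro _ rfl
        obtain ⟨c, h0, h1, rfl, hxu, hxw⟩ := hx
        refine ⟨by rw [segment_eq_image_lineMap]; exact ⟨c, ⟨h0.le, h1.le⟩, rfl⟩,
          lineMap_mem_of_realizes h hu hw h0.le h1.le, fun j hj => ?_⟩
        by_cases hju : j = u
        · rw [hju, hxu]
        by_cases hjw : j = w
        · rw [hjw, hxw]
        exact (hA.edge_pos hu hw hj hju hjw h0.le h1.le).le

end VertexTruncation

/-! ### Boolean intervals of the face lattice -/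

section Intervals

variable {d : ℕ} {α β : Type*} {V : Finset α} {W : Finset β} {I : α → β → Prop}
  {p : α → Space d} {g : β → Space d →ᵃ[ℝ] ℝ} {P : Set (Space d)}

/-- A lower interval of the face lattice is boolean if all sets of vertices of the face are
closed. -/
theorem HVRep.nonempty_iic_orderIso (h : HVRep V W I p g P) {m : ℕ} {T : Finset α}
    (hT : T.card = m) (hc : ∀ S ⊆ T, IsClosedSet V W I (S : Set α)) {F : FaceLattice P}
    (hF : F.1 = convexHull ℝ (p '' (T : Set α))) : Nonempty (Set.Iic F ≃o Finset (Fin m)) := by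
  classical
  let σ : Fin m ↪ α := (Finset.equivFinOfCardEq hT).symm.toEmbedding.trans
    (Function.Embedding.subtype _)
  have hσ : ∀ i, σ i ∈ T := fun i => ((Finset.equivFinOfCardEq hT).symm i).2
  have hσs : ∀ x ∈ T, ∃ i, σ i = x := fun x hx =>
    ⟨Finset.equivFinOfCardEq hT ⟨x, hx⟩, by simp [σ]⟩
  have hsub : ∀ s : Finset (Fin m), s.map σ ⊆ T := fun s x hx => by
    obtain ⟨i, -, rfl⟩ := Finset.mem_map.1 hx
    exact hσ i
  let φ : Finset (Fin m) → Set.Iic F := fun s =>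
    ⟨⟨convexHull ℝ (p '' (s.map σ : Set α)), h.isExposed_convexHull (hc _ (hsub s))⟩, by
      change convexHull ℝ _ ⊆ F.1
      rw [hF]
      exact convexHull_mono (image_mono (by exact_mod_cast hsub s))⟩
  have hφ : ∀ s t, φ s ≤ φ t ↔ s ≤ t := fun s t => by
    change convexHull ℝ _ ⊆ convexHull ℝ _ ↔ _
    rw [h.convexHull_subset_iff (hc _ (hsub s)) (hc _ (hsub t)), Finset.coe_subset,
      Finset.map_subset_map]
  refine ⟨(RelIso.ofSurjective (OrderEmbedding.ofMapLEIff φ hφ) ?_).symm⟩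
  rintro ⟨⟨G, hG⟩, hGF⟩
  have hGF : G ⊆ F.1 := hGF
  refine ⟨Finset.univ.filter fun i => p (σ i) ∈ G, Subtype.ext (Subtype.ext ?_)⟩
  change convexHull ℝ _ = G
  rw [h.eq_convexHull_of_isExposed hG]
  congr 2
  ext x
  simp only [Finset.coe_map, Finset.coe_filter, Finset.mem_univ, true_and, mem_image,
    mem_ofPred_eq]
  constructor
  · rintro ⟨i, hi, rfl⟩
    exact ⟨HVRep.subset_of_isClosedSet (hc T subset_rfl) (hσ i),
      h.eq_convexHull_of_isExposed hG ▸ hi⟩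
  · rintro ⟨hxV, hx⟩
    obtain ⟨i, rfl⟩ := hσs x ((h.mem_convexHull_iff (hc T subset_rfl) hxV).1 (hF ▸ hGF hx))
    exact ⟨i, h.eq_convexHull_of_isExposed hG ▸ hx, rfl⟩

/-- An upper interval of the face lattice is boolean if the facets through the face are
independent. -/
theorem HVRep.nonempty_ici_orderIso (h : HVRep V W I p g P) {m : ℕ} {T : Finset β}
    (hT : T.card = m) {F : FaceLattice P} (hF0 : F.1.Nonempty)
    (hTF : ∀ k, k ∈ T ↔ k ∈ W ∧ ∀ i ∈ V, p i ∈ F.1 → I i k)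
    (hsep : ∀ k ∈ T, ∃ i ∈ V, (∀ k' ∈ T, k' ≠ k → I i k') ∧ ¬ I i k) :
    Nonempty (Set.Ici F ≃o Finset (Fin m)) := by
  classical
  let σ : Fin m ↪ β := (Finset.equivFinOfCardEq hT).symm.toEmbedding.trans
    (Function.Embedding.subtype _)
  have hσ : ∀ i, σ i ∈ T := fun i => ((Finset.equivFinOfCardEq hT).symm i).2
  have hσs : ∀ x ∈ T, ∃ i, σ i = x := fun x hx =>
    ⟨Finset.equivFinOfCardEq hT ⟨x, hx⟩, by simp [σ]⟩
  -- The facets outside `s` are the ones imposed, so that a larger `s` gives a larger face.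
  let S : Finset (Fin m) → Set α := fun s => {i | i ∈ V ∧ ∀ k ∈ W, k ∈ (σ '' {j | j ∉ s}) → I i k}
  have hS : ∀ s, IsClosedSet V W I (S s) := fun s => Or.inr ⟨_, rfl⟩
  have hFS : ∀ s, F.1 ⊆ convexHull ℝ (p '' S s) := fun s => by
    rw [h.eq_convexHull_of_isExposed F.2]
    refine convexHull_mono (image_mono ?_)
    rintro i ⟨hi, hiF⟩
    refine ⟨hi, ?_⟩
    rintro k hk ⟨j, -, rfl⟩
    exact ((hTF _).1 (hσ j)).2 i hi hiF
  let φ : Finset (Fin m) → Set.Ici F := fun s =>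
    ⟨⟨convexHull ℝ (p '' S s), h.isExposed_convexHull (hS s)⟩, hFS s⟩
  have hφ : ∀ s t, φ s ≤ φ t ↔ s ≤ t := fun s t => by
    change convexHull ℝ _ ⊆ convexHull ℝ _ ↔ _
    rw [h.convexHull_subset_iff (hS s) (hS t)]
    constructor
    · intro hst j hj
      by_contra hjt
      obtain ⟨i, hi, hik, hij⟩ := hsep (σ j) (hσ j)
      have hiS : i ∈ S s := by
        refine ⟨hi, ?_⟩
        rintro k hk ⟨j', hj', rfl⟩
        refine hik _ (hσ j') fun heq => hj' ?_
        rw [σ.injective heq]; exact hj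
      exact hij ((hst hiS).2 _ ((hTF _).1 (hσ j)).1 ⟨j, hjt, rfl⟩)
    · rintro hst i ⟨hi, hi'⟩
      refine ⟨hi, ?_⟩
      rintro k hk ⟨j, hj, rfl⟩
      exact hi' _ hk ⟨j, fun hjs => hj (hst hjs), rfl⟩
  refine ⟨(RelIso.ofSurjective (OrderEmbedding.ofMapLEIff φ hφ) ?_).symm⟩
  rintro ⟨⟨G, hG⟩, hFG⟩
  have hFG : F.1 ⊆ G := hFG
  -- The preimage of `G` consists of the facets of `T` not containing `G`. This recovers `G`, since
  -- each facet over `G` contains `F` and hence belongs to `T`.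
  refine ⟨Finset.univ.filter fun j => ¬ ∀ i ∈ V, p i ∈ G → I i (σ j),
    Subtype.ext (Subtype.ext ?_)⟩
  change convexHull ℝ (p '' S _) = G
  have hG' := h.eq_convexHull_of_isExposed hG
  conv_rhs => rw [hG']
  congr 2
  ext i
  have hmem : ∀ j : Fin m, j ∈ {j | j ∉ Finset.univ.filter fun j => ¬ ∀ i ∈ V, p i ∈ G →
      I i (σ j)} ↔ ∀ i ∈ V, p i ∈ G → I i (σ j) := fun j => by simp
  constructor
  · rintro ⟨hi, hi'⟩
    refine ⟨hi, ?_⟩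
    rcases h.isClosedSet_of_isExposed hG with h0 | ⟨A, hA⟩
    · rw [hG', h0] at hFG
      simp at hFG
      exact absurd hFG hF0.ne_empty
    · have : i ∈ {i | i ∈ V ∧ p i ∈ G} := by
        rw [hA]
        refine ⟨hi, fun k hk hkA => ?_⟩
        have hkG : ∀ i ∈ V, p i ∈ G → I i k := fun i' hi' hi'G => by
          have : i' ∈ {i | i ∈ V ∧ p i ∈ G} := ⟨hi', hi'G⟩
          rw [hA] at this
          exact this.2 k hk hkA
        obtain ⟨j, rfl⟩ := hσs k ((hTF k).2 ⟨hk, fun i hi hiF => hkG i hi (hFG hiF)⟩)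
        exact hi' _ hk ⟨j, (hmem j).2 hkG, rfl⟩
      exact this.2
  · rintro ⟨hi, hiG⟩
    refine ⟨hi, ?_⟩
    rintro k hk ⟨j, hj, rfl⟩
    exact (hmem j).1 hj i hi hiG

end Intervals

/-! ### Combinatorics of the intervals that become faces -/

section Cells

/-- The edges in the interval `x` of the face lattice. -/
def edgeSet (K : Finset (Finset ℕ)) (x : Finset ℕ × Finset ℕ) : Finset (Finset ℕ) :=
  (skel K 2).filter fun e => x.1 ⊆ e ∧ e ⊆ x.2

theorem mem_edgeSet {K : Finset (Finset ℕ)} {x : Finset ℕ × Finset ℕ} {e : Finset ℕ} :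
    e ∈ edgeSet K x ↔ e ∈ skel K 2 ∧ x.1 ⊆ e ∧ e ⊆ x.2 := Finset.mem_filter

/-- The pairs of a vertex and a face containing it. -/
def vertexFlags (T : Finset (Finset ℕ)) : Finset (Finset ℕ × Finset ℕ) :=
  T.biUnion fun t => t.image fun v => ({v}, t)

theorem mem_vertexFlags {T : Finset (Finset ℕ)} {x : Finset ℕ × Finset ℕ} :
    x ∈ vertexFlags T ↔ ∃ t ∈ T, ∃ v ∈ t, x = ({v}, t) := by
  simp [vertexFlags, eq_comm]

/-- The intervals in the face lattice that represent the `j`-faces of the truncation. -/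
def cells (N : ℕ) (K : Finset (Finset ℕ)) : ℕ → Finset (Finset ℕ × Finset ℕ)
  | 0 => (skel K 2).image fun e => (e, e)
  | 1 => vertexFlags (skel K 3)
  | 2 => (skel K 3).image (fun t => (∅, t)) ∪ vertexFlags K
  | 3 => truncFacets N K
  | 4 => {(∅, Finset.range N)}
  | _ => ∅

/-- The common shape of all intervals representing faces of the truncation. -/
def IsCell (N : ℕ) (K : Finset (Finset ℕ)) (x : Finset ℕ × Finset ℕ) : Prop :=
  (∃ e ∈ skel K 2, x = (e, e)) ∨
    x.1.card ≤ 1 ∧ x.1 ⊆ x.2 ∧ (x.2 ∈ skel K 3 ∨ x.2 ∈ K ∨ x.2 = Finset.range N)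

variable {N : ℕ} {K : Finset (Finset ℕ)}

theorem isCell_of_mem_cells {j : ℕ} {x : Finset ℕ × Finset ℕ} (hx : x ∈ cells N K j) :
    IsCell N K x := by
  match j, hx with
  | 0, hx => left; simpa [cells, eq_comm] using hx
  | 1, hx =>
    obtain ⟨t, ht, v, hv, rfl⟩ := mem_vertexFlags.1 hx
    exact Or.inr ⟨by simp, by simpa using hv, Or.inl ht⟩
  | 2, hx =>
    rcases Finset.mem_union.1 hx with hx | hx
    · obtain ⟨t, ht, rfl⟩ := Finset.mem_image.1 hx
      exact Or.inr ⟨by simp, by simp, Or.inl ht⟩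
    · obtain ⟨t, ht, v, hv, rfl⟩ := mem_vertexFlags.1 hx
      exact Or.inr ⟨by simp, by simpa using hv, Or.inr (Or.inl ht)⟩
  | 3, hx =>
    rcases mem_truncFacets.1 hx with ⟨f, hf, rfl⟩ | ⟨v, hv, rfl⟩
    · exact Or.inr ⟨by simp, by simp, Or.inr (Or.inl hf)⟩
    · exact Or.inr ⟨by simp, by simpa using hv, Or.inr (Or.inr rfl)⟩
  | 4, hx =>
    rw [Finset.mem_singleton.1 hx]
    exact Or.inr ⟨by simp, by simp, Or.inr (Or.inr rfl)⟩
  | j + 5, hx => simp [cells] at hx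

theorem exists_edge {f s b : Finset ℕ} (hf : f ∈ K) (hsf : s ⊆ f) (hbs : b ⊆ s) (hb : b.card ≤ 2)
    (hs : 2 ≤ s.card) : ∃ e ∈ skel K 2, b ⊆ e ∧ e ⊆ s := by
  obtain ⟨e, hbe, hes, hec⟩ := Finset.exists_subsuperset_card_eq hbs hb hs
  exact ⟨e, mem_skel.2 ⟨f, hf, hes.trans hsf, hec⟩, hbe, hes⟩

namespace IsComplex

/-- Every interval contains one whose upper end is a proper face with at least three vertices. -/
theorem exists_face_le (hK : IsComplex N K) {x : Finset ℕ × Finset ℕ} (h1 : x.1.card ≤ 1)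
    (h2 : x.1 ⊆ x.2) (h3 : x.2 ∈ skel K 3 ∨ x.2 ∈ K ∨ x.2 = Finset.range N) :
    ∃ f ∈ K, ∃ s ⊆ f, x.1 ⊆ s ∧ s ⊆ x.2 ∧ 3 ≤ s.card := by
  rcases h3 with h3 | h3 | h3
  · obtain ⟨f, hf, htf, htc⟩ := mem_skel.1 h3
    exact ⟨f, hf, x.2, htf, h2, subset_rfl, htc.ge⟩
  · exact ⟨x.2, h3, x.2, subset_rfl, h2, subset_rfl, by rw [hK.card _ h3]; norm_num⟩
  · rcases Nat.le_one_iff_eq_zero_or_eq_one.1 h1 with h0 | h0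
    · obtain ⟨f, hf⟩ := hK.nonempty
      exact ⟨f, hf, f, subset_rfl, by simp [Finset.card_eq_zero.1 h0], h3 ▸ hK.sub f hf,
        by rw [hK.card _ hf]; norm_num⟩
    · obtain ⟨v, hv⟩ := Finset.card_eq_one.1 h0
      have hvN : v < N := by
        have : v ∈ x.2 := h2 (by rw [hv]; simp)
        rw [h3] at this
        exact Finset.mem_range.1 this
      obtain ⟨f, hf, hvf⟩ := hK.cover v hvN
      exact ⟨f, hf, f, subset_rfl, by rw [hv]; simpa using hvf, h3 ▸ hK.sub f hf,
        by rw [hK.card _ hf]; norm_num⟩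

theorem edgeSet_nonempty (hK : IsComplex N K) {x : Finset ℕ × Finset ℕ} (hx : IsCell N K x) :
    (edgeSet K x).Nonempty := by
  rcases hx with ⟨e, he, rfl⟩ | ⟨h1, h2, h3⟩
  · exact ⟨e, mem_edgeSet.2 ⟨he, subset_rfl, subset_rfl⟩⟩
  · obtain ⟨f, hf, s, hsf, hbs, hst, hs⟩ := hK.exists_face_le h1 h2 h3
    obtain ⟨e, he, hbe, hes⟩ := exists_edge hf hsf hbs (by omega) (by omega)
    exact ⟨e, mem_edgeSet.2 ⟨he, hbe, hes.trans hst⟩⟩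

theorem upper_subset (hK : IsComplex N K) {x : Finset ℕ × Finset ℕ} (hx : IsCell N K x) :
    x.2 ⊆ Finset.range N := by
  rcases hx with ⟨e, he, rfl⟩ | ⟨-, -, h | h | h⟩
  · exact fun i hi => Finset.mem_range.2 (hK.skel_lt he hi)
  · exact fun i hi => Finset.mem_range.2 (hK.skel_lt h hi)
  · exact hK.sub _ h
  · exact h.le

/-- An interval is recovered from its edges, in essence as their intersection and their union. The
exception is ({v}, P), as `v` need not be joined to every vertex; there one uses that the neighbours
of `v` do not fit into one facet. -/
theorem edgeSet_subset_iff (hK : IsComplex N K) {x y : Finset ℕ × Finset ℕ} (hx : IsCell N K x)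
    (hy : IsCell N K y) : edgeSet K x ⊆ edgeSet K y ↔ y.1 ⊆ x.1 ∧ x.2 ⊆ y.2 := by
  constructor
  · intro hxy
    have hxy' : ∀ e ∈ skel K 2, x.1 ⊆ e → e ⊆ x.2 → y.1 ⊆ e ∧ e ⊆ y.2 := fun e he h1 h2 =>
      (mem_edgeSet.1 (hxy (mem_edgeSet.2 ⟨he, h1, h2⟩))).2
    have hyf : y.2 = Finset.range N ∨ ∃ f ∈ K, y.2 ⊆ f := by
      rcases hy with ⟨e, he, rfl⟩ | ⟨-, -, h | h | h⟩
      · obtain ⟨f, hf, hef, -⟩ := mem_skel.1 he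
        exact Or.inr ⟨f, hf, hef⟩
      · obtain ⟨f, hf, hef, -⟩ := mem_skel.1 h
        exact Or.inr ⟨f, hf, hef⟩
      · exact Or.inr ⟨_, h, subset_rfl⟩
      · exact Or.inl h
    have hxN := hK.upper_subset hx
    rcases hx with ⟨e, he, rfl⟩ | ⟨h1, h2, h3⟩
    · exact hxy' e he subset_rfl subset_rfl
    obtain ⟨f, hf, s, hsf, hbs, hst, hs⟩ := hK.exists_face_le h1 h2 h3
    refine ⟨fun i hi => ?_, fun i hi => ?_⟩
    · by_contra hix
      -- As `s` has at least three vertices, an edge of the interval avoiding `i` remains.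
      obtain ⟨e, he, hbe, hes⟩ := exists_edge (b := x.1) (s := s.erase i) hf
        ((Finset.erase_subset _ _).trans hsf)
        (fun j hj => Finset.mem_erase.2 ⟨fun hji => hix (hji ▸ hj), hbs hj⟩) (by omega)
        (by have := Finset.pred_card_le_card_erase (s := s) (a := i); omega)
      exact Finset.notMem_erase i s
        (hes ((hxy' e he hbe (hes.trans ((Finset.erase_subset _ _).trans hst))).1 hi))
    · have hins : (insert i x.1).card ≤ 2 := (Finset.card_insert_le _ _).trans (by omega)
      have face : ∀ f ∈ K, ∀ s ⊆ f, insert i x.1 ⊆ s → s ⊆ x.2 → 2 ≤ s.card → i ∈ y.2 := by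
        intro f hf s hsf his hst hs
        obtain ⟨e, he, hbe, hes⟩ := exists_edge hf hsf his hins hs
        exact (hxy' e he ((Finset.subset_insert _ _).trans hbe) (hes.trans hst)).2
          (hbe (Finset.mem_insert_self _ _))
      rcases h3 with h3 | h3 | h3
      · obtain ⟨f, hf, htf, htc⟩ := mem_skel.1 h3
        exact face f hf _ htf (Finset.insert_subset hi h2) subset_rfl (by omega)
      · exact face _ h3 _ subset_rfl (Finset.insert_subset hi h2) subset_rfl
          (by rw [hK.card _ h3]; norm_num)
      · have hiN : i < N := by rw [h3] at hi; exact Finset.mem_range.1 hi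
        rcases Nat.le_one_iff_eq_zero_or_eq_one.1 h1 with h0 | h0
        · obtain ⟨f, hf, hif⟩ := hK.cover i hiN
          exact face f hf f subset_rfl (by simpa [Finset.card_eq_zero.1 h0] using hif)
            (h3 ▸ hK.sub f hf) (by rw [hK.card _ hf]; norm_num)
        · rcases hyf with hyN | ⟨f₀, hf₀, hyf₀⟩
          · rw [hyN]; exact Finset.mem_range.2 hiN
          -- If `y.2` lay in a facet `f₀`, all neighbours of `v` would too. But crossing a triangle
          -- of `f₀` that contains `v` leads to a neighbour outside `f₀`.
          exfalso
          obtain ⟨v, hv⟩ := Finset.card_eq_one.1 h0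
          obtain ⟨e, he, hbe, hes⟩ := exists_edge hf hsf hbs (by omega) (by omega)
          have hvf₀ : v ∈ f₀ := hyf₀ ((hxy' e he hbe (hes.trans hst)).2 (hbe (by rw [hv]; simp)))
          obtain ⟨w, hw, hwv⟩ := Finset.exists_mem_ne
            (by rw [hK.card _ hf₀]; norm_num : 1 < f₀.card) v
          obtain ⟨f', hf', hne, hsub, hwf'⟩ := hK.neighbour hf₀ hw
          have hvf' : v ∈ f' := hsub (Finset.mem_erase.2 ⟨hwv.symm, hvf₀⟩)
          obtain ⟨u, huf', huf₀⟩ : ∃ u ∈ f', u ∉ f₀ := by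
            by_contra! hcon
            exact hne (Finset.eq_of_subset_of_card_le hcon
              (by rw [hK.card _ hf₀, hK.card _ hf']))
          obtain ⟨e, he, hbe, hes⟩ := exists_edge (b := {v, u}) hf' subset_rfl
            (by simp [Finset.insert_subset_iff, hvf', huf']) Finset.card_le_two
            (by rw [hK.card _ hf']; norm_num)
          refine huf₀ (hyf₀ ((hxy' e he ?_ ?_).2 (hbe (by simp))))
          · rw [hv]; exact (Finset.singleton_subset_iff.2 (hbe (by simp)))
          · rw [h3]; exact hes.trans (hK.sub f' hf')
  · rintro ⟨h1, h2⟩ e he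
    obtain ⟨he, hxe, hex⟩ := mem_edgeSet.1 he
    exact mem_edgeSet.2 ⟨he, h1.trans hxe, hex.trans h2⟩

theorem exists_facet_notMem (hK : IsComplex N K) {f t : Finset ℕ} (hf : f ∈ K) (ht : t ⊆ f)
    {i : ℕ} (hi : i ∉ t) : ∃ f' ∈ K, t ⊆ f' ∧ i ∉ f' := by
  by_cases hif : i ∈ f
  · obtain ⟨f', hf', -, hsub, hif'⟩ := hK.neighbour hf hif
    exact ⟨f', hf', fun j hj => hsub (Finset.mem_erase.2 ⟨fun hji => hi (hji ▸ hj), ht hj⟩), hif'⟩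
  · exact ⟨f, hf, ht, hif⟩

/-- The vertex facets at the elements of `x.1` force `x.1 ⊆ e`. The facets over `x.2` intersect in
`x.2` if it is a proper face, and force `e ⊆ x.2`. -/
theorem isClosedSet_edgeSet (hK : IsComplex N K) {x : Finset ℕ × Finset ℕ} (hx : IsCell N K x) :
    IsClosedSet (skel K 2) (truncFacets N K) (fun e y => y.1 ⊆ e ∧ e ⊆ y.2)
      (edgeSet K x : Set (Finset ℕ)) := by
  have hxN := hK.upper_subset hx
  have h12 : x.1 ⊆ x.2 := by
    rcases hx with ⟨e, he, rfl⟩ | h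
    · exact subset_rfl
    · exact h.2.1
  have hxf : x.2 = Finset.range N ∨ ∃ f ∈ K, x.2 ⊆ f := by
    rcases hx with ⟨e, he, rfl⟩ | ⟨-, -, h | h | h⟩
    · obtain ⟨f, hf, hef, -⟩ := mem_skel.1 he
      exact Or.inr ⟨f, hf, hef⟩
    · obtain ⟨f, hf, hef, -⟩ := mem_skel.1 h
      exact Or.inr ⟨f, hf, hef⟩
    · exact Or.inr ⟨_, h, subset_rfl⟩
    · exact Or.inl h
  refine Or.inr ⟨{y | y.1 ⊆ x.1 ∧ x.2 ⊆ y.2}, ?_⟩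
  ext e
  rw [Finset.mem_coe, mem_edgeSet]
  constructor
  · rintro ⟨he, hxe, hex⟩
    exact ⟨he, fun y _ hy => ⟨hy.1.trans hxe, hex.trans hy.2⟩⟩
  · rintro ⟨he, h⟩
    refine ⟨he, fun i hi => ?_, fun i hi => ?_⟩
    · have := h ({i}, Finset.range N)
        (mem_truncFacets.2 (Or.inr ⟨i, Finset.mem_range.1 (hxN (h12 hi)), rfl⟩))
        ⟨Finset.singleton_subset_iff.2 hi, hxN⟩
      exact Finset.singleton_subset_iff.1 this.1
    · rcases hxf with hxf | ⟨f, hf, hxf⟩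
      · rw [hxf]; exact Finset.mem_range.2 (hK.skel_lt he hi)
      · by_contra hix
        obtain ⟨f', hf', hsub, hif'⟩ := hK.exists_facet_notMem hf hxf hix
        exact hif' ((h (∅, f') (mem_truncFacets.2 (Or.inl ⟨f', hf', rfl⟩))
          ⟨Finset.empty_subset _, hsub⟩).2 hi)

/-- The facets in `A` amount to a single condition `b ⊆ e ⊆ t`. An edge satisfying it gives `b.card
≤ 2 ≤ t.card`, which leaves only the listed intervals. -/
theorem exists_cell_of_isClosedSet (hK : IsComplex N K) {S : Set (Finset ℕ)}
    (hS : IsClosedSet (skel K 2) (truncFacets N K) (fun e y => y.1 ⊆ e ∧ e ⊆ y.2) S)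
    (hS0 : S.Nonempty) : ∃ j < 5, ∃ x ∈ cells N K j, S = (edgeSet K x : Set (Finset ℕ)) := by
  classical
  rcases hS with rfl | ⟨A, rfl⟩
  · exact absurd hS0 (by simp)
  obtain ⟨e₀, he₀, hA₀⟩ := hS0
  let b : Finset ℕ := (Finset.range N).filter fun v => (({v} : Finset ℕ), Finset.range N) ∈ A
  let t : Finset ℕ := (Finset.range N).filter fun i => ∀ f ∈ K, ((∅ : Finset ℕ), f) ∈ A → i ∈ f
  have heq : {e | e ∈ skel K 2 ∧ ∀ y ∈ truncFacets N K, y ∈ A → y.1 ⊆ e ∧ e ⊆ y.2} =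
      (edgeSet K (b, t) : Set (Finset ℕ)) := by
    ext e
    rw [Finset.mem_coe, mem_edgeSet]
    refine and_congr_right fun he => ⟨fun h => ⟨fun v hv => ?_, fun i hi => ?_⟩, fun h y hy hyA => ?_⟩
    · obtain ⟨hvN, hvA⟩ := Finset.mem_filter.1 hv
      exact Finset.singleton_subset_iff.1
        (h _ (mem_truncFacets.2 (Or.inr ⟨v, Finset.mem_range.1 hvN, rfl⟩)) hvA).1
    · exact Finset.mem_filter.2 ⟨Finset.mem_range.2 (hK.skel_lt he hi), fun f hf hfA =>
        (h _ (mem_truncFacets.2 (Or.inl ⟨f, hf, rfl⟩)) hfA).2 hi⟩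
    · rcases mem_truncFacets.1 hy with ⟨f, hf, rfl⟩ | ⟨v, hv, rfl⟩
      · exact ⟨Finset.empty_subset _, fun i hi => (Finset.mem_filter.1 (h.2 hi)).2 f hf hyA⟩
      · exact ⟨Finset.singleton_subset_iff.2
          (h.1 (Finset.mem_filter.2 ⟨Finset.mem_range.2 hv, hyA⟩)),
          fun i hi => Finset.mem_range.2 (hK.skel_lt he hi)⟩
  have he₀' : e₀ ∈ edgeSet K (b, t) := by
    rw [← Finset.mem_coe, ← heq]; exact ⟨he₀, hA₀⟩
  rw [heq]
  obtain ⟨-, hbe, het⟩ := mem_edgeSet.1 he₀'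
  dsimp only at hbe het
  obtain ⟨-, -, -, hec⟩ := mem_skel.1 he₀
  -- If `b` or `t` has two elements, then `e₀` is the only edge in between and the face is a vertex.
  have single : (∀ e ∈ skel K 2, b ⊆ e → e ⊆ t → e = e₀) → ∃ j < 5, ∃ x ∈ cells N K j,
      (edgeSet K (b, t) : Set (Finset ℕ)) = (edgeSet K x : Set (Finset ℕ)) := by
    intro h
    refine ⟨0, by norm_num, (e₀, e₀), Finset.mem_image.2 ⟨e₀, he₀, rfl⟩, ?_⟩
    congr 1
    ext e
    rw [mem_edgeSet, mem_edgeSet]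
    exact ⟨fun ⟨he, h1, h2⟩ => ⟨he, (h e he h1 h2).ge, (h e he h1 h2).le⟩,
      fun ⟨he, h1, h2⟩ => by rw [← h1.antisymm h2]; exact ⟨he₀, hbe, het⟩⟩
  have hskel : ∀ e ∈ skel K 2, e.card = 2 := fun e he => by
    obtain ⟨-, -, -, h⟩ := mem_skel.1 he; exact h
  have hbc := Finset.card_le_card hbe
  rcases Nat.lt_or_ge 1 b.card with hb | hb
  · refine single fun e he h1 _ => ?_
    have e1 := Finset.eq_of_subset_of_card_le hbe (by omega)
    have e2 := Finset.eq_of_subset_of_card_le h1 (by rw [hskel e he]; omega)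
    exact e2.symm.trans e1
  have htT : t = Finset.range N ∨ ∃ f ∈ K, t ⊆ f := by
    by_cases hT : ∃ f ∈ K, ((∅ : Finset ℕ), f) ∈ A
    · obtain ⟨f, hf, hfA⟩ := hT
      exact Or.inr ⟨f, hf, fun i hi => (Finset.mem_filter.1 hi).2 f hf hfA⟩
    · push Not at hT
      exact Or.inl (Finset.filter_true_of_mem fun i _ f hf hfA => absurd hfA (hT f hf))
  have hb' : b = ∅ ∨ ∃ v ∈ t, v < N ∧ b = {v} := by
    rcases Nat.le_one_iff_eq_zero_or_eq_one.1 hb with hb | hb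
    · exact Or.inl (Finset.card_eq_zero.1 hb)
    · obtain ⟨v, hv⟩ := Finset.card_eq_one.1 hb
      have hve : v ∈ e₀ := hbe (by rw [hv]; simp)
      exact Or.inr ⟨v, het hve, hK.skel_lt he₀ hve, hv⟩
  rcases htT with ht | ⟨f, hf, htf⟩
  · rcases hb' with hb' | ⟨v, -, hv, hb'⟩
    · exact ⟨4, by norm_num, (b, t), by rw [hb', ht]; simp [cells], rfl⟩
    · exact ⟨3, by norm_num, (b, t), by rw [hb', ht]; exact mem_truncFacets.2 (Or.inr ⟨v, hv, rfl⟩),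
        rfl⟩
  · have h1 := Finset.card_le_card htf
    have h2 := Finset.card_le_card het
    rw [hK.card f hf] at h1
    rw [hec] at h2
    obtain h | h | h : t.card = 2 ∨ t.card = 3 ∨ t.card = 4 := by omega
    · refine single fun e he _ h' => ?_
      have e1 := Finset.eq_of_subset_of_card_le het (by omega)
      have e2 := Finset.eq_of_subset_of_card_le h' (by rw [hskel e he]; omega)
      exact e2.trans e1.symm
    · have ht3 : t ∈ skel K 3 := mem_skel.2 ⟨f, hf, htf, h⟩
      rcases hb' with hb' | ⟨v, hv, -, hb'⟩
      · exact ⟨2, by norm_num, (b, t), by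
          rw [hb']; exact Finset.mem_union_left _ (Finset.mem_image.2 ⟨t, ht3, rfl⟩), rfl⟩
      · exact ⟨1, by norm_num, (b, t), by rw [hb']; exact mem_vertexFlags.2 ⟨t, ht3, v, hv, rfl⟩,
          rfl⟩
    · have htK : t ∈ K := by
        rw [Finset.eq_of_subset_of_card_le htf (by rw [hK.card f hf, h])]; exact hf
      rcases hb' with hb' | ⟨v, hv, -, hb'⟩
      · exact ⟨3, by norm_num, (b, t), by
          rw [hb']; exact mem_truncFacets.2 (Or.inl ⟨t, htK, rfl⟩), rfl⟩
      · exact ⟨2, by norm_num, (b, t), by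
          rw [hb']; exact Finset.mem_union_right _ (mem_vertexFlags.2 ⟨t, htK, v, hv, rfl⟩), rfl⟩

/-- With `exists_cell_below` this places every cell in a chain with one cell of each rank from 0 to
4, which pins down the dimensions. -/
theorem exists_cell_above (hK : IsComplex N K) {j : ℕ} (hj : j < 4) {x : Finset ℕ × Finset ℕ}
    (hx : x ∈ cells N K j) : ∃ y ∈ cells N K (j + 1), y.1 ⊆ x.1 ∧ x.2 ⊆ y.2 ∧ x ≠ y := by
  interval_cases j
  · obtain ⟨e, he, rfl⟩ := Finset.mem_image.1 hx
    obtain ⟨f, hf, hef, hec⟩ := mem_skel.1 he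
    obtain ⟨r, her, hrf, hrc⟩ := Finset.exists_subsuperset_card_eq hef (by omega : e.card ≤ 3)
      (by rw [hK.card f hf]; norm_num)
    obtain ⟨v, hv⟩ : e.Nonempty := Finset.card_pos.1 (by omega)
    refine ⟨({v}, r), mem_vertexFlags.2 ⟨r, mem_skel.2 ⟨f, hf, hrf, hrc⟩, v, her hv, rfl⟩,
      by simpa using hv, her, fun h => ?_⟩
    have := congrArg (fun y => y.2.card) h
    simp only at this; omega
  · obtain ⟨t, ht, v, hv, rfl⟩ := mem_vertexFlags.1 hx
    exact ⟨(∅, t), Finset.mem_union_left _ (Finset.mem_image.2 ⟨t, ht, rfl⟩), by simp, by simp,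
      by simp⟩
  · rcases Finset.mem_union.1 hx with hx | hx
    · obtain ⟨t, ht, rfl⟩ := Finset.mem_image.1 hx
      obtain ⟨f, hf, htf, htc⟩ := mem_skel.1 ht
      refine ⟨(∅, f), mem_truncFacets.2 (Or.inl ⟨f, hf, rfl⟩), by simp, htf, fun h => ?_⟩
      have := congrArg (fun y => y.2.card) h
      simp only [hK.card f hf] at this; omega
    · obtain ⟨f, hf, v, hv, rfl⟩ := mem_vertexFlags.1 hx
      exact ⟨(∅, f), mem_truncFacets.2 (Or.inl ⟨f, hf, rfl⟩), by simp, by simp, by simp⟩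
  · refine ⟨(∅, Finset.range N), by simp [cells], by simp,
      hK.upper_subset (isCell_of_mem_cells hx), ?_⟩
    rcases mem_truncFacets.1 hx with ⟨f, hf, rfl⟩ | ⟨v, hv, rfl⟩
    · intro h
      have := congrArg (fun y => y.2.card) h
      simp only [hK.card f hf, Finset.card_range] at this
      have := hK.five_le
      omega
    · simp

theorem exists_cell_below (hK : IsComplex N K) {j : ℕ} (hj : j < 4) {x : Finset ℕ × Finset ℕ}
    (hx : x ∈ cells N K (j + 1)) : ∃ y ∈ cells N K j, x.1 ⊆ y.1 ∧ y.2 ⊆ x.2 ∧ y ≠ x := by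
  interval_cases j
  · obtain ⟨t, ht, v, hv, rfl⟩ := mem_vertexFlags.1 hx
    obtain ⟨f, hf, htf, htc⟩ := mem_skel.1 ht
    obtain ⟨e, he, hve, het⟩ := exists_edge hf htf (Finset.singleton_subset_iff.2 hv) (by simp)
      (by omega)
    refine ⟨(e, e), Finset.mem_image.2 ⟨e, he, rfl⟩, hve, het, fun h => ?_⟩
    obtain ⟨-, -, -, hec⟩ := mem_skel.1 he
    have := congrArg (fun y => y.1.card) h
    simp only [Finset.card_singleton] at this; omega
  · rcases Finset.mem_union.1 hx with hx | hx
    · obtain ⟨t, ht, rfl⟩ := Finset.mem_image.1 hx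
      obtain ⟨f, hf, htf, htc⟩ := mem_skel.1 ht
      obtain ⟨v, hv⟩ : t.Nonempty := Finset.card_pos.1 (by omega)
      exact ⟨({v}, t), mem_vertexFlags.2 ⟨t, ht, v, hv, rfl⟩, by simp, by simp, by simp⟩
    · obtain ⟨f, hf, v, hv, rfl⟩ := mem_vertexFlags.1 hx
      obtain ⟨r, hvr, hrf, hrc⟩ := Finset.exists_subsuperset_card_eq
        (Finset.singleton_subset_iff.2 hv) (by simp : _ ≤ 3) (by rw [hK.card f hf]; norm_num)
      refine ⟨({v}, r), mem_vertexFlags.2 ⟨r, mem_skel.2 ⟨f, hf, hrf, hrc⟩, v,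
        Finset.singleton_subset_iff.1 hvr, rfl⟩, by simp, hrf, fun h => ?_⟩
      have := congrArg (fun y => y.2.card) h
      simp only [hK.card f hf] at this; omega
  · rcases mem_truncFacets.1 hx with ⟨f, hf, rfl⟩ | ⟨v, hv, rfl⟩
    · obtain ⟨v, hv⟩ : f.Nonempty := Finset.card_pos.1 (by rw [hK.card f hf]; norm_num)
      exact ⟨({v}, f), Finset.mem_union_right _ (mem_vertexFlags.2 ⟨f, hf, v, hv, rfl⟩),
        by simp, by simp, by simp⟩
    · obtain ⟨f, hf, hvf⟩ := hK.cover v hv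
      refine ⟨({v}, f), Finset.mem_union_right _ (mem_vertexFlags.2 ⟨f, hf, v, hvf, rfl⟩),
        by simp, hK.sub f hf, fun h => ?_⟩
      have := congrArg (fun y => y.2.card) h
      simp only [hK.card f hf, Finset.card_range] at this
      have := hK.five_le
      omega
  · rw [Finset.mem_singleton.1 hx]
    exact ⟨({0}, Finset.range N), mem_truncFacets.2 (Or.inr ⟨0, by have := hK.five_le; omega, rfl⟩),
      by simp, by simp, by simp⟩

theorem card_vertexFlags {T : Finset (Finset ℕ)} {m : ℕ} (hT : ∀ t ∈ T, t.card = m) :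
    (vertexFlags T).card = T.card * m := by
  rw [vertexFlags, Finset.card_biUnion]
  · rw [← smul_eq_mul, ← Finset.sum_const]
    refine Finset.sum_congr rfl fun t ht => ?_
    rw [Finset.card_image_of_injective _ fun a b hab => by simpa using hab, hT t ht]
  · intro s _ t _ hst
    refine Finset.disjoint_left.2 fun x hx hx' => hst ?_
    obtain ⟨v, -, rfl⟩ := Finset.mem_image.1 hx
    obtain ⟨w, -, hw⟩ := Finset.mem_image.1 hx'
    exact (congrArg Prod.snd hw).symm

theorem card_cells (hK : IsComplex N K) :
    (cells N K 0).card = (skel K 2).card ∧ (cells N K 1).card = (skel K 3).card * 3 ∧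
    (cells N K 2).card = (skel K 3).card + K.card * 4 ∧ (cells N K 3).card = K.card + N ∧
    (cells N K 4).card = 1 := by
  have h3 : ∀ t ∈ skel K 3, t.card = 3 := fun t ht => by
    obtain ⟨-, -, -, h⟩ := mem_skel.1 ht; exact h
  refine ⟨?_, ?_, ?_, ?_, ?_⟩
  · exact Finset.card_image_of_injective _ fun a b hab => (Prod.ext_iff.1 hab).1
  · exact card_vertexFlags h3
  · rw [cells, Finset.card_union_of_disjoint, card_vertexFlags hK.card,
      Finset.card_image_of_injective _ fun a b hab => (Prod.ext_iff.1 hab).2]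
    refine Finset.disjoint_left.2 fun x hx hx' => ?_
    obtain ⟨t, -, rfl⟩ := Finset.mem_image.1 hx
    obtain ⟨f, -, v, -, h⟩ := mem_vertexFlags.1 hx'
    simp at h
  · rw [cells, truncFacets, Finset.card_union_of_disjoint,
      Finset.card_image_of_injective _ fun a b hab => (Prod.ext_iff.1 hab).2,
      Finset.card_image_of_injective _ fun a b hab => by simpa using hab, Finset.card_range]
    refine Finset.disjoint_left.2 fun x hx hx' => ?_
    obtain ⟨t, -, rfl⟩ := Finset.mem_image.1 hx
    obtain ⟨v, -, h⟩ := Finset.mem_image.1 hx'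
    simp at h
  · simp [cells]

/-- The number of incidences between edges and facets of the truncation. -/
theorem sum_card_edgeSet (hK : IsComplex N K) :
    ∑ y ∈ truncFacets N K, (edgeSet K y).card = K.card * 6 + (skel K 2).card * 2 := by
  rw [truncFacets, Finset.sum_union, Finset.sum_image, Finset.sum_image]
  · congr 1
    · rw [← smul_eq_mul, ← Finset.sum_const]
      refine Finset.sum_congr rfl fun f hf => ?_
      have : edgeSet K (∅, f) = f.powersetCard 2 := by
        ext e
        rw [mem_edgeSet, Finset.mem_powersetCard]
        constructor
        · rintro ⟨he, -, hef⟩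
          obtain ⟨-, -, -, hec⟩ := mem_skel.1 he
          exact ⟨hef, hec⟩
        · rintro ⟨hef, hec⟩
          exact ⟨mem_skel.2 ⟨f, hf, hef, hec⟩, Finset.empty_subset _, hef⟩
      rw [this, Finset.card_powersetCard, hK.card f hf]
      rfl
    · have h1 : ∀ v ∈ Finset.range N, (edgeSet K ({v}, Finset.range N)).card =
          (Finset.bipartiteAbove (fun (v : ℕ) (e : Finset ℕ) => v ∈ e) (skel K 2) v).card := by
        intro v _
        congr 1
        ext e
        rw [mem_edgeSet, Finset.mem_bipartiteAbove]
        simp only [Finset.singleton_subset_iff]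
        exact ⟨fun h => ⟨h.1, h.2.1⟩, fun h => ⟨h.1, h.2, fun i hi =>
          Finset.mem_range.2 (hK.skel_lt h.1 hi)⟩⟩
      rw [Finset.sum_congr rfl h1, Finset.sum_card_bipartiteAbove_eq_sum_card_bipartiteBelow,
        ← smul_eq_mul, ← Finset.sum_const]
      refine Finset.sum_congr rfl fun e he => ?_
      obtain ⟨-, -, -, hec⟩ := mem_skel.1 he
      rw [← hec]
      congr 1
      ext i
      rw [Finset.mem_bipartiteBelow]
      exact ⟨fun h => h.2, fun h => ⟨Finset.mem_range.2 (hK.skel_lt he h), h⟩⟩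
  · exact fun a _ b _ hab => by simpa using hab
  · exact fun a _ b _ hab => (Prod.ext_iff.1 hab).2
  · refine Finset.disjoint_left.2 fun x hx hx' => ?_
    obtain ⟨t, -, rfl⟩ := Finset.mem_image.1 hx
    obtain ⟨v, -, h⟩ := Finset.mem_image.1 hx'
    simp at h

end IsComplex

end Cells

/-! ### Faces, flags, simpliciality and simplicity of the truncation -/

section TruncationFaces

variable {N : ℕ} {K : Finset (Finset ℕ)} {q : Finset ℕ → Space 4}
  {g : Finset ℕ × Finset ℕ → Space 4 →ᵃ[ℝ] ℝ} {D : Set (Space 4)}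

/-- The face of the truncation given by an interval. -/
def cellHull (K : Finset (Finset ℕ)) (q : Finset ℕ → Space 4) (x : Finset ℕ × Finset ℕ) :
    Set (Space 4) := convexHull ℝ (q '' (edgeSet K x : Set (Finset ℕ)))

namespace IsTruncation

theorem isExposed_cellHull (hK : IsComplex N K) (h : IsTruncation N K q g D)
    {x : Finset ℕ × Finset ℕ} (hx : IsCell N K x) : IsExposed ℝ D (cellHull K q x) :=
  h.isExposed_convexHull (hK.isClosedSet_edgeSet hx)

theorem cellHull_nonempty (hK : IsComplex N K) {x : Finset ℕ × Finset ℕ} (hx : IsCell N K x) :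
    (cellHull K q x).Nonempty := by
  simpa [cellHull] using hK.edgeSet_nonempty hx

theorem cellHull_subset_iff (hK : IsComplex N K) (h : IsTruncation N K q g D)
    {x y : Finset ℕ × Finset ℕ} (hx : IsCell N K x) (hy : IsCell N K y) :
    cellHull K q x ⊆ cellHull K q y ↔ y.1 ⊆ x.1 ∧ x.2 ⊆ y.2 := by
  rw [cellHull, cellHull, h.convexHull_subset_iff (hK.isClosedSet_edgeSet hx)
    (hK.isClosedSet_edgeSet hy), Finset.coe_subset, hK.edgeSet_subset_iff hx hy]

theorem cellHull_injective (hK : IsComplex N K) (h : IsTruncation N K q g D)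
    {x y : Finset ℕ × Finset ℕ} (hx : IsCell N K x) (hy : IsCell N K y)
    (hxy : cellHull K q x = cellHull K q y) : x = y := by
  obtain ⟨h1, h2⟩ := (h.cellHull_subset_iff hK hx hy).1 hxy.le
  obtain ⟨h3, h4⟩ := (h.cellHull_subset_iff hK hy hx).1 hxy.ge
  exact Prod.ext (h3.antisymm h1) (h2.antisymm h4)

theorem dim_lt (hK : IsComplex N K) (h : IsTruncation N K q g D) {x y : Finset ℕ × Finset ℕ}
    (hx : IsCell N K x) (hy : IsCell N K y) (h1 : y.1 ⊆ x.1) (h2 : x.2 ⊆ y.2) (hne : x ≠ y) :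
    dim (cellHull K q x) < dim (cellHull K q y) :=
  dim_lt_of_isExposed (h.isExposed_cellHull hK hx) (cellHull_nonempty hK hx)
    (h.isExposed_cellHull hK hy).subset (lt_of_le_of_ne ((h.cellHull_subset_iff hK hx hy).2 ⟨h1, h2⟩)
      fun heq => hne (h.cellHull_injective hK hx hy heq))

/-- Dimension increases strictly along chains of cells. Climbing from rank 0 bounds it below by the
rank, descending from rank 4 in 4-space bounds it above. -/
theorem dim_cellHull (hK : IsComplex N K) (h : IsTruncation N K q g D) {j : ℕ} (hj : j < 5)
    {x : Finset ℕ × Finset ℕ} (hx : x ∈ cells N K j) : dim (cellHull K q x) = j := by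
  have low : ∀ j < 5, ∀ x ∈ cells N K j, j ≤ dim (cellHull K q x) := by
    intro j
    induction j with
    | zero => simp
    | succ j ih =>
      intro hj x hx
      obtain ⟨y, hy, h1, h2, hne⟩ := hK.exists_cell_below (by omega) hx
      have := ih (by omega) y hy
      have := h.dim_lt hK (isCell_of_mem_cells hy) (isCell_of_mem_cells hx) h1 h2 hne
      omega
  have up : ∀ i ≤ 4, ∀ x ∈ cells N K (4 - i), dim (cellHull K q x) ≤ 4 - i := by
    intro i
    induction i with
    | zero => intro _ x _; exact dim_le _
    | succ i ih =>
      intro hi x hx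
      obtain ⟨y, hy, h1, h2, hne⟩ := hK.exists_cell_above (by omega) hx
      rw [show 4 - (i + 1) + 1 = 4 - i by omega] at hy
      have := ih (by omega) y hy
      have := h.dim_lt hK (isCell_of_mem_cells hx) (isCell_of_mem_cells hy) h1 h2 hne
      omega
  have := low j hj x hx
  have := up (4 - j) (by omega) x (by rwa [show 4 - (4 - j) = j by omega])
  omega

theorem exists_cell (hK : IsComplex N K) (h : IsTruncation N K q g D) {F : Set (Space 4)}
    (hF : IsExposed ℝ D F) (hF0 : F.Nonempty) :
    ∃ j < 5, ∃ x ∈ cells N K j, F = cellHull K q x := by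
  have h1 := h.eq_convexHull_of_isExposed hF
  obtain ⟨j, hj, x, hx, hS⟩ := hK.exists_cell_of_isClosedSet (h.isClosedSet_of_isExposed hF) (by
    rw [h1] at hF0; simpa using hF0)
  exact ⟨j, hj, x, hx, by rw [h1, hS]; rfl⟩

theorem isFaceOfDim_iff (hK : IsComplex N K) (h : IsTruncation N K q g D) {j : ℕ} (hj : j < 5)
    {F : Set (Space 4)} : IsFaceOfDim D j F ↔ ∃ x ∈ cells N K j, cellHull K q x = F := by
  constructor
  · rintro ⟨hF, hF0, hd⟩
    obtain ⟨i, hi, x, hx, rfl⟩ := h.exists_cell hK hF hF0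
    rw [h.dim_cellHull hK hi hx] at hd
    exact ⟨x, hd ▸ hx, rfl⟩
  · rintro ⟨x, hx, rfl⟩
    have hc := isCell_of_mem_cells hx
    exact ⟨h.isExposed_cellHull hK hc, cellHull_nonempty hK hc, h.dim_cellHull hK hj hx⟩

theorem fNum_eq (hK : IsComplex N K) (h : IsTruncation N K q g D) {j : ℕ} (hj : j < 5) :
    fNum D j = (cells N K j).card := by
  have : {F | IsFaceOfDim D j F} = cellHull K q '' (cells N K j : Set _) := by
    ext F; exact h.isFaceOfDim_iff hK hj
  rw [fNum, this, InjOn.ncard_image, ncard_coe_finset]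
  exact fun x hx y hy hxy =>
    h.cellHull_injective hK (isCell_of_mem_cells hx) (isCell_of_mem_cells hy) hxy

theorem flagNum_eq (hK : IsComplex N K) (h : IsTruncation N K q g D) :
    flagNum D 0 3 = K.card * 6 + (skel K 2).card * 2 := by
  rw [← hK.sum_card_edgeSet]
  have : {F : Set (Space 4) × Set (Space 4) |
      IsFaceOfDim D 0 F.1 ∧ IsFaceOfDim D 3 F.2 ∧ F.1 ⊆ F.2} =
      (fun a : (_ : Finset ℕ × Finset ℕ) × Finset ℕ =>
        (cellHull K q (a.2, a.2), cellHull K q a.1)) ''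
        ((truncFacets N K).sigma fun y => edgeSet K y : Finset _) := by
    ext ⟨F, G⟩
    simp only [mem_ofPred_eq, h.isFaceOfDim_iff hK (show 0 < 5 by norm_num),
      h.isFaceOfDim_iff hK (show 3 < 5 by norm_num)]
    constructor
    · rintro ⟨⟨x, hx, rfl⟩, ⟨y, hy, rfl⟩, hxy⟩
      have hxy := (h.cellHull_subset_iff hK (isCell_of_mem_cells hx) (isCell_of_mem_cells hy)).1 hxy
      obtain ⟨e, he, rfl⟩ := Finset.mem_image.1 hx
      exact ⟨⟨y, e⟩, Finset.mem_coe.2 (Finset.mem_sigma.2 ⟨hy, mem_edgeSet.2 ⟨he, hxy⟩⟩), rfl⟩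
    · rintro ⟨⟨y, e⟩, ha, heq⟩
      obtain ⟨hy, he⟩ := Finset.mem_sigma.1 (Finset.mem_coe.1 ha)
      obtain ⟨rfl, rfl⟩ := Prod.ext_iff.1 heq
      obtain ⟨he, hye⟩ := mem_edgeSet.1 he
      have hx : (e, e) ∈ cells N K 0 := Finset.mem_image.2 ⟨e, he, rfl⟩
      exact ⟨⟨_, hx, rfl⟩, ⟨_, hy, rfl⟩, (h.cellHull_subset_iff hK (isCell_of_mem_cells hx)
        (isCell_of_mem_cells (j := 3) hy)).2 hye⟩
  rw [flagNum, this, InjOn.ncard_image, ncard_coe_finset, Finset.card_sigma]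
  rintro ⟨y, e⟩ ha ⟨y', e'⟩ ha' heq
  obtain ⟨hy, he⟩ := Finset.mem_sigma.1 (Finset.mem_coe.1 ha)
  obtain ⟨hy', he'⟩ := Finset.mem_sigma.1 (Finset.mem_coe.1 ha')
  obtain ⟨h1, h2⟩ := Prod.ext_iff.1 heq
  have e1 := h.cellHull_injective hK (Or.inl ⟨e, (mem_edgeSet.1 he).1, rfl⟩)
    (Or.inl ⟨e', (mem_edgeSet.1 he').1, rfl⟩) h1
  have e2 := h.cellHull_injective hK (isCell_of_mem_cells (j := 3) hy)
    (isCell_of_mem_cells (j := 3) hy') h2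
  simp only [Prod.mk.injEq, and_self] at e1 e2
  rw [e1, e2]

theorem eq_cellHull (hK : IsComplex N K) (h : IsTruncation N K q g D) :
    D = cellHull K q (∅, Finset.range N) := by
  have : edgeSet K (∅, Finset.range N) = skel K 2 := by
    ext e
    rw [mem_edgeSet]
    exact ⟨fun he => he.1, fun he => ⟨he, Finset.empty_subset _, fun i hi =>
      Finset.mem_range.2 (hK.skel_lt he hi)⟩⟩
  rw [cellHull, this]
  exact h.hull

theorem dim_eq (hK : IsComplex N K) (h : IsTruncation N K q g D) : dim D = 4 := by
  rw [h.eq_cellHull hK]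
  exact h.dim_cellHull hK (j := 4) (by norm_num) (by simp [cells])

theorem isPolytope (hK : IsComplex N K) (h : IsTruncation N K q g D) : IsPolytope 4 D := by
  refine ⟨⟨q '' (skel K 2 : Set (Finset ℕ)), (Finset.finite_toSet _).image q, ?_, h.hull⟩,
    h.dim_eq hK⟩
  have := cellHull_nonempty (q := q) hK (isCell_of_mem_cells (N := N) (K := K) (j := 4)
    (x := (∅, Finset.range N)) (by simp [cells]))
  rw [← h.eq_cellHull hK, h.hull] at this
  exact (convexHull_nonempty_iff (𝕜 := ℝ)).1 this

/-- Two adjacent edges of a triangle form a closed set. -/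
theorem isClosedSet_pair (hK : IsComplex N K) {f : Finset ℕ} (hf : f ∈ K) {v w u : ℕ}
    (hv : v ∈ f) (hw : w ∈ f) (hu : u ∈ f) (hvw : v ≠ w) (hvu : v ≠ u) (hwu : w ≠ u) :
    IsClosedSet (skel K 2) (truncFacets N K) (fun e y => y.1 ⊆ e ∧ e ⊆ y.2)
      (({{v, w}, {v, u}} : Finset (Finset ℕ)) : Set (Finset ℕ)) := by
  have hsub : ({v, w, u} : Finset ℕ) ⊆ f := by simp [Finset.insert_subset_iff, hv, hw, hu]
  have ht : ({v, w, u} : Finset ℕ) ∈ skel K 3 :=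
    mem_skel.2 ⟨f, hf, hsub, Finset.card_eq_three.2 ⟨v, w, u, hvw, hvu, hwu, rfl⟩⟩
  have := hK.isClosedSet_edgeSet (x := ({v}, {v, w, u})) (Or.inr ⟨by simp, by simp, Or.inl ht⟩)
  convert this using 2
  ext e
  rw [mem_edgeSet]
  constructor
  · intro he
    rcases Finset.mem_insert.1 he with rfl | he
    · exact ⟨mem_skel.2 ⟨f, hf, by simp [Finset.insert_subset_iff, hv, hw],
        Finset.card_pair hvw⟩, by simp, by simp [Finset.insert_subset_iff]⟩
    · rw [Finset.mem_singleton.1 he]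
      exact ⟨mem_skel.2 ⟨f, hf, by simp [Finset.insert_subset_iff, hv, hu],
        Finset.card_pair hvu⟩, by simp, by simp [Finset.insert_subset_iff]⟩
  · rintro ⟨he, hve, het⟩
    obtain ⟨-, -, -, hec⟩ := mem_skel.1 he
    have hve := Finset.singleton_subset_iff.1 hve
    obtain ⟨x, hx⟩ := Finset.card_eq_one.1
      (by rw [Finset.card_erase_of_mem hve, hec] : (e.erase v).card = 1)
    have hex : e = {v, x} := by rw [← Finset.insert_erase hve, hx]
    have hxm : x ∈ e.erase v := by rw [hx]; simp
    obtain ⟨hxv, hxe⟩ := Finset.mem_erase.1 hxm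
    have := het hxe
    simp only [Finset.mem_insert, Finset.mem_singleton, hxv, false_or] at this
    rcases this with rfl | rfl <;> simp [hex]

/-- A 2-cell consists of the three edges of a triangle, or of the three edges at a vertex of a
tetrahedron. Any two of these share a vertex and so span the edge ({v}, triangle) of the truncation;
hence every subset is closed. -/
theorem isClosedSet_subset (hK : IsComplex N K) {x : Finset ℕ × Finset ℕ} (hx : x ∈ cells N K 2)
    {S : Finset (Finset ℕ)} (hS : S ⊆ edgeSet K x) :
    (edgeSet K x).card = 3 ∧ IsClosedSet (skel K 2) (truncFacets N K)
      (fun e y => y.1 ⊆ e ∧ e ⊆ y.2) (S : Set (Finset ℕ)) := by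
  have hcl := hK.isClosedSet_edgeSet (isCell_of_mem_cells hx)
  have key : (edgeSet K x).card = 3 ∧ ∀ e ∈ edgeSet K x, ∀ e' ∈ edgeSet K x, e ≠ e' →
      ∃ f ∈ K, ∃ v ∈ f, ∃ w ∈ f, ∃ u ∈ f, v ≠ w ∧ v ≠ u ∧ w ≠ u ∧ e = {v, w} ∧ e' = {v, u} := by
    have hpair : ∀ f ∈ K, ∀ e ⊆ f, ∀ e' ⊆ f, e.card = 2 → e'.card = 2 → e ≠ e' →
        (e ∩ e').Nonempty → ∃ f ∈ K, ∃ v ∈ f, ∃ w ∈ f, ∃ u ∈ f, v ≠ w ∧ v ≠ u ∧ w ≠ u ∧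
          e = {v, w} ∧ e' = {v, u} := by
      intro f hf e hef e' hef' hc hc' hne ⟨v, hv⟩
      obtain ⟨hve, hve'⟩ := Finset.mem_inter.1 hv
      obtain ⟨w, hw⟩ := Finset.card_eq_one.1
        (by rw [Finset.card_erase_of_mem hve, hc] : (e.erase v).card = 1)
      obtain ⟨u, hu⟩ := Finset.card_eq_one.1
        (by rw [Finset.card_erase_of_mem hve', hc'] : (e'.erase v).card = 1)
      have hwe := Finset.mem_erase.1 (by rw [hw]; simp : w ∈ e.erase v)
      have hue := Finset.mem_erase.1 (by rw [hu]; simp : u ∈ e'.erase v)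
      have e1 : e = {v, w} := by rw [← Finset.insert_erase hve, hw]
      have e2 : e' = {v, u} := by rw [← Finset.insert_erase hve', hu]
      refine ⟨f, hf, v, hef hve, w, hef hwe.2, u, hef' hue.2, hwe.1.symm, hue.1.symm, ?_, e1, e2⟩
      rintro rfl
      exact hne (e1.trans e2.symm)
    have hcard : ∀ {x e}, e ∈ edgeSet K x → e.card = 2 := fun {x e} he => by
      obtain ⟨-, -, -, h⟩ := mem_skel.1 (mem_edgeSet.1 he).1; exact h
    rcases Finset.mem_union.1 hx with hx | hx
    · obtain ⟨t, ht, rfl⟩ := Finset.mem_image.1 hx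
      obtain ⟨f, hf, htf, htc⟩ := mem_skel.1 ht
      constructor
      · have : edgeSet K (∅, t) = t.powersetCard 2 := by
          ext e
          rw [mem_edgeSet, Finset.mem_powersetCard]
          exact ⟨fun he => ⟨he.2.2, hcard (mem_edgeSet.2 he)⟩, fun he =>
            ⟨mem_skel.2 ⟨f, hf, he.1.trans htf, he.2⟩, Finset.empty_subset _, he.1⟩⟩
        rw [this, Finset.card_powersetCard, htc]; rfl
      · intro e he e' he' hne
        have h1 := (mem_edgeSet.1 he).2.2
        have h2 := (mem_edgeSet.1 he').2.2
        refine hpair f hf e (h1.trans htf) e' (h2.trans htf) (hcard he) (hcard he') hne ?_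
        rw [← Finset.card_pos]
        have := Finset.card_inter_add_card_union e e'
        have := Finset.card_le_card (Finset.union_subset h1 h2)
        rw [hcard he, hcard he'] at *
        dsimp only at *
        omega
    · obtain ⟨f, hf, v, hv, rfl⟩ := mem_vertexFlags.1 hx
      constructor
      · have : edgeSet K ({v}, f) = (f.erase v).image fun w => {v, w} := by
          ext e
          rw [mem_edgeSet, Finset.mem_image]
          constructor
          · rintro ⟨he, hve, hef⟩
            have hve := Finset.singleton_subset_iff.1 hve
            obtain ⟨-, -, -, hec⟩ := mem_skel.1 he
            obtain ⟨w, hw⟩ := Finset.card_eq_one.1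
              (by rw [Finset.card_erase_of_mem hve, hec] : (e.erase v).card = 1)
            have hwe := Finset.mem_erase.1 (by rw [hw]; simp : w ∈ e.erase v)
            exact ⟨w, Finset.mem_erase.2 ⟨hwe.1, hef hwe.2⟩,
              by rw [← Finset.insert_erase hve, hw]⟩
          · rintro ⟨w, hw, rfl⟩
            obtain ⟨hwv, hwf⟩ := Finset.mem_erase.1 hw
            have hsub : ({v, w} : Finset ℕ) ⊆ f := by simp [Finset.insert_subset_iff, hv, hwf]
            exact ⟨mem_skel.2 ⟨f, hf, hsub, Finset.card_pair hwv.symm⟩, by simp, hsub⟩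
        rw [this, Finset.card_image_of_injOn, Finset.card_erase_of_mem hv, hK.card f hf]
        intro a ha b hb hab
        have h1 : a ∈ ({v, b} : Finset ℕ) := by
          rw [← show ({v, a} : Finset ℕ) = {v, b} from hab]; simp
        simpa [(Finset.mem_erase.1 ha).1] using h1
      · intro e he e' he' hne
        obtain ⟨-, h1, h1'⟩ := mem_edgeSet.1 he
        obtain ⟨-, h2, h2'⟩ := mem_edgeSet.1 he'
        exact hpair f hf e h1' e' h2' (hcard he) (hcard he') hne
          ⟨v, Finset.mem_inter.2 ⟨Finset.singleton_subset_iff.1 h1,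
            Finset.singleton_subset_iff.1 h2⟩⟩
  obtain ⟨hc3, hp⟩ := key
  refine ⟨hc3, ?_⟩
  have hSc := Finset.card_le_card hS
  rw [hc3] at hSc
  interval_cases hc : S.card
  · rw [Finset.card_eq_zero.1 hc]; exact Or.inl (by simp)
  · obtain ⟨e, rfl⟩ := Finset.card_eq_one.1 hc
    have he := (mem_edgeSet.1 (hS (Finset.mem_singleton_self e))).1
    have := hK.isClosedSet_edgeSet (x := (e, e)) (Or.inl ⟨e, he, rfl⟩)
    convert this using 2
    ext e'
    rw [mem_edgeSet, Finset.mem_singleton]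
    exact ⟨fun h => by rw [h]; exact ⟨he, subset_rfl, subset_rfl⟩, fun h => h.2.2.antisymm h.2.1⟩
  · obtain ⟨e, e', hne, rfl⟩ := Finset.card_eq_two.1 hc
    obtain ⟨f, hf, v, hv, w, hw, u, hu, h1, h2, h3, rfl, rfl⟩ :=
      hp e (hS (by simp)) e' (hS (by simp)) hne
    exact isClosedSet_pair hK hf hv hw hu h1 h2 h3
  · rw [Finset.eq_of_subset_of_card_le hS (by rw [hc3, hc])]
    exact hcl

theorem isSimplicial (hK : IsComplex N K) (h : IsTruncation N K q g D) : IsSimplicial 2 D := by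
  intro F hF
  obtain ⟨x, hx, hxF⟩ := (h.isFaceOfDim_iff hK (by norm_num)).1 hF
  exact h.nonempty_iic_orderIso (isClosedSet_subset hK hx subset_rfl).1
    (fun S hS => (isClosedSet_subset hK hx hS).2) hxF.symm

/-- The edge ({v}, r) lies in exactly three facets: the two tetrahedra over `r`, by the ridge
condition, and the vertex facet of `v`. -/
theorem isSimple (hK : IsComplex N K) (h : IsTruncation N K q g D) : IsSimple 2 D := by
  intro F hF0 hd
  rw [h.dim_eq hK] at hd
  obtain ⟨x, hx, hxF⟩ := (h.isFaceOfDim_iff hK (j := 1) (by norm_num)).1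
    ⟨F.2, hF0, by omega⟩
  have hxc := isCell_of_mem_cells hx
  obtain ⟨r, hr, v, hv, rfl⟩ := mem_vertexFlags.1 hx
  obtain ⟨f₁, f₂, hne, hf₁₂⟩ := Finset.card_eq_two.1 (hK.ridge r hr)
  have hfr : ∀ f, f ∈ K ∧ r ⊆ f ↔ f = f₁ ∨ f = f₂ := fun f => by
    rw [← Finset.mem_filter, hf₁₂]; simp
  obtain ⟨hf₁, hr₁⟩ := (hfr f₁).2 (Or.inl rfl)
  obtain ⟨hf₂, hr₂⟩ := (hfr f₂).2 (Or.inr rfl)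
  obtain ⟨-, -, -, hrc⟩ := mem_skel.1 hr
  have hvN := hK.lt hf₁ (hr₁ hv)
  have hFI : ∀ y ∈ truncFacets N K,
      (∀ e ∈ skel K 2, q e ∈ F.1 → y.1 ⊆ e ∧ e ⊆ y.2) ↔ y.1 ⊆ {v} ∧ r ⊆ y.2 := by
    intro y hy
    rw [← hK.edgeSet_subset_iff hxc (isCell_of_mem_cells (j := 3) hy)]
    constructor
    · intro hh e he
      have he' := (mem_edgeSet.1 he).1
      refine mem_edgeSet.2 ⟨he', hh e he' ?_⟩
      rw [← hxF]
      exact subset_convexHull ℝ _ ⟨e, he, rfl⟩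
    · intro hh e he heF
      rw [← hxF] at heF
      exact (mem_edgeSet.1 (hh ((h.mem_convexHull_iff (hK.isClosedSet_edgeSet hxc) he).1 heF))).2
  have hd12 : ((∅ : Finset ℕ), f₁) ≠ (∅, f₂) := fun h => hne (Prod.ext_iff.1 h).2
  refine h.nonempty_ici_orderIso (T := {(∅, f₁), (∅, f₂), ({v}, Finset.range N)})
    (Finset.card_eq_three.2 ⟨_, _, _, hd12, by simp, by simp, rfl⟩) hF0 ?_ ?_
  · intro y
    simp only [Finset.mem_insert, Finset.mem_singleton]
    constructor
    · intro hy
      have hyT : y ∈ truncFacets N K := by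
        rcases hy with rfl | rfl | rfl
        · exact mem_truncFacets.2 (Or.inl ⟨_, hf₁, rfl⟩)
        · exact mem_truncFacets.2 (Or.inl ⟨_, hf₂, rfl⟩)
        · exact mem_truncFacets.2 (Or.inr ⟨_, hvN, rfl⟩)
      refine ⟨hyT, (hFI y hyT).2 ?_⟩
      rcases hy with rfl | rfl | rfl
      · exact ⟨by simp, hr₁⟩
      · exact ⟨by simp, hr₂⟩
      · exact ⟨by simp, hr₁.trans (hK.sub f₁ hf₁)⟩
    · rintro ⟨hyT, hy⟩
      obtain ⟨h1, h2⟩ := (hFI y hyT).1 hy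
      rcases mem_truncFacets.1 hyT with ⟨f, hf, rfl⟩ | ⟨w, hw, rfl⟩
      · rcases (hfr f).1 ⟨hf, h2⟩ with rfl | rfl <;> simp
      · right; right
        simpa using h1
  -- Each of the three facets is missed by a vertex lying on the other two. For a tetrahedron this
  -- is the edge from `v` to the apex of the other one; for the vertex facet it is the edge of `r`
  -- opposite `v`.
  · have hedge : ∀ f ∈ K, ∀ f' ∈ K, f ≠ f' → r ⊆ f → r ⊆ f' →
        ∃ e ∈ skel K 2, v ∈ e ∧ e ⊆ f' ∧ ¬ e ⊆ f := by
      intro f hf f' hf' hne' hrf hrf'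
      obtain ⟨u, huf', huf⟩ : ∃ u ∈ f', u ∉ f := by
        by_contra! hcon
        exact hne' (Finset.eq_of_subset_of_card_le hcon
          (by rw [hK.card f hf, hK.card f' hf'])).symm
      have hvu : v ≠ u := fun h' => huf (h' ▸ hrf hv)
      have hsub : ({v, u} : Finset ℕ) ⊆ f' := by
        simp [Finset.insert_subset_iff, hrf' hv, huf']
      exact ⟨{v, u}, mem_skel.2 ⟨f', hf', hsub, Finset.card_pair hvu⟩, by simp, hsub,
        fun h' => huf (h' (by simp))⟩
    intro y hy
    simp only [Finset.mem_insert, Finset.mem_singleton] at hy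
    rcases hy with rfl | rfl | rfl
    · obtain ⟨e, he, hve, h1, h2⟩ := hedge f₁ hf₁ f₂ hf₂ hne hr₁ hr₂
      refine ⟨e, he, fun y hy hy' => ?_, fun h' => h2 h'.2⟩
      simp only [Finset.mem_insert, Finset.mem_singleton] at hy
      rcases hy with rfl | rfl | rfl
      · exact absurd rfl hy'
      · exact ⟨Finset.empty_subset _, h1⟩
      · exact ⟨by simpa using hve, h1.trans (hK.sub f₂ hf₂)⟩
    · obtain ⟨e, he, hve, h1, h2⟩ := hedge f₂ hf₂ f₁ hf₁ hne.symm hr₂ hr₁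
      refine ⟨e, he, fun y hy hy' => ?_, fun h' => h2 h'.2⟩
      simp only [Finset.mem_insert, Finset.mem_singleton] at hy
      rcases hy with rfl | rfl | rfl
      · exact ⟨Finset.empty_subset _, h1⟩
      · exact absurd rfl hy'
      · exact ⟨by simpa using hve, h1.trans (hK.sub f₁ hf₁)⟩
    · have hec : (r.erase v).card = 2 := by rw [Finset.card_erase_of_mem hv, hrc]
      have her : r.erase v ⊆ r := Finset.erase_subset _ _
      refine ⟨r.erase v, mem_skel.2 ⟨f₁, hf₁, her.trans hr₁, hec⟩, fun y hy hy' => ?_,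
        fun h' => Finset.notMem_erase v r (by simpa using h'.1)⟩
      simp only [Finset.mem_insert, Finset.mem_singleton] at hy
      rcases hy with rfl | rfl | rfl
      · exact ⟨Finset.empty_subset _, her.trans hr₁⟩
      · exact ⟨Finset.empty_subset _, her.trans hr₂⟩
      · exact absurd rfl hy'

/-- The total number of faces. -/
theorem natCard_faceLattice (hK : IsComplex N K) (h : IsTruncation N K q g D) :
    Nat.card (FaceLattice D) = 1 + ∑ j ∈ Finset.range 5, (cells N K j).card := by
  classical
  have hset : {F | IsExposed ℝ D F} = insert ∅ (cellHull K q ''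
      ((Finset.range 5).biUnion (cells N K) : Set _)) := by
    ext F
    constructor
    · intro hF
      rcases F.eq_empty_or_nonempty with rfl | hF0
      · exact mem_insert _ _
      · obtain ⟨j, hj, x, hx, rfl⟩ := h.exists_cell hK hF hF0
        exact Or.inr ⟨x, Finset.mem_coe.2
          (Finset.mem_biUnion.2 ⟨j, Finset.mem_range.2 hj, hx⟩), rfl⟩
    · rintro (rfl | ⟨x, hx, rfl⟩)
      · exact isExposed_empty
      · obtain ⟨j, -, hx⟩ := Finset.mem_biUnion.1 (Finset.mem_coe.1 hx)
        exact h.isExposed_cellHull hK (isCell_of_mem_cells hx)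
  change Nat.card ({F | IsExposed ℝ D F} : Set _) = _
  rw [Nat.card_coe_set_eq, hset, ncard_insert_of_notMem _ ((Finset.finite_toSet _).image _),
    InjOn.ncard_image, ncard_coe_finset, Finset.card_biUnion, add_comm]
  · intro i hi j hj hij
    refine Finset.disjoint_left.2 fun x hx hx' => hij ?_
    rw [← h.dim_cellHull hK (Finset.mem_range.1 hi) hx,
      h.dim_cellHull hK (Finset.mem_range.1 hj) hx']
  · intro x hx y hy hxy
    obtain ⟨i, -, hx⟩ := Finset.mem_biUnion.1 (Finset.mem_coe.1 hx)
    obtain ⟨j, -, hy⟩ := Finset.mem_biUnion.1 (Finset.mem_coe.1 hy)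
    exact h.cellHull_injective hK (isCell_of_mem_cells hx) (isCell_of_mem_cells hy) hxy
  · rintro ⟨x, hx, h0⟩
    obtain ⟨j, -, hx⟩ := Finset.mem_biUnion.1 (Finset.mem_coe.1 hx)
    exact (cellHull_nonempty hK (isCell_of_mem_cells hx)).ne_empty h0

end IsTruncation

end TruncationFaces

/-! ### Rational realizations by induction along the stackings -/

section Rational

/-- The rational numbers inside the reals. -/
noncomputable def ratField : Subfield ℝ := (Rat.castHom ℝ).fieldRange

/-- A point with rational coordinates. -/
def IsRatPoint (x : Space 4) : Prop := ∀ i, x i ∈ ratField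

/-- An affine functional that takes rational values at rational points. -/
def IsRatFunctional (φ : Space 4 →ᵃ[ℝ] ℝ) : Prop := ∀ x, IsRatPoint x → φ x ∈ ratField

theorem ratCast_mem (q : ℚ) : (q : ℝ) ∈ ratField := ⟨q, rfl⟩

theorem isRational_of_forall {P : Set (Space 4)} (h : ∀ v ∈ vertices P, IsRatPoint v) :
    IsRational P := fun v hv i => by
  obtain ⟨q, hq⟩ := h v hv i
  exact ⟨q, hq.symm⟩

theorem IsRatPoint.add {x y : Space 4} (hx : IsRatPoint x) (hy : IsRatPoint y) :
    IsRatPoint (x + y) := fun i => by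
  rw [PiLp.add_apply]; exact add_mem (hx i) (hy i)

theorem IsRatPoint.smul {c : ℝ} (hc : c ∈ ratField) {x : Space 4} (hx : IsRatPoint x) :
    IsRatPoint (c • x) := fun i => by
  rw [PiLp.smul_apply]; exact mul_mem hc (hx i)

theorem IsRatPoint.sub {x y : Space 4} (hx : IsRatPoint x) (hy : IsRatPoint y) :
    IsRatPoint (x - y) := fun i => by
  rw [PiLp.sub_apply]; exact sub_mem (hx i) (hy i)

theorem IsRatPoint.sum {γ : Type*} {s : Finset γ} {x : γ → Space 4}
    (hx : ∀ k ∈ s, IsRatPoint (x k)) : IsRatPoint (∑ k ∈ s, x k) := by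
  classical
  induction s using Finset.induction_on with
  | empty => intro i; simp
  | insert a s ha ih =>
    rw [Finset.sum_insert ha]
    exact (hx a (by simp)).add (ih fun k hk => hx k (by simp [hk]))

theorem IsRatFunctional.smul {c : ℝ} (hc : c ∈ ratField) {φ : Space 4 →ᵃ[ℝ] ℝ}
    (hφ : IsRatFunctional φ) : IsRatFunctional (c • φ) := fun x hx => by
  exact mul_mem hc (hφ x hx)

theorem IsRatFunctional.sub {φ ψ : Space 4 →ᵃ[ℝ] ℝ} (hφ : IsRatFunctional φ)
    (hψ : IsRatFunctional ψ) : IsRatFunctional (φ - ψ) := fun x hx => by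
  exact sub_mem (hφ x hx) (hψ x hx)

theorem IsRatFunctional.sum {γ : Type*} {s : Finset γ} {φ : γ → Space 4 →ᵃ[ℝ] ℝ}
    (hφ : ∀ k ∈ s, IsRatFunctional (φ k)) : IsRatFunctional (∑ k ∈ s, φ k) := fun x hx => by
  rw [affineMap_sum_apply]
  exact sum_mem fun k hk => hφ k hk x hx

variable {N : ℕ} {K : Finset (Finset ℕ)} {p : ℕ → Space 4} {g : Finset ℕ → Space 4 →ᵃ[ℝ] ℝ}
  {P : Set (Space 4)} {A : ℕ → Space 4 →ᵃ[ℝ] ℝ}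

theorem Truncates.isRatPoint_edgePoint (hK : IsComplex N K) (hA : Truncates N K p A)
    (hp : ∀ i < N, IsRatPoint (p i)) (hAr : ∀ u < N, IsRatFunctional (A u)) {u w : ℕ} (huw : u ≠ w)
    (he : {u, w} ∈ skel K 2) {x : Space 4} (hx : IsEdgePoint p A u w x) : IsRatPoint x := by
  have hu := hK.skel_lt he (u := u) (by simp)
  have hw := hK.skel_lt he (u := w) (by simp)
  have a1 := hA.neg u hu
  have a2 := hA.pos u hu w hw huw.symm
  obtain ⟨c, -, -, rfl, hc, -⟩ := hx
  rw [affineMap_lineMap] at hc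
  have hc' : c = -A u (p u) / (A u (p w) - A u (p u)) := by
    rw [eq_div_iff (by linarith)]; linarith
  have hcr : c ∈ ratField := by
    rw [hc']
    exact div_mem (neg_mem (hAr u hu _ (hp u hu)))
      (sub_mem (hAr u hu _ (hp w hw)) (hAr u hu _ (hp u hu)))
  rw [AffineMap.lineMap_apply, vsub_eq_sub, vadd_eq_add]
  exact (((hp w hw).sub (hp u hu)).smul hcr).add (hp u hu)

/-- A realization of a stacked complex with a vertex truncation, all of whose data are rational. -/
structure IsRatRealization (n : ℕ) (K : Finset (Finset ℕ)) (p : ℕ → Space 4)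
    (g : Finset ℕ → Space 4 →ᵃ[ℝ] ℝ) (P : Set (Space 4)) (A : ℕ → Space 4 →ᵃ[ℝ] ℝ) : Prop where
  stacked : IsStacked n P
  realizes : Realizes (n + 5) K p g P
  truncates : Truncates (n + 5) K p A
  rat_point : ∀ i < n + 5, IsRatPoint (p i)
  rat_facet : ∀ f ∈ K, IsRatFunctional (g f)
  rat_trunc : ∀ u < n + 5, IsRatFunctional (A u)

/-- The standard simplex. -/
theorem exists_affineBasis_isRatPoint : ∃ b : AffineBasis (Fin 5) ℝ (Space 4),
    (∀ i, IsRatPoint (b i)) ∧ ∀ i, IsRatFunctional (b.coord i) := by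
  let v : Fin 5 → Space 4 := Fin.cons 0 fun i => EuclideanSpace.single i 1
  have hv : AffineIndependent ℝ v := by
    rw [affineIndependent_iff_linearIndependent_vsub ℝ v 0]
    refine (linearIndependent_equiv (finSuccAboveEquiv (0 : Fin 5))).1 ?_
    have hfun : (fun x : {x : Fin 5 // x ≠ 0} => v x -ᵥ v 0) ∘ finSuccAboveEquiv (0 : Fin 5) =
        EuclideanSpace.basisFun (Fin 4) ℝ := by
      ext i : 1
      simp [v, finSuccAboveEquiv]
    rw [hfun]
    exact (EuclideanSpace.basisFun (Fin 4) ℝ).orthonormal.linearIndependent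
  let b : AffineBasis (Fin 5) ℝ (Space 4) :=
    ⟨v, hv, hv.affineSpan_eq_top_iff_card_eq_finrank_add_one.2 (by simp)⟩
  have hb : ∀ i, b i = v i := fun i => rfl
  -- For the standard simplex four barycentric coordinates are the Cartesian ones; the fifth is one
  -- minus their sum.
  have hsucc : ∀ (x : Space 4) (i : Fin 4), b.coord i.succ x = x i := fun x i => by
    have := congrArg (fun y : Space 4 => y i) (b.linear_combination_coord_eq_self x)
    simp only [Fin.sum_univ_succ (n := 4), hb, v, Fin.cons_zero, Fin.cons_succ] at this
    simpa [Pi.single_apply] using this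
  refine ⟨b, fun i => ?_, fun i x hx => ?_⟩
  · refine Fin.cases ?_ (fun i => ?_) i
    · intro j; simp [hb, v]
    · intro j
      simp only [hb, v, Fin.cons_succ, PiLp.single_apply]
      split_ifs
      · exact one_mem _
      · exact zero_mem _
  · refine Fin.cases ?_ (fun i => ?_) i
    · have := b.sum_coord_apply_eq_one x
      rw [Fin.sum_univ_succ] at this
      rw [eq_sub_of_add_eq this]
      exact sub_mem (one_mem _) (sum_mem fun i _ => by rw [hsucc]; exact hx i)
    · rw [hsucc]; exact hx i

theorem exists_isRatRealization_simplex :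
    ∃ p g P A, IsRatRealization 0 ((Finset.range 5).powersetCard 4) p g P A := by
  obtain ⟨b, hb, hbc⟩ := exists_affineBasis_isRatPoint
  -- These functionals cut every edge of the simplex at its midpoint.
  have hA : ∀ u w : ℕ, (AffineMap.const ℝ (Space 4) (1 / 2 : ℝ) - b.coord (Fin.ofNat 5 u))
      (b (Fin.ofNat 5 w)) = 1 / 2 - if Fin.ofNat 5 u = Fin.ofNat 5 w then 1 else 0 := fun u w => by
    simp [b.coord_apply]
  have hne : ∀ u < 5, ∀ w < 5, u ≠ w → Fin.ofNat 5 u ≠ Fin.ofNat 5 w := by decide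
  refine ⟨_, _, _, fun u => AffineMap.const ℝ (Space 4) (1 / 2 : ℝ) - b.coord (Fin.ofNat 5 u),
    .simplex b b.ind, Realizes.simplex b, ⟨?_, ?_, ?_⟩, fun i _ => hb _, fun f _ => hbc _, ?_⟩
  · intro u _
    rw [hA, if_pos rfl]; norm_num
  · intro u hu w hw hwu
    rw [hA, if_neg (hne u hu w hw hwu.symm)]; norm_num
  · intro u w huw he
    have hK := StackedComplex.simplex.isComplex
    have hu : u < 5 := hK.skel_lt he (by simp)
    have hw : w < 5 := hK.skel_lt he (by simp)
    rw [hA, hA, hA, hA, if_pos rfl, if_pos rfl, if_neg (hne u hu w hw huw),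
      if_neg (hne w hw u hu huw.symm)]
    norm_num
  · intro u _ x hx
    change (1 / 2 : ℝ) - _ ∈ ratField
    exact sub_mem (by simp) (hbc _ x hx)

/-- A rational point beyond exactly one facet that is not cut off by the truncation. -/
theorem exists_isRatPoint_beyond (hK : IsComplex N K) (h : Realizes N K p g P)
    (hA : Truncates N K p A) (hp : ∀ i < N, IsRatPoint (p i))
    (hAr : ∀ u < N, IsRatFunctional (A u)) {f : Finset ℕ} (hf : f ∈ K) :
    ∃ v, IsRatPoint v ∧ g f v < 0 ∧ (∀ e ∈ K, e ≠ f → 0 < g e v) ∧ ∀ u < N, 0 < A u v := by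
  obtain ⟨q, hq, hD⟩ := hA.hvRep hK h
  have hfc := hK.card f hf
  let E := f.powersetCard 2
  have hE : ∀ e ∈ E, e ∈ skel K 2 ∧ e ⊆ f := fun e he => by
    obtain ⟨hef, hec⟩ := Finset.mem_powersetCard.1 he
    exact ⟨mem_skel.2 ⟨f, hf, hef, hec⟩, hef⟩
  have hE' : ∀ b ⊆ f, b.card ≤ 2 → ∀ s ⊆ f, b ⊆ s → 2 ≤ s.card → ∃ e ∈ E, b ⊆ e ∧ e ⊆ s := by
    intro b _ hb s hs hbs hs2
    obtain ⟨e, hbe, hes, hec⟩ := Finset.exists_subsuperset_card_eq hbs hb hs2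
    exact ⟨e, Finset.mem_powersetCard.2 ⟨hes.trans hs, hec⟩, hbe, hes⟩
  have hEc : E.card = 6 := by rw [Finset.card_powersetCard, hfc]; rfl
  -- The barycentre of the six edge points on `f` lies on `f` but on no other facet of the
  -- truncation, since each of those misses one of the six points.
  let x : Space 4 := ∑ e ∈ E, (1 / 6 : ℝ) • q e
  have hφx : ∀ φ : Space 4 →ᵃ[ℝ] ℝ, φ x = ∑ e ∈ E, (1 / 6 : ℝ) * φ (q e) := fun φ =>
    affineMap_sum φ E _ _ (by rw [Finset.sum_const, hEc]; norm_num)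
  have hqr : ∀ e ∈ E, IsRatPoint (q e) := fun e he => by
    obtain ⟨u, w, huw, rfl⟩ := skel_two (hE e he).1
    exact hA.isRatPoint_edgePoint hK hp hAr huw (hE _ he).1 (hq u w huw (hE _ he).1)
  have hxr : IsRatPoint x := IsRatPoint.sum fun e he =>
    (hqr e he).smul (by simp)
  have hfx : g f x = 0 := by
    rw [hφx]
    refine Finset.sum_eq_zero fun e he => ?_
    have := (hD.inc e (hE e he).1 (∅, f) (mem_truncFacets.2 (Or.inl ⟨f, hf, rfl⟩))).2
      ⟨Finset.empty_subset _, (hE e he).2⟩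
    rw [show truncFunctional g A (∅, f) = g f from if_pos rfl] at this
    rw [this, mul_zero]
  have hpos : ∀ y ∈ (truncFacets N K).erase (∅, f), 0 < truncFunctional g A y x := by
    intro y hy
    obtain ⟨hyf, hyT⟩ := Finset.mem_erase.1 hy
    rw [hφx]
    have hex : ∃ e ∈ E, ¬ (y.1 ⊆ e ∧ e ⊆ y.2) := by
      rcases mem_truncFacets.1 hyT with ⟨f', hf', rfl⟩ | ⟨w, hw, rfl⟩
      · obtain ⟨i, hi, hif'⟩ : ∃ i ∈ f, i ∉ f' := by
          by_contra! hcon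
          exact hyf (by rw [Finset.eq_of_subset_of_card_le hcon
            (by rw [hfc, hK.card f' hf'])])
        obtain ⟨e, he, hie, -⟩ := hE' {i} (by simpa using hi) (by simp) f subset_rfl
          (by simpa using hi) (by omega)
        exact ⟨e, he, fun h' => hif' (h'.2 (Finset.singleton_subset_iff.1 hie))⟩
      · obtain ⟨e, he, -, hef⟩ := hE' ∅ (by simp) (by simp) (f.erase w) (Finset.erase_subset _ _)
          (by simp) (by have := Finset.pred_card_le_card_erase (s := f) (a := w); omega)
        exact ⟨e, he, fun h' => Finset.notMem_erase w f
          (hef (Finset.singleton_subset_iff.1 h'.1))⟩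
    obtain ⟨e, he, hne⟩ := hex
    refine Finset.sum_pos' (fun e he => ?_) ⟨e, he, ?_⟩
    · have := hD.nonneg (hD.mem (hE e he).1) hyT
      positivity
    · have := hD.pos (hE e he).1 hyT hne
      positivity
  obtain ⟨i, hi, hif⟩ := hK.exists_notMem hf
  have hgi := h.pos (Finset.mem_range.2 hi) hf hif
  -- A small rational step from `x` away from a vertex off `f` crosses `f` and keeps the other
  -- inequalities, including all cuts, strict.
  obtain ⟨ε, hε, hε'⟩ := exists_pos_forall_add_mul_pos ((truncFacets N K).erase (∅, f))
    (fun y => truncFunctional g A y x) (fun y => (truncFunctional g A y).linear (x - p i)) hpos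
  obtain ⟨c, hc0, hcε⟩ := exists_rat_btwn hε
  have hlin : ∀ φ : Space 4 →ᵃ[ℝ] ℝ, φ.linear (x - p i) = φ x - φ (p i) := fun φ => by
    have := φ.linearMap_vsub x (p i)
    simpa using this
  have hv : ∀ y ∈ truncFacets N K, y ≠ (∅, f) → 0 < truncFunctional g A y (x + (c : ℝ) • (x - p i)) :=
    fun y hy hyf => by
      rw [affineMap_add_smul]
      exact hε' c (by rw [abs_of_pos hc0]; exact hcε.le) y (Finset.mem_erase.2 ⟨hyf, hy⟩)
  refine ⟨x + (c : ℝ) • (x - p i), hxr.add ((hxr.sub (hp i hi)).smul (ratCast_mem c)), ?_, ?_, ?_⟩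
  · rw [affineMap_add_smul, hlin, hfx]
    nlinarith
  · intro e he hef
    have := hv (∅, e) (mem_truncFacets.2 (Or.inl ⟨e, he, rfl⟩)) fun h' => hef (Prod.ext_iff.1 h').2
    rwa [show truncFunctional g A (∅, e) = g e from if_pos rfl] at this
  · intro u hu
    have := hv ({u}, Finset.range N) (mem_truncFacets.2 (Or.inr ⟨u, hu, rfl⟩)) (by simp)
    simpa [truncFunctional] using this

/-- A truncation extends over a stacking by a point that is not cut off. -/
theorem Truncates.exists_stack (hK : IsComplex N K) (h : Realizes N K p g P)
    (hA : Truncates N K p A) (hp : ∀ i < N, IsRatPoint (p i))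
    (hg : ∀ e ∈ K, IsRatFunctional (g e)) (hAr : ∀ u < N, IsRatFunctional (A u)) {f : Finset ℕ}
    (hf : f ∈ K) {v : Space 4} (hvr : IsRatPoint v) (hv : g f v < 0)
    (hv' : ∀ e ∈ K, e ≠ f → 0 < g e v) (hvA : ∀ u < N, 0 < A u v) :
    ∃ φ : Space 4 →ᵃ[ℝ] ℝ, IsRatFunctional φ ∧
      Truncates (N + 1) (stackFacets K f N) (Function.update p N v) (Function.update A N φ) := by
  obtain ⟨ψ, hψv, hψ0, hψw, hψP, -, hψg⟩ := h.exists_dual hK hf hv hv'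
  have hpf : ∀ w ∈ f, g f (p w) = 0 := fun w hw => (h.inc w (hK.sub f hf hw) f hf).2 hw
  -- With value -1 at `v`, the equation on the edge from `v` to `w` forces this value at `p w`. It
  -- is positive since `v` is not cut off.
  let a : ℕ → ℝ := fun w => -A w (p w) / A w v
  have ha : ∀ w ∈ f, 0 < a w := fun w hw =>
    div_pos (neg_pos.2 (hA.neg w (hK.lt hf hw))) (hvA w (hK.lt hf hw))
  -- The affine interpolation of -1 at `v` and `a w` at `p w`, written in the basis dual to these
  -- five points. All summands are nonnegative on `P`, and the last one is positive at vertices off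
  -- `f`.
  let φ : Space 4 →ᵃ[ℝ] ℝ := ∑ w ∈ f, (a w / ψ w (p w)) • ψ w - (1 / g f v) • g f
  have hφ : ∀ x, φ x = ∑ w ∈ f, a w / ψ w (p w) * ψ w x - 1 / g f v * g f x := fun x => by
    change (∑ w ∈ f, (a w / ψ w (p w)) • ψ w) x - 1 / g f v * g f x = _
    rw [affineMap_sum_apply]
    rfl
  have hφv : φ v = -1 := by
    rw [hφ, Finset.sum_eq_zero fun w _ => by rw [hψv, mul_zero], zero_sub,
      one_div_mul_cancel hv.ne]
  have hφw : ∀ w ∈ f, φ (p w) = a w := fun w hw => by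
    rw [hφ, hpf w hw, mul_zero, sub_zero, Finset.sum_eq_single w
      (fun w' hw' hne => by rw [hψ0 w' hw' w hw hne.symm, mul_zero]) (fun h' => absurd hw h'),
      div_mul_cancel₀ _ (hψw w hw).ne']
  have hφi : ∀ i < N, 0 < φ (p i) := fun i hi => by
    by_cases hif : i ∈ f
    · rw [hφw i hif]; exact ha i hif
    · have hi' := Finset.mem_range.2 hi
      have h1 := h.pos hi' hf hif
      have h2 : 0 ≤ ∑ w ∈ f, a w / ψ w (p w) * ψ w (p i) := Finset.sum_nonneg fun w hw =>
        mul_nonneg (div_pos (ha w hw) (hψw w hw)).le (hψP w hw _ (h.mem hi'))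
      have h3 : 1 / g f v * g f (p i) < 0 := mul_neg_of_neg_of_pos (one_div_neg.2 hv) h1
      rw [hφ]; linarith
  have hψr : ∀ w ∈ f, IsRatFunctional (ψ w) := fun w hw => by
    obtain ⟨e, he, heq⟩ := hψg w hw
    rw [heq]
    exact ((hg f hf).smul (hg e he v hvr)).sub ((hg e he).smul (hg f hf v hvr))
  have har : ∀ w ∈ f, a w ∈ ratField := fun w hw =>
    div_mem (neg_mem (hAr w (hK.lt hf hw) _ (hp w (hK.lt hf hw)))) (hAr w (hK.lt hf hw) _ hvr)
  refine ⟨φ, (IsRatFunctional.sum fun w hw => (hψr w hw).smul (div_mem (har w hw)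
    (hψr w hw _ (hp w (hK.lt hf hw))))).sub ((hg f hf).smul (div_mem (one_mem _) (hg f hf v hvr))),
    ?_, ?_, ?_⟩
  · intro u hu
    rcases Nat.lt_succ_iff_lt_or_eq.1 hu with hu | rfl
    · rw [Function.update_of_ne hu.ne, Function.update_of_ne hu.ne]; exact hA.neg u hu
    · rw [Function.update_self, Function.update_self, hφv]; norm_num
  · intro u hu w hw hwu
    rcases Nat.lt_succ_iff_lt_or_eq.1 hu with hu | rfl
    · rw [Function.update_of_ne hu.ne]
      rcases Nat.lt_succ_iff_lt_or_eq.1 hw with hw | rfl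
      · rw [Function.update_of_ne hw.ne]; exact hA.pos u hu w hw hwu
      · rw [Function.update_self]; exact hvA u hu
    · have hw : w < u := by omega
      rw [Function.update_self, Function.update_of_ne hw.ne]
      exact hφi w hw
  · have key : ∀ w ∈ f, φ v * A w (p w) = φ (p w) * A w v := fun w hw => by
      have := (hvA w (hK.lt hf hw)).ne'
      rw [hφv, hφw w hw, div_mul_cancel₀ _ this]; ring
    intro u w huw he
    rw [hK.skel_stackFacets hf (by norm_num)] at he
    rcases Finset.mem_union.1 he with he | he
    · have hu := hK.skel_lt he (u := u) (by simp)
      have hw := hK.skel_lt he (u := w) (by simp)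
      rw [Function.update_of_ne hu.ne, Function.update_of_ne hw.ne, Function.update_of_ne hu.ne,
        Function.update_of_ne hw.ne]
      exact hA.compat u w huw he
    · obtain ⟨s, hs, heq⟩ := Finset.mem_image.1 he
      obtain ⟨hsf, hsc⟩ := Finset.mem_powersetCard.1 hs
      obtain ⟨i, rfl⟩ := Finset.card_eq_one.1 hsc
      have hif : i ∈ f := Finset.singleton_subset_iff.1 hsf
      have hi := (hK.lt hf hif).ne
      rcases Set.pair_eq_pair_iff.1 (by simpa using congrArg (fun s : Finset ℕ => (s : Set ℕ)) heq :
        ({N, i} : Set ℕ) = {u, w}) with ⟨rfl, rfl⟩ | ⟨rfl, rfl⟩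
      · rw [Function.update_self, Function.update_self, Function.update_of_ne hi,
          Function.update_of_ne hi]
        exact key i hif
      · rw [Function.update_self, Function.update_self, Function.update_of_ne hi,
          Function.update_of_ne hi]
        linarith [key i hif]

theorem StackedComplex.exists_isRatRealization {n : ℕ} {K : Finset (Finset ℕ)}
    (hS : StackedComplex n K) : ∃ p g P A, IsRatRealization n K p g P A := by
  induction hS with
  | simplex => exact exists_isRatRealization_simplex
  | stack n K f hS hf ih =>
    obtain ⟨p, g, P, A, h⟩ := ih
    have hK := hS.isComplex
    have hR := h.realizes
    obtain ⟨v, hvr, hv, hv', hvA⟩ := exists_isRatPoint_beyond hK hR h.truncates h.rat_point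
      h.rat_trunc hf
    obtain ⟨g', hg', hgr⟩ := hR.stack hK hf hv hv'
    obtain ⟨φ, hφr, hφ⟩ := h.truncates.exists_stack hK hR h.rat_point h.rat_facet h.rat_trunc hf
      hvr hv hv' hvA
    refine ⟨_, g', _, _, ?_, hg', hφ, ?_, ?_, ?_⟩
    · refine .stack n P _ v h.stacked (hR.isFacet hK hf) (hR.isBeyond hK hf hv) ?_
      intro G hG hGf
      obtain ⟨e, he, rfl⟩ := hR.exists_of_isFacet hK hG
      exact hR.isBeneath hK he (hv' e he fun hef => hGf (by rw [hef]))
    · intro i hi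
      by_cases hin : i = n + 5
      · rw [hin, Function.update_self]; exact hvr
      · rw [Function.update_of_ne hin]; exact h.rat_point i (by omega)
    · intro e he
      rcases hgr e he with ⟨heK, heq⟩ | ⟨e₁, he₁, e₂, he₂, heq⟩
      · rw [heq]; exact h.rat_facet e heK
      · rw [heq]
        exact ((h.rat_facet e₂ he₂).smul (h.rat_facet e₁ he₁ v hvr)).sub
          ((h.rat_facet e₁ he₁).smul (h.rat_facet e₂ he₂ v hvr))
    · intro u hu
      by_cases hun : u = n + 5
      · rw [hun, Function.update_self]; exact hφr
      · rw [Function.update_of_ne hun]; exact h.rat_trunc u (by omega)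

theorem IsRatRealization.isRational {n : ℕ} (hK : IsComplex (n + 5) K)
    (h : IsRatRealization n K p g P A) : IsRational P :=
  isRational_of_forall fun x hx => by
    rw [h.realizes.vertices_eq hK] at hx
    obtain ⟨i, hi, rfl⟩ := hx
    exact h.rat_point i (Finset.mem_range.1 hi)

theorem IsRatRealization.isRational_truncation {n : ℕ} (hK : IsComplex (n + 5) K)
    (h : IsRatRealization n K p g P A) : IsRational (truncation (n + 5) A P) :=
  isRational_of_forall fun x hx => by
    obtain ⟨q, hq, hD⟩ := h.truncates.hvRep hK h.realizes
    obtain ⟨e, he, rfl⟩ := hD.vertices_subset hx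
    obtain ⟨u, w, huw, rfl⟩ := skel_two he
    exact h.truncates.isRatPoint_edgePoint hK h.rat_point h.rat_trunc huw he (hq u w huw he)

end Rational

end Polytope

theorem mainTheorem9 :
    -- every vertex truncation of a stacked 4-polytope is a 2-simplicial 2-simple 4-polytope
    -- with the stated flag vector
    (∀ (n : ℕ) (P D : Set (Space 4)),
      Polytope.IsStacked n P → Polytope.IsVertexTruncation P D →
        Polytope.IsPolytope 4 D ∧
        Polytope.IsSimplicial 2 D ∧ Polytope.IsSimple 2 D ∧
        Polytope.fNum D 0 = 10 + 4 * n ∧ Polytope.fNum D 1 = 30 + 18 * n ∧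
        Polytope.fNum D 2 = 30 + 18 * n ∧ Polytope.fNum D 3 = 10 + 4 * n ∧
        Polytope.flagNum D 0 3 = 50 + 26 * n) ∧
    -- every combinatorial type of stacked 4-polytopes has a rational realization with a
    -- rational vertex truncation
    (∀ (n : ℕ) (S : Set (Space 4)), Polytope.IsStacked n S →
      ∃ P D : Set (Space 4), Polytope.IsStacked n P ∧ Polytope.CombEquiv P S ∧
        Polytope.IsRational P ∧ Polytope.IsVertexTruncation P D ∧ Polytope.IsRational D) ∧
    -- for every `n` there is such a truncation, and they are combinatorially distinct
    (∃ P D : ℕ → Set (Space 4),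
      (∀ n, Polytope.IsStacked n (P n) ∧ Polytope.IsVertexTruncation (P n) (D n) ∧
        Polytope.IsRational (D n)) ∧
      ∀ m n, m ≠ n → ¬ Polytope.CombEquiv (D m) (D n)) := by
  refine ⟨fun n P D hP hD => ?_, fun n S hS => ?_, ?_⟩
  · obtain ⟨K, p, g, hS, h⟩ := hP.exists_realizes
    have hK := hS.isComplex
    obtain ⟨A, hA, rfl⟩ := hD.exists_truncates hK h
    obtain ⟨q, -, hq⟩ := hA.hvRep hK h
    obtain ⟨c0, c1, c2, c3, -⟩ := hK.card_cells
    obtain ⟨k3, k1, k2⟩ := hS.card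
    refine ⟨hq.isPolytope hK, hq.isSimplicial hK, hq.isSimple hK, ?_, ?_, ?_, ?_, ?_⟩
    · rw [hq.fNum_eq hK (by norm_num), c0, k1]
    · rw [hq.fNum_eq hK (by norm_num), c1, k2]; ring
    · rw [hq.fNum_eq hK (by norm_num), c2, k2, k3]; ring
    · rw [hq.fNum_eq hK (by norm_num), c3, k3]; ring
    · rw [hq.flagNum_eq hK, k3, k1]; ring
  · obtain ⟨K, p, g, hSK, h⟩ := hS.exists_realizes
    have hK := hSK.isComplex
    obtain ⟨p', g', P, A, hr⟩ := hSK.exists_isRatRealization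
    -- Both polytopes realize the same complex, hence have isomorphic face lattices.
    exact ⟨P, _, hr.stacked, hr.realizes.combEquiv h, hr.isRational hK,
      hr.truncates.isVertexTruncation hK hr.realizes, hr.isRational_truncation hK⟩
  · choose K hK using Polytope.exists_stackedComplex
    choose p g P A hr using fun n => (hK n).exists_isRatRealization
    refine ⟨P, fun n => Polytope.truncation (n + 5) (A n) (P n), fun n => ⟨(hr n).stacked,
      (hr n).truncates.isVertexTruncation (hK n).isComplex (hr n).realizes,
      (hr n).isRational_truncation (hK n).isComplex⟩, ?_⟩
    -- The empty face, f₀+f₁+f₂+f₃ = 80+44n, and the polytope itself.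
    have hcard : ∀ n, Nat.card (Polytope.FaceLattice (Polytope.truncation (n + 5) (A n) (P n))) =
        82 + 44 * n := fun n => by
      obtain ⟨q, -, hq⟩ := (hr n).truncates.hvRep (hK n).isComplex (hr n).realizes
      obtain ⟨c0, c1, c2, c3, c4⟩ := (hK n).isComplex.card_cells
      obtain ⟨k3, k1, k2⟩ := (hK n).card
      rw [hq.natCard_faceLattice (hK n).isComplex]
      simp only [Finset.sum_range_succ, Finset.sum_range_zero, c0, c1, c2, c3, c4, k1, k2, k3]
      ring
    rintro m n hmn ⟨e⟩
    have := Nat.card_congr e.toEquiv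
    rw [hcard, hcard] at this
    omega
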